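/- Let $n\ge 3$, let $\omega\subset\mathbb R^{n-1}$ be a bounded connected open set, $\Omega:=\omega\times\mathbb R$, with points $x=(x',x_n)$, $T>0$, $Q:=\Omega\times(-T,T)$. Let $\omega_3\subsetneq\omega_2\subset\omega$ be open sets with $\partial\omega\subset\partial\omega_j$ for $j=2,3$ and $\overline{\omega_3}\cap\overline{\omega\setminus\omega_2}=\emptyset$, and put $Q_j:=(\omega\setminus\overline{\omega_j})\times\mathbb R\times(-T,T)$. Fix $x_0'\in\mathbb R^{n-1}\setminus\overline\omega$, $r>1$, $\lambda>0$ and set $$\tilde\beta(x'):=|x'-x_0'|^2,\quad K:=r\|\tilde\beta\|_{L^\infty(\omega)},\quad \beta(x):=\tilde\beta(x')+K,\quad \eta(x,t):=\frac{e^{2\lambda K}-e^{\lambda\beta(x)}}{(T+t)(T-t)},\quad (x,t)\in Q.$$ For $s>0$ let $M_1:=i\partial_t+\Delta+s^2|\nabla\eta|^2$ and $M_2:=is(\partial_t\eta)+2s\nabla\eta\cdot\nabla+s(\Delta\eta)$, acting on distributions on $Q$, where $\nabla$ and $\Delta$ are taken with respect to $x$. Let $M\ge 0$. For a measurable $p:\Omega\to\mathbb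 R$ let $P:=-i\partial_t-\Delta+p$. Then there are constants $s_0>0$ and $C>0$, depending only on $n,\omega,\omega_2,\omega_3,x_0',r,\lambda,T$ and $M$, such that for every measurable $p:\Omega\to\mathbb R$ with $\|p\|_{L^\infty(\Omega)}\le M$, every $s\ge s_0$ and every $w\in L^2(-T,T;H^1_0(\Omega))$ with $Pw\in L^2(Q)$ (in the sense of distributions), the distributions $M_je^{-s\eta}w$, $j=1,2$, belong to $L^2(Q_2)$ and $$s\|e^{-s\eta}\nabla_{x'}w\|_{L^2(Q_2)}^2+s^3\|e^{-s\eta}w\|_{L^2(Q_2)}^2+\sum_{j=1,2}\|M_je^{-s\eta}w\|_{L^2(Q_2)}^2$$ $$\le C\left(\|e^{-s\eta}Pw\|_{L^2(Q)}^2+\|e^{-s\eta}\nabla_{x'}w\|_{L^2(Q_3\setminus Q_2)}^2+\|e^{-s\eta}w\|_{L^2(Q_3\setminus Q_2)}^2\right).$$ -/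

import Mathlib

open MeasureTheory Set Filter Topology
open scoped ENNReal

noncomputable section

namespace Carleman

/-- `ℝⁿ` with `n = m + 1`; a point is `x = (x', xₙ)` with `x' ∈ ℝᵐ`. -/
abbrev Space (m : ℕ) : Type := EuclideanSpace ℝ (Fin (m + 1))

/-- Space-time `ℝⁿ × ℝ`, with points `(x, t)`. -/
abbrev SpaceTime (m : ℕ) : Type := Space m × ℝ

/-- The transverse variable `x'` (the first `m = n - 1` coordinates of `x`). -/
def transverse {m : ℕ} (x : Space m) : EuclideanSpace ℝ (Fin m) :=
  WithLp.toLp 2 (fun i : Fin m => x i.castSucc)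

/-- The infinite cylinder `A × ℝ ⊆ ℝⁿ` with cross section `A`. -/
def infCylinder {m : ℕ} (A : Set (EuclideanSpace ℝ (Fin m))) : Set (Space m) :=
  {x | transverse x ∈ A}

/-- The space-time cylinder `(A × ℝ) × (-T, T)`. -/
def stCylinder {m : ℕ} (A : Set (EuclideanSpace ℝ (Fin m))) (T : ℝ) : Set (SpaceTime m) :=
  infCylinder A ×ˢ Ioo (-T) T

/-- The unit vector of `ℝⁿ` in the `j`-th direction. -/
def spaceDir {m : ℕ} (j : Fin (m + 1)) : Space m := EuclideanSpace.single j 1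

/-- The unit vector of space-time in the `j`-th spatial direction. -/
def stDir {m : ℕ} (j : Fin (m + 1)) : SpaceTime m := (spaceDir j, 0)

/-- The unit vector of space-time in the time direction. -/
def timeDir {m : ℕ} : SpaceTime m := (0, 1)

/-- `φ ∈ C₀^∞(U)`, complex-valued. -/
structure IsTest {E : Type*} [NormedAddCommGroup E] [NormedSpace ℝ E]
    (U : Set E) (φ : E → ℂ) : Prop where
  contDiff : ContDiff ℝ (⊤ : ℕ∞) φ
  hasCompactSupport : HasCompactSupport φ
  tsupport_subset : tsupport φ ⊆ U

/-! ### Sobolev spaces -/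

/-- The classical gradient of a function on `ℝⁿ`. -/
def classicalGrad {m : ℕ} (φ : Space m → ℂ) (x : Space m) : EuclideanSpace ℂ (Fin (m + 1)) :=
  WithLp.toLp 2 (fun j => fderiv ℝ φ x (spaceDir j))

/-- `f ∈ H¹(Ω)` with weak gradient `g`. -/
structure MemH1 {m : ℕ} (Ω : Set (Space m)) (f : Space m → ℂ)
    (g : Space m → EuclideanSpace ℂ (Fin (m + 1))) : Prop where
  memLp : MemLp f 2 (volume.restrict Ω)
  memLp_grad : MemLp g 2 (volume.restrict Ω)
  weak : ∀ φ : Space m → ℂ, IsTest Ω φ → ∀ j : Fin (m + 1),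
    ∫ x in Ω, f x * fderiv ℝ φ x (spaceDir j) = - ∫ x in Ω, g x j * φ x

/-- `f ∈ H¹₀(Ω)` with weak gradient `g`: `f ∈ H¹(Ω)` is a limit, in the norm of `H¹(Ω)`,
of elements of `C₀^∞(Ω)`. -/
structure MemH10 {m : ℕ} (Ω : Set (Space m)) (f : Space m → ℂ)
    (g : Space m → EuclideanSpace ℂ (Fin (m + 1))) : Prop where
  memH1 : MemH1 Ω f g
  approx : ∃ φ : ℕ → Space m → ℂ, (∀ k, IsTest Ω (φ k)) ∧
    Tendsto (fun k => eLpNorm (fun x => φ k x - f x) 2 (volume.restrict Ω)) atTop (𝓝 0) ∧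
    Tendsto (fun k => eLpNorm (fun x => classicalGrad (φ k) x - g x) 2 (volume.restrict Ω))
      atTop (𝓝 0)

/-- `w ∈ L²(-T, T; H¹₀(Ω))` with spatial weak gradient `G`, where `w` and `G` are functions of
`(x, t)`: both are (measurable and) square integrable on `Ω × (-T, T)`, and for almost every `t`
the slice `w(·, t)` belongs to `H¹₀(Ω)` with weak gradient `G(·, t)`. -/
structure MemL2H10 {m : ℕ} (Ω : Set (Space m)) (T : ℝ) (w : SpaceTime m → ℂ)
    (G : SpaceTime m → EuclideanSpace ℂ (Fin (m + 1))) : Prop where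
  memLp : MemLp w 2 (volume.restrict (Ω ×ˢ Ioo (-T) T))
  memLp_grad : MemLp G 2 (volume.restrict (Ω ×ˢ Ioo (-T) T))
  slice : ∀ᵐ t ∂(volume.restrict (Ioo (-T) T)),
    MemH10 Ω (fun x => w (x, t)) (fun x => G (x, t))

/-- The transverse part `∇_{x'}` of a gradient. -/
def transversePart {m : ℕ} (v : EuclideanSpace ℂ (Fin (m + 1))) : EuclideanSpace ℂ (Fin m) :=
  WithLp.toLp 2 (fun i : Fin m => v i.castSucc)

/-! ### Distributions on space-time

A distribution is handled through its values on test functions. -/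

/-- Functionals on functions of `(x, t)`; only their values on test functions matter. -/
abbrev Functional (m : ℕ) : Type := (SpaceTime m → ℂ) → ℂ

/-- The distribution on `U` given by the function `f`. -/
def ofFun {m : ℕ} (U : Set (SpaceTime m)) (f : SpaceTime m → ℂ) : Functional m :=
  fun φ => ∫ z in U, f z * φ z

/-- The derivative of a distribution in the direction `e`. -/
def dderiv {m : ℕ} (e : SpaceTime m) (S : Functional m) : Functional m :=
  fun φ => - S (fun z => fderiv ℝ φ z e)

/-- The product of a distribution with the real-valued function `a`, smooth on the domain of the
distribution. -/
def dmul {m : ℕ} (a : SpaceTime m → ℝ) (S : Functional m) : Functional m :=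
  fun φ => S (fun z => (a z : ℂ) * φ z)

/-- The spatial Laplacian `Δ = ∑ⱼ ∂ⱼ²` of a distribution. -/
def dlaplacian {m : ℕ} (S : Functional m) : Functional m :=
  ∑ j : Fin (m + 1), dderiv (stDir j) (dderiv (stDir j) S)

/-- The distribution `S` coincides on `U` with the function `g`. -/
def EqOnTest {m : ℕ} (U : Set (SpaceTime m)) (S : Functional m) (g : SpaceTime m → ℂ) : Prop :=
  ∀ φ : SpaceTime m → ℂ, IsTest U φ → S φ = ofFun U g φ

/-- `P w = -i ∂ₜ w - Δ w + p w` as a distribution on `Q`. -/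
def schrodinger {m : ℕ} (Q : Set (SpaceTime m)) (p : Space m → ℝ) (w : SpaceTime m → ℂ) :
    Functional m :=
  (-Complex.I) • dderiv timeDir (ofFun Q w) - dlaplacian (ofFun Q w)
    + ofFun Q (fun z => (p z.1 : ℂ) * w z)

/-! ### The weight and the operators `M₁`, `M₂` -/

/-- `β̃(x') = |x' - x₀'|²`. -/
def betaTilde {m : ℕ} (x₀ x' : EuclideanSpace ℝ (Fin m)) : ℝ := ‖x' - x₀‖ ^ 2

/-- `K = r ‖β̃‖_{L^∞(ω)}` (the function `β̃` is continuous and nonnegative, `ω` is open). -/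
def weightK {m : ℕ} (ω : Set (EuclideanSpace ℝ (Fin m))) (x₀ : EuclideanSpace ℝ (Fin m))
    (r : ℝ) : ℝ :=
  r * sSup (betaTilde x₀ '' ω)

/-- `β(x) = β̃(x') + K`. -/
def beta {m : ℕ} (ω : Set (EuclideanSpace ℝ (Fin m))) (x₀ : EuclideanSpace ℝ (Fin m))
    (r : ℝ) (x : Space m) : ℝ :=
  betaTilde x₀ (transverse x) + weightK ω x₀ r

/-- `η(x, t) = (e^{2λK} - e^{λβ(x)}) / ((T + t)(T - t))`. -/
def eta {m : ℕ} (ω : Set (EuclideanSpace ℝ (Fin m))) (x₀ : EuclideanSpace ℝ (Fin m))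
    (r lam T : ℝ) (z : SpaceTime m) : ℝ :=
  (Real.exp (2 * lam * weightK ω x₀ r) - Real.exp (lam * beta ω x₀ r z.1))
    / ((T + z.2) * (T - z.2))

/-- The directional derivative of a real-valued function on space-time. -/
def pderiv {m : ℕ} (e : SpaceTime m) (a : SpaceTime m → ℝ) : SpaceTime m → ℝ :=
  fun z => fderiv ℝ a z e

/-- `M₁ = i ∂ₜ + Δ + s² |∇η|²`, acting on distributions. -/
def opM₁ {m : ℕ} (s : ℝ) (η : SpaceTime m → ℝ) (S : Functional m) : Functional m :=
  Complex.I • dderiv timeDir S + dlaplacian S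
    + dmul (fun z => s ^ 2 * ∑ j : Fin (m + 1), pderiv (stDir j) η z ^ 2) S

/-- `M₂ = i s (∂ₜη) + 2 s ∇η · ∇ + s (Δη)`, acting on distributions. -/
def opM₂ {m : ℕ} (s : ℝ) (η : SpaceTime m → ℝ) (S : Functional m) : Functional m :=
  Complex.I • dmul (fun z => s * pderiv timeDir η z) S
    + ∑ j : Fin (m + 1), dmul (fun z => 2 * s * pderiv (stDir j) η z) (dderiv (stDir j) S)
    + dmul (fun z => s * ∑ j : Fin (m + 1), pderiv (stDir j) (pderiv (stDir j) η) z) S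

/-- The squared norm `‖f‖²_{L²(U)}`. -/
def normSqL2 {m : ℕ} {F : Type*} [NormedAddCommGroup F] (U : Set (SpaceTime m))
    (f : SpaceTime m → F) : ℝ≥0∞ :=
  eLpNorm f 2 (volume.restrict U) ^ 2

end Carleman

end

open Carleman

/-! Put σ = sη and v = e^{-σ}u. Conjugation gives e^{-σ}(i∂ₜ + Δ)u = M₁v + M₂v. Expanding the
square, ‖M₁v + M₂v‖² is ‖M₁v‖² + ‖M₂v‖² plus a cross term, which integrations by parts turn into a
quadratic form in (v, ∇v) with coefficients built from derivatives of σ (`algM_commutator`,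
`integral_norm_sq_smM`).

With ℓ = 1/(T² - t²), y = x' - x₀' and b = e^{λβ}, one has -D²σ = sℓb(2λ·I + 4λ² y⊗y), where I is
the identity of the transverse directions and zero in the axial one. Hence the form contains
sℓ|∇_{x'}v|², and -D²σ(∇σ, ∇σ)|v|² gives s³ℓ³|y|⁴|v|² and s³ℓ³|y|²|v|², with |y| bounded below
because x₀' lies off the closure of ω. The remaining terms, from Δ²σ, ∂ₜ²σ and ∇∂ₜσ, carry one power
of s only; since |ℓ'| ≲ ℓ², |ℓ''| ≲ ℓ³ and ℓ is bounded below, a large s absorbs them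
(`formValue_controls`). As |x' - x₀'|² is convex in x', no largeness of λ is required. This proves
the estimate for test functions (`carlemanEstimate_of_isTest`).

The passage to weak solutions rests on a formulation that involves only u, its spatial gradient G
and h = i∂ₜu + Δu, and these only pointwise: M₂v is e^{-sη} times `transport`, and M₁v is e^{-sη}(h
- `transport`). So a.e. convergence and Fatou suffice on the left, and only the weighted norm of h
has to be followed. Mollification commutes with i∂ₜ + Δ and gives the compactly supported case
(`WeakSol.carlemanEstimate`). Cutoffs in time and in the axial variable are then removed in
`WeakSol.carlemanEstimate_pullTransverse`: the axial derivatives are O(1/k), and the time derivative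
is paid for by e^{-sη} ≲ (T² - t²)², as η blows up at ±T.

Finally a cutoff χ(x') that is 1 near the closure of ω \ ω₂ and vanishes near ω₃ and near ∂ω (recall
∂ω ⊆ ∂ω₃) removes the lateral boundary. Its commutator lives in Q₃ \ Q₂ and contains only w and
∇_{x'}w, since χ depends on x' alone. The potential contributes at most M|χw|, absorbed by
s³‖e^{-sη}χw‖² (`exists_carleman_localised`). The two terms with `transport` are identified with the
distributions M₁e^{-sη}w and M₂e^{-sη}w in `eqOnTest_opM₁` and `eqOnTest_opM₂`. -/

noncomputable section

namespace Carleman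

/-! ### The commutator identity in a differential algebra -/

section Algebra

variable {A : Type*} [CommRing A] [Algebra ℂ A] {ι : Type*} [Fintype ι]

/-- The operator `c ∂ₜ + Δ + |∇σ|²`; `M₁` for `c = i`, its conjugate for `c = -i`. -/
def algM₁ (d : ι → Derivation ℂ A A) (dt : Derivation ℂ A A) (c : ℂ) (σ v : A) : A :=
  algebraMap ℂ A c * dt v + ∑ j, d j (d j v) + (∑ j, d j σ ^ 2) * v

/-- The operator `c (∂ₜσ) + 2 ∇σ · ∇ + Δσ`; `M₂` for `c = i`, its conjugate for `c = -i`. -/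
def algM₂ (d : ι → Derivation ℂ A A) (dt : Derivation ℂ A A) (c : ℂ) (σ v : A) : A :=
  algebraMap ℂ A c * (dt σ * v) + ∑ j, 2 * (d j σ * d j v) + (∑ j, d j (d j σ)) * v

/-- The quadratic form of the commutator of `M₁` and `M₂`, with `V` in the role of the conjugate
of `v`. -/
def algForm (d : ι → Derivation ℂ A A) (dt : Derivation ℂ A A) (σ v V : A) : A :=
  (∑ j, ∑ k, -2 * d j (d k σ) * (d j v * d k V + d j V * d k v))
    - 4 * (∑ j, ∑ k, d j (d k σ) * d j σ * d k σ) * (v * V)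
    + ((∑ j, ∑ k, d j (d j (d k (d k σ)))) - dt (dt σ)) * (v * V)
    + ∑ j, 2 * algebraMap ℂ A Complex.I * d j (dt σ) * (V * d j v - v * d j V)

/-- The spatial flux in the commutator identity. -/
def algFlux (d : ι → Derivation ℂ A A) (dt : Derivation ℂ A A) (σ v V : A) (j : ι) : A :=
  (∑ k, (2 * d k σ * (d j v * d k V + d j V * d k v) - 2 * d j σ * (d k v * d k V)
      + d k (d k σ) * (d j v * V + d j V * v) - d j (d k (d k σ)) * (v * V)))
    + algebraMap ℂ A Complex.I * (d j σ * (dt v * V - dt V * v) - dt σ * (d j v * V - d j V * v))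
    + 2 * (∑ k, d k σ ^ 2) * d j σ * (v * V)

/-- The flux in time in the commutator identity. -/
def algTimeFlux (d : ι → Derivation ℂ A A) (dt : Derivation ℂ A A) (σ v V : A) : A :=
  dt σ * (v * V) + ∑ j, algebraMap ℂ A Complex.I * (d j σ * (v * d j V - V * d j v))

/-- Conjugation is not ℂ-linear, so the conjugate of v enters as an independent element V, acted on
by the operators with -i. The identity is then polynomial and follows from Leibniz and the
commutation of the derivations. What is not in the form is a divergence. -/
theorem algM_commutator (d : ι → Derivation ℂ A A) (dt : Derivation ℂ A A)
    (hd : ∀ j k x, d j (d k x) = d k (d j x)) (hdt : ∀ j x, dt (d j x) = d j (dt x)) (σ v V : A) :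
    algM₁ d dt Complex.I σ v * algM₂ d dt (-Complex.I) σ V
      + algM₁ d dt (-Complex.I) σ V * algM₂ d dt Complex.I σ v
      = algForm d dt σ v V + (∑ j, d j (algFlux d dt σ v V j) + dt (algTimeFlux d dt σ v V)) := by
  have hI : algebraMap ℂ A Complex.I * algebraMap ℂ A Complex.I = -1 := by
    rw [← map_mul, Complex.I_mul_I, map_neg, map_one]
  set i : A := algebraMap ℂ A Complex.I with hi
  have hi0 : ∀ D : Derivation ℂ A A, D i = 0 := fun D => D.map_algebraMap _
  have h2 : ∀ D : Derivation ℂ A A, D 2 = 0 := fun D => by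
    rw [show (2 : A) = algebraMap ℂ A 2 from (map_ofNat _ 2).symm]; exact D.map_algebraMap _
  set q : A := ∑ k, d k σ ^ 2 with hq
  have hdq : ∀ j, d j q = ∑ k, 2 * d k σ * d j (d k σ) := by
    intro j
    simp only [hq, map_sum, sq, Derivation.leibniz, smul_eq_mul]
    exact Finset.sum_congr rfl fun k _ => by ring
  -- Second derivatives from M₁ against the real first and zeroth order terms of M₂, for one pair of
  -- directions: a Rellich type identity, which produces the Hessian and bilaplacian terms.
  have hpair : ∀ j k,
      d j (d j v) * (2 * (d k σ * d k V) + d k (d k σ) * V)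
        + d j (d j V) * (2 * (d k σ * d k v) + d k (d k σ) * v)
      = -2 * d j (d k σ) * (d j v * d k V + d j V * d k v) + d j (d j (d k (d k σ))) * (v * V)
        + d j (2 * d k σ * (d j v * d k V + d j V * d k v)
          + d k (d k σ) * (d j v * V + d j V * v) - d j (d k (d k σ)) * (v * V))
        - d k (2 * d k σ * (d j v * d j V)) := by
    intro j k
    simp only [Derivation.leibniz, smul_eq_mul, map_add, map_sub, h2, hd k j]
    ring
  -- The flux that `hpair` leaves under the derivative in direction k is relabelled, so that a
  -- single divergence in j collects everything.
  have hswap : ∑ j, ∑ k, d k (2 * d k σ * (d j v * d j V))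
      = ∑ j, ∑ k, d j (2 * d j σ * (d k v * d k V)) := Finset.sum_comm
  -- Mixed products of time and space terms. They leave only the coefficient ∂ⱼ∂ₜσ.
  have htime : ∀ j,
      i * dt v * (2 * (d j σ * d j V) + d j (d j σ) * V)
        - i * dt V * (2 * (d j σ * d j v) + d j (d j σ) * v)
        + (d j (d j v) * (-i * (dt σ * V)) + d j (d j V) * (i * (dt σ * v)))
      = 2 * i * d j (dt σ) * (V * d j v - v * d j V)
        + d j (i * (d j σ * (dt v * V - dt V * v) - dt σ * (d j v * V - d j V * v)))
        + dt (i * (d j σ * (v * d j V - V * d j v))) := by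
    intro j
    simp only [Derivation.leibniz, smul_eq_mul, map_sub, hi0, hdt]
    ring
  -- The potential |∇σ|² against M₂: moving the derivative off vV differentiates |∇σ|² and yields -4
  -- D²σ(∇σ, ∇σ), the term of order s³.
  have hpot : ∀ j,
      q * v * (2 * (d j σ * d j V) + d j (d j σ) * V)
        + q * V * (2 * (d j σ * d j v) + d j (d j σ) * v)
      = -4 * (∑ k, d j (d k σ) * d j σ * d k σ) * (v * V) + d j (2 * q * d j σ * (v * V)) := by
    intro j
    have : ∑ k, 2 * d k σ * d j (d k σ) * d j σ = 2 * ∑ k, d j (d k σ) * d j σ * d k σ := by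
      rw [Finset.mul_sum]; exact Finset.sum_congr rfl fun k _ => by ring
    have h3 : d j q * d j σ = 2 * ∑ k, d j (d k σ) * d j σ * d k σ := by
      rw [hdq, Finset.sum_mul, this]
    simp only [Derivation.leibniz, smul_eq_mul, h2]
    linear_combination (-2 * (v * V)) * h3
  -- The products of |∇σ|² with ±i∂ₜσ cancel between the two conjugate summands, so only four groups
  -- remain.
  have hL : algM₁ d dt Complex.I σ v * algM₂ d dt (-Complex.I) σ V
      + algM₁ d dt (-Complex.I) σ V * algM₂ d dt Complex.I σ v
      = (-(i * i) * (dt v * V + dt V * v) * dt σ)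
        + ∑ j, (i * dt v * (2 * (d j σ * d j V) + d j (d j σ) * V)
          - i * dt V * (2 * (d j σ * d j v) + d j (d j σ) * v)
          + (d j (d j v) * (-i * (dt σ * V)) + d j (d j V) * (i * (dt σ * v))))
        + ∑ j, ∑ k, (d j (d j v) * (2 * (d k σ * d k V) + d k (d k σ) * V)
          + d j (d j V) * (2 * (d k σ * d k v) + d k (d k σ) * v))
        + ∑ j, (q * v * (2 * (d j σ * d j V) + d j (d j σ) * V)
          + q * V * (2 * (d j σ * d j v) + d j (d j σ) * v)) := by
    simp only [algM₁, algM₂, map_neg, ← hi, ← hq]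
    simp only [Finset.sum_add_distrib, Finset.sum_sub_distrib, ← Finset.mul_sum, ← Finset.sum_mul,
      mul_add]
    ring
  have htt : -(i * i) * (dt v * V + dt V * v) * dt σ
      = - dt (dt σ) * (v * V) + dt (dt σ * (v * V)) := by
    rw [hI]
    simp only [Derivation.leibniz, smul_eq_mul]
    ring
  rw [hL, htt]
  simp only [hpair, htime, hpot, algForm, algFlux, algTimeFlux, map_add, map_sum, ← hi, ← hq]
  simp only [map_add, map_sub, Finset.sum_add_distrib, Finset.sum_sub_distrib, hswap,
    ← Finset.mul_sum, ← Finset.sum_mul]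
  ring

/-- Conjugation of `c ∂ₜ + Δ` by an exponential weight. -/
theorem algM_conj (d : ι → Derivation ℂ A A) (dt : Derivation ℂ A A) (σ e u : A) (c : ℂ)
    (he : ∀ j, d j e = - d j σ * e) (het : dt e = - dt σ * e) :
    algM₁ d dt c σ (e * u) + algM₂ d dt c σ (e * u)
      = e * (algebraMap ℂ A c * dt u + ∑ j, d j (d j u)) := by
  have h : ∀ j, d j (d j (e * u)) + 2 * (d j σ * d j (e * u)) + d j (d j σ) * (e * u)
      + d j σ ^ 2 * (e * u) = e * d j (d j u) := by
    intro j
    simp only [Derivation.leibniz, smul_eq_mul, map_add, he, map_neg, neg_mul]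
    ring
  rw [mul_add, Finset.mul_sum, ← Finset.sum_congr rfl fun j _ => h j]
  simp only [algM₁, algM₂, Derivation.leibniz dt, smul_eq_mul, het, Finset.sum_add_distrib,
    ← Finset.sum_mul]
  ring

end Algebra

end Carleman
end

noncomputable section

namespace Carleman

/-! ### The differential algebra of smooth functions -/

section Smooth

variable {E : Type*} [NormedAddCommGroup E] [NormedSpace ℝ E]

/-- The algebra of smooth complex-valued functions. -/
def smoothFun (E : Type*) [NormedAddCommGroup E] [NormedSpace ℝ E] : Subalgebra ℂ (E → ℂ) where
  carrier := {f | ContDiff ℝ (⊤ : ℕ∞) f}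
  mul_mem' hf hg := by
    rw [mem_ofPred_eq] at hf hg ⊢
    exact hf.mul hg
  add_mem' hf hg := by
    rw [mem_ofPred_eq] at hf hg ⊢
    exact hf.add hg
  algebraMap_mem' c := by
    rw [mem_ofPred_eq]
    exact contDiff_const (c := c)

theorem mem_smoothFun {f : E → ℂ} : f ∈ smoothFun E ↔ ContDiff ℝ (⊤ : ℕ∞) f := Iff.rfl

theorem smoothFun_contDiff (f : smoothFun E) : ContDiff ℝ (⊤ : ℕ∞) (f : E → ℂ) := mem_smoothFun.1 f.2

theorem smoothFun_differentiable (f : smoothFun E) : Differentiable ℝ (f : E → ℂ) :=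
  (smoothFun_contDiff f).differentiable (by simp)

theorem contDiff_fderiv_apply_const {f : E → ℂ} (hf : ContDiff ℝ (⊤ : ℕ∞) f) (e : E) :
    ContDiff ℝ (⊤ : ℕ∞) fun z => fderiv ℝ f z e :=
  (hf.fderiv_right (m := (⊤ : ℕ∞)) (by simp)).clm_apply contDiff_const

/-- The derivative in the direction `e` as a derivation of the algebra of smooth functions. -/
def dirDeriv (e : E) : Derivation ℂ (smoothFun E) (smoothFun E) :=
  Derivation.mk'
    { toFun := fun f => ⟨fun z => fderiv ℝ f.1 z e, mem_smoothFun.2 (contDiff_fderiv_apply_const (smoothFun_contDiff f) e)⟩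
      map_add' := fun f g => by
        ext z
        simp [fderiv_add (smoothFun_differentiable f z) (smoothFun_differentiable g z)]
      map_smul' := fun c f => by
        ext z
        simp [fderiv_const_smul (smoothFun_differentiable f z) c] }
    (fun f g => by
      ext z
      simp [fderiv_mul (smoothFun_differentiable f z) (smoothFun_differentiable g z)])

@[simp] theorem dirDeriv_apply (e : E) (f : smoothFun E) (z : E) :
    (dirDeriv e f : E → ℂ) z = fderiv ℝ f z e := rfl

theorem dirDeriv_comm (e e' : E) (f : smoothFun E) :
    dirDeriv e (dirDeriv e' f) = dirDeriv e' (dirDeriv e f) := by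
  have hd : Differentiable ℝ (fderiv ℝ (f : E → ℂ)) :=
    ((smoothFun_contDiff f).fderiv_right (m := (⊤ : ℕ∞)) (by simp)).differentiable (by simp)
  have h : ∀ a b : E, ∀ z, (dirDeriv a (dirDeriv b f) : E → ℂ) z
      = fderiv ℝ (fderiv ℝ (f : E → ℂ)) z a b := by
    intro a b z
    change fderiv ℝ (fun y => fderiv ℝ (f : E → ℂ) y b) z a = _
    rw [fderiv_clm_apply (hd z) (differentiableAt_const b)]
    simp
  ext z
  rw [h, h]
  exact ((smoothFun_contDiff f).contDiffAt.isSymmSndFDerivAt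
    (by simpa using (mod_cast le_top : ((2 : ℕ∞) : WithTop ℕ∞) ≤ (⊤ : ℕ∞)))).eq _ _

/-- Complex conjugation on smooth functions. -/
def smoothConj : smoothFun E →+* smoothFun E where
  toFun f := ⟨fun z => (starRingEnd ℂ) (f.1 z),
    mem_smoothFun.2 (Complex.conjCLE.contDiff.comp (smoothFun_contDiff f))⟩
  map_one' := by ext; simp
  map_mul' f g := by ext; simp
  map_zero' := by ext; simp
  map_add' f g := by ext; simp

@[simp] theorem smoothConj_apply (f : smoothFun E) (z : E) :
    (smoothConj f : E → ℂ) z = (starRingEnd ℂ) ((f : E → ℂ) z) := rfl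

theorem fderiv_conj_apply {f : E → ℂ} {z : E} (hf : DifferentiableAt ℝ f z) (e : E) :
    fderiv ℝ (fun y => (starRingEnd ℂ) (f y)) z e = (starRingEnd ℂ) (fderiv ℝ f z e) := by
  have := (Complex.conjCLE.toContinuousLinearMap.hasFDerivAt.comp z hf.hasFDerivAt).fderiv
  change fderiv ℝ (Complex.conjCLE.toContinuousLinearMap ∘ f) z e = _
  rw [this]; rfl

theorem dirDeriv_smoothConj (e : E) (f : smoothFun E) :
    dirDeriv e (smoothConj f) = smoothConj (dirDeriv e f) := by
  ext z
  exact fderiv_conj_apply (smoothFun_differentiable f z) e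

theorem smoothConj_algebraMap (c : ℂ) :
    smoothConj (algebraMap ℂ (smoothFun E) c)
      = algebraMap ℂ (smoothFun E) ((starRingEnd ℂ) c) := by
  ext z; rfl

theorem smoothFun_sum_apply {ι : Type*} (s : Finset ι) (f : ι → smoothFun E) (z : E) :
    ((∑ j ∈ s, f j : smoothFun E) : E → ℂ) z = ∑ j ∈ s, (f j : E → ℂ) z := by
  simp

/-- The ideal of compactly supported smooth functions. -/
def compactIdeal (E : Type*) [NormedAddCommGroup E] [NormedSpace ℝ E] : Ideal (smoothFun E) where
  carrier := {f | HasCompactSupport (f : E → ℂ)}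
  add_mem' hf hg := by
    rw [mem_ofPred_eq] at hf hg ⊢
    exact hf.add hg
  zero_mem' := HasCompactSupport.zero
  smul_mem' c f hf := by
    rw [mem_ofPred_eq] at hf ⊢
    exact hf.mul_left (f := c.1)

theorem mem_compactIdeal {f : smoothFun E} :
    f ∈ compactIdeal E ↔ HasCompactSupport (f : E → ℂ) := Iff.rfl

/-- An ideal stable under differentiation contains the operators, the form and the fluxes as soon as
it contains v and V, so integrability needs no separate discussion of supports. -/
theorem dirDeriv_mem_compactIdeal (e : E) {f : smoothFun E} (hf : f ∈ compactIdeal E) :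
    dirDeriv e f ∈ compactIdeal E := by
  rw [mem_compactIdeal] at hf ⊢
  exact hf.fderiv_apply (𝕜 := ℝ) e

variable {ι : Type*} [Fintype ι]

/-- The operator `c ∂ₜ + Δ + |∇σ|²` on smooth functions. -/
def smM₁ (d : ι → E) (dt : E) (c : ℂ) (σ v : smoothFun E) : smoothFun E :=
  algM₁ (fun j => dirDeriv (d j)) (dirDeriv dt) c σ v

/-- The operator `c (∂ₜσ) + 2 ∇σ · ∇ + Δσ` on smooth functions. -/
def smM₂ (d : ι → E) (dt : E) (c : ℂ) (σ v : smoothFun E) : smoothFun E :=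
  algM₂ (fun j => dirDeriv (d j)) (dirDeriv dt) c σ v

/-- The commutator form on smooth functions. -/
def smForm (d : ι → E) (dt : E) (σ v V : smoothFun E) : smoothFun E :=
  algForm (fun j => dirDeriv (d j)) (dirDeriv dt) σ v V

/-- The spatial flux on smooth functions. -/
def smFlux (d : ι → E) (dt : E) (σ v V : smoothFun E) (j : ι) : smoothFun E :=
  algFlux (fun j => dirDeriv (d j)) (dirDeriv dt) σ v V j

/-- The flux in time on smooth functions. -/
def smTimeFlux (d : ι → E) (dt : E) (σ v V : smoothFun E) : smoothFun E :=
  algTimeFlux (fun j => dirDeriv (d j)) (dirDeriv dt) σ v V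

theorem smM_commutator (d : ι → E) (dt : E) (σ v V : smoothFun E) :
    smM₁ d dt Complex.I σ v * smM₂ d dt (-Complex.I) σ V
      + smM₁ d dt (-Complex.I) σ V * smM₂ d dt Complex.I σ v
      = smForm d dt σ v V
        + (∑ j, dirDeriv (d j) (smFlux d dt σ v V j) + dirDeriv dt (smTimeFlux d dt σ v V)) := by
  unfold smM₁ smM₂ smForm smFlux smTimeFlux
  exact algM_commutator _ _ (fun j k => dirDeriv_comm (d j) (d k)) (fun j => dirDeriv_comm dt (d j)) σ v V

/-- For a real weight this turns the bilinear cross term at V = conj v into M₁v·conj(M₂v) plus its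
conjugate, that is 2 Re. -/
theorem smM₁_smoothConj (d : ι → E) (dt : E) {σ : smoothFun E} (hσ : smoothConj σ = σ)
    (v : smoothFun E) :
    smM₁ d dt (-Complex.I) σ (smoothConj v)
      = smoothConj (smM₁ d dt Complex.I σ v) := by
  have h : ∀ e, smoothConj (dirDeriv e σ) = dirDeriv e σ := fun e => by
    rw [← dirDeriv_smoothConj, hσ]
  simp [smM₁, algM₁, dirDeriv_smoothConj, smoothConj_algebraMap, h]

theorem smM₂_smoothConj (d : ι → E) (dt : E) {σ : smoothFun E} (hσ : smoothConj σ = σ)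
    (v : smoothFun E) :
    smM₂ d dt (-Complex.I) σ (smoothConj v)
      = smoothConj (smM₂ d dt Complex.I σ v) := by
  have h : ∀ e, smoothConj (dirDeriv e σ) = dirDeriv e σ := fun e => by
    rw [← dirDeriv_smoothConj, hσ]
  have h' : ∀ e e', smoothConj (dirDeriv e (dirDeriv e' σ)) = dirDeriv e (dirDeriv e' σ) :=
    fun e e' => by rw [← dirDeriv_smoothConj, h]
  simp [smM₂, algM₂, show smoothConj (2 : smoothFun E) = 2 from map_ofNat _ 2, dirDeriv_smoothConj, smoothConj_algebraMap, h, h']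

theorem smM₁_mem_compactIdeal (d : ι → E) (dt : E) (c : ℂ) (σ : smoothFun E) {v : smoothFun E}
    (hv : v ∈ compactIdeal E) :
    smM₁ d dt c σ v ∈ compactIdeal E :=
  Ideal.add_mem _ (Ideal.add_mem _ (Ideal.mul_mem_left _ _ (dirDeriv_mem_compactIdeal _ hv))
    (Ideal.sum_mem _ fun _ _ => dirDeriv_mem_compactIdeal _ (dirDeriv_mem_compactIdeal _ hv)))
    (Ideal.mul_mem_left _ _ hv)

theorem smM₂_mem_compactIdeal (d : ι → E) (dt : E) (c : ℂ) (σ : smoothFun E) {v : smoothFun E}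
    (hv : v ∈ compactIdeal E) :
    smM₂ d dt c σ v ∈ compactIdeal E :=
  Ideal.add_mem _ (Ideal.add_mem _ (Ideal.mul_mem_left _ _ (Ideal.mul_mem_left _ _ hv))
    (Ideal.sum_mem _ fun _ _ => Ideal.mul_mem_left _ _
      (Ideal.mul_mem_left _ _ (dirDeriv_mem_compactIdeal _ hv))))
    (Ideal.mul_mem_left _ _ hv)

theorem smForm_mem_compactIdeal (d : ι → E) (dt : E) (σ : smoothFun E) {v V : smoothFun E}
    (hv : v ∈ compactIdeal E) (hV : V ∈ compactIdeal E) :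
    smForm d dt σ v V ∈ compactIdeal E := by
  have hvV := Ideal.mul_mem_right V _ hv
  refine Ideal.add_mem _ (Ideal.add_mem _ (Ideal.sub_mem _ ?_ (Ideal.mul_mem_left _ _ hvV))
    (Ideal.mul_mem_left _ _ hvV)) ?_
  · exact Ideal.sum_mem _ fun j _ => Ideal.sum_mem _ fun k _ => Ideal.mul_mem_left _ _
      (Ideal.add_mem _ (Ideal.mul_mem_right _ _ (dirDeriv_mem_compactIdeal _ hv))
        (Ideal.mul_mem_right _ _ (dirDeriv_mem_compactIdeal _ hV)))
  · exact Ideal.sum_mem _ fun j _ => Ideal.mul_mem_left _ _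
      (Ideal.sub_mem _ (Ideal.mul_mem_right _ _ hV) (Ideal.mul_mem_right _ _ hv))

variable [MeasurableSpace E] [BorelSpace E]
  {μ : Measure E}

theorem integrable_of_mem_compactIdeal [IsFiniteMeasureOnCompacts μ]
    {f : smoothFun E} (hf : f ∈ compactIdeal E) :
    Integrable (f : E → ℂ) μ :=
  (smoothFun_contDiff f).continuous.integrable_of_hasCompactSupport hf

theorem integrable_norm_sq_of_mem_compactIdeal [IsFiniteMeasureOnCompacts μ]
    {f : smoothFun E} (hf : f ∈ compactIdeal E) :
    Integrable (fun z => ‖(f : E → ℂ) z‖ ^ 2) μ := by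
  refine ((smoothFun_contDiff f).continuous.norm.pow 2).integrable_of_hasCompactSupport ?_
  rw [mem_compactIdeal] at hf
  refine HasCompactSupport.of_support_subset_isCompact hf fun z hz => subset_tsupport _ ?_
  rw [Function.mem_support] at hz ⊢
  intro h0
  exact hz (by simp [h0])

variable [FiniteDimensional ℝ E] [μ.IsAddHaarMeasure]

theorem integral_dirDeriv_eq_zero (e : E) {f : smoothFun E} (hf : f ∈ compactIdeal E) :
    ∫ z, (dirDeriv e f : E → ℂ) z ∂μ = 0 := by
  -- Integration by parts against the constant 1; only the products with it have to be integrable.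
  have h := integral_smul_fderiv_eq_neg_fderiv_smul_of_integrable (𝕜 := ℝ) (μ := μ) (v := e)
    (f := fun _ => (1 : ℝ)) (g := (f : E → ℂ)) (by simp)
    (by
      simp only [one_smul]
      exact integrable_of_mem_compactIdeal (μ := μ) (dirDeriv_mem_compactIdeal e hf))
    (by
      simp only [one_smul]
      exact integrable_of_mem_compactIdeal (μ := μ) hf)
    (fun _ _ => differentiableAt_const _) (fun z _ => smoothFun_differentiable f z)
  simpa using h

theorem integral_smM_commutator (d : ι → E) (dt : E) (σ v V : smoothFun E)
    (hv : v ∈ compactIdeal E) (hV : V ∈ compactIdeal E) :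
    ∫ z, (smM₁ d dt Complex.I σ v
          * smM₂ d dt (-Complex.I) σ V
        + smM₁ d dt (-Complex.I) σ V
          * smM₂ d dt Complex.I σ v).1 z ∂μ
      = ∫ z, (smForm d dt σ v V).1 z ∂μ := by
  set J := compactIdeal E
  have hD : ∀ e, ∀ f ∈ J, dirDeriv e f ∈ J := fun e f => dirDeriv_mem_compactIdeal e
  have hvV : v * V ∈ J := J.mul_mem_right _ hv
  have hform := smForm_mem_compactIdeal d dt σ hv hV
  have hflux : ∀ j, smFlux d dt σ v V j ∈ J := by
    intro j
    refine J.add_mem (J.add_mem (J.sum_mem fun k _ => J.sub_mem (J.add_mem (J.sub_mem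
      (J.mul_mem_left _ (J.add_mem (J.mul_mem_right _ (hD _ _ hv)) (J.mul_mem_right _ (hD _ _ hV))))
      (J.mul_mem_left _ (J.mul_mem_right _ (hD _ _ hv))))
      (J.mul_mem_left _ (J.add_mem (J.mul_mem_left _ hV) (J.mul_mem_left _ hv))))
      (J.mul_mem_left _ hvV)) (J.mul_mem_left _ (J.sub_mem (J.mul_mem_left _
        (J.sub_mem (J.mul_mem_left _ hV) (J.mul_mem_left _ hv))) (J.mul_mem_left _
        (J.sub_mem (J.mul_mem_left _ hV) (J.mul_mem_left _ hv))))))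
      (J.mul_mem_left _ hvV)
  have htflux : smTimeFlux d dt σ v V ∈ J :=
    J.add_mem (J.mul_mem_left _ hvV) (J.sum_mem fun j _ => J.mul_mem_left _ (J.mul_mem_left _
      (J.sub_mem (J.mul_mem_right _ hv) (J.mul_mem_right _ hV))))
  rw [smM_commutator]
  have hi : ∀ f ∈ J, Integrable (f : E → ℂ) μ := fun f hf => integrable_of_mem_compactIdeal hf
  have hi1 := hi _ hform
  have hi2 := hi _ (J.sum_mem fun j (_ : j ∈ Finset.univ) => hD (d j) _ (hflux j))
  have hi3 := hi _ (hD dt _ htflux)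
  have hi23 : Integrable (fun z => (∑ j, dirDeriv (d j) (smFlux d dt σ v V j)).1 z
      + (dirDeriv dt (smTimeFlux d dt σ v V)).1 z) μ := hi2.add hi3
  simp only [Subalgebra.coe_add, Pi.add_apply]
  rw [integral_add hi1 hi23, integral_add hi2 hi3, integral_dirDeriv_eq_zero dt htflux]
  simp only [smoothFun_sum_apply]
  rw [integral_finsetSum _ fun j _ => hi _ (hD (d j) _ (hflux j))]
  simp only [integral_dirDeriv_eq_zero _ (hflux _), Finset.sum_const_zero, add_zero]

/-- The energy identity `‖M₁v + M₂v‖² = ‖M₁v‖² + ‖M₂v‖² + ⟨[M₁, M₂]v, v⟩`. -/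
theorem integral_norm_sq_smM (d : ι → E) (dt : E) {σ : smoothFun E} (hσ : smoothConj σ = σ)
    {v : smoothFun E} (hv : v ∈ compactIdeal E) :
    Integrable (fun z => ‖(smM₁ d dt Complex.I σ v).1 z‖ ^ 2
      + ‖(smM₂ d dt Complex.I σ v).1 z‖ ^ 2
      + ((smForm d dt σ v (smoothConj v)).1 z).re) μ ∧
    ∫ z, (‖(smM₁ d dt Complex.I σ v).1 z‖ ^ 2
      + ‖(smM₂ d dt Complex.I σ v).1 z‖ ^ 2
      + ((smForm d dt σ v (smoothConj v)).1 z).re) ∂μ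
    = ∫ z, ‖(smM₁ d dt Complex.I σ v
        + smM₂ d dt Complex.I σ v).1 z‖ ^ 2
        ∂μ := by
  have hV : smoothConj v ∈ compactIdeal E := by
    rw [mem_compactIdeal] at hv ⊢
    exact hv.comp_left (g := starRingEnd ℂ) (map_zero _)
  have key := integral_smM_commutator (μ := μ) d dt σ v _ hv hV
  rw [smM₁_smoothConj d dt hσ, smM₂_smoothConj d dt hσ] at key
  have hm1 := smM₁_mem_compactIdeal d dt Complex.I σ hv
  have hm2 := smM₂_mem_compactIdeal d dt Complex.I σ hv
  set a := smM₁ d dt Complex.I σ v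
  set b := smM₂ d dt Complex.I σ v
  have hB := smForm_mem_compactIdeal d dt σ hv hV
  set B := smForm d dt σ v (smoothConj v)
  have hc : a * smoothConj b + smoothConj a * b ∈ compactIdeal E :=
    Ideal.add_mem _ (Ideal.mul_mem_right _ _ hm1) (Ideal.mul_mem_left _ _ hm2)
  have hre : ∀ {f : smoothFun E}, f ∈ compactIdeal E → ∫ z, ((f : E → ℂ) z).re ∂μ
      = (∫ z, (f : E → ℂ) z ∂μ).re := fun hf =>
    integral_re (𝕜 := ℂ) (integrable_of_mem_compactIdeal (μ := μ) hf)
  have hia := integrable_norm_sq_of_mem_compactIdeal (μ := μ) hm1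
  have hib := integrable_norm_sq_of_mem_compactIdeal (μ := μ) hm2
  have hiB : Integrable (fun z => ((B : E → ℂ) z).re) μ :=
    (integrable_of_mem_compactIdeal (μ := μ) hB).re
  have hic : Integrable (fun z => (((a * smoothConj b + smoothConj a * b : smoothFun E) : E → ℂ) z).re) μ :=
    (integrable_of_mem_compactIdeal (μ := μ) hc).re
  refine ⟨(hia.add hib).add hiB, ?_⟩
  have hpt : ∀ z, ‖((a + b : smoothFun E) : E → ℂ) z‖ ^ 2 = ‖(a : E → ℂ) z‖ ^ 2
      + ‖(b : E → ℂ) z‖ ^ 2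
      + (((a * smoothConj b + smoothConj a * b : smoothFun E) : E → ℂ) z).re := by
    intro z
    simp only [Subalgebra.coe_add, Subalgebra.coe_mul, Pi.add_apply, Pi.mul_apply,
      smoothConj_apply, ← Complex.normSq_eq_norm_sq, Complex.normSq_apply]
    simp
    ring
  simp only [hpt]
  have hiab : Integrable (fun z => ‖a.1 z‖ ^ 2 + ‖b.1 z‖ ^ 2) μ := hia.add hib
  rw [integral_add hiab hiB, integral_add hiab hic, hre hB, hre hc, key]

end Smooth

end Carleman
end

noncomputable section

namespace Carleman

/-! ### Pointwise positivity of the commutator form -/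

section Pointwise

variable {ι : Type*} [Fintype ι]

/-- Cauchy–Schwarz. Because κⱼyⱼ = yⱼ, the vector y lives where κ = 1, so the radial derivative is
controlled by the transverse gradient alone. -/
theorem sum_weighted_norm_sq_le {κ y : ι → ℝ} (hκ : ∀ j, 0 ≤ κ j) (hκy : ∀ j, κ j * y j = y j)
    (hκ1 : ∀ j, κ j ≤ 1) (a : ι → ℂ) :
    ‖∑ j, (y j : ℂ) * a j‖ ^ 2 ≤ (∑ j, y j ^ 2) * ∑ j, κ j * ‖a j‖ ^ 2 := by
  have h1 : ‖∑ j, (y j : ℂ) * a j‖ ≤ ∑ j, |y j| * (κ j * ‖a j‖) := by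
    refine (norm_sum_le _ _).trans (Finset.sum_le_sum fun j _ => ?_)
    rw [norm_mul, Complex.norm_real, Real.norm_eq_abs, ← mul_assoc]
    gcongr
    conv_lhs => rw [← hκy j, abs_mul, abs_of_nonneg (hκ j), mul_comm]
  calc ‖∑ j, (y j : ℂ) * a j‖ ^ 2 ≤ (∑ j, |y j| * (κ j * ‖a j‖)) ^ 2 := by gcongr
    _ ≤ (∑ j, |y j| ^ 2) * ∑ j, (κ j * ‖a j‖) ^ 2 := Finset.sum_mul_sq_le_sq_mul_sq _ _ _
    _ ≤ _ := by
      simp only [sq_abs]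
      refine mul_le_mul_of_nonneg_left (Finset.sum_le_sum fun j _ => ?_)
        (Finset.sum_nonneg fun j _ => sq_nonneg _)
      rw [mul_pow]
      refine mul_le_mul_of_nonneg_right ?_ (sq_nonneg _)
      nlinarith [hκ j, hκ1 j]

/-- With v = e^{-σ}u one has e^{-σ}∇u = ∇v + v∇σ, and ∇σ = -2λsℓby. Returning from v to u therefore
costs a term (sℓ)²|v|². -/
theorem sum_weighted_norm_sub_sq_le {κ y : ι → ℝ} (hκ : ∀ j, 0 ≤ κ j) (hκ1 : ∀ j, κ j ≤ 1)
    {lam s ℓ b B R : ℝ} (hb : 1 ≤ b) (hbB : b ≤ B) (hR : ∑ j, y j ^ 2 ≤ R) (a : ι → ℂ) (v : ℂ) :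
    ∑ j, κ j * ‖a j - ((s * ℓ * (2 * lam * y j * b) : ℝ) : ℂ) * v‖ ^ 2
    ≤ 2 * (∑ j, κ j * ‖a j‖ ^ 2) + 8 * lam ^ 2 * B ^ 2 * R * (s * ℓ) ^ 2 * ‖v‖ ^ 2 := by
  have h1 : ∀ j, κ j * ‖a j - ((s * ℓ * (2 * lam * y j * b) : ℝ) : ℂ) * v‖ ^ 2
      ≤ 2 * (κ j * ‖a j‖ ^ 2) + 8 * lam ^ 2 * B ^ 2 * (s * ℓ) ^ 2 * ‖v‖ ^ 2 * y j ^ 2 := by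
    intro j
    have h2 : ‖a j - ((s * ℓ * (2 * lam * y j * b) : ℝ) : ℂ) * v‖ ^ 2
        ≤ 2 * ‖a j‖ ^ 2 + 2 * ((s * ℓ * (2 * lam * y j * b)) ^ 2 * ‖v‖ ^ 2) := by
      have h3 := norm_sub_le (a j) (((s * ℓ * (2 * lam * y j * b) : ℝ) : ℂ) * v)
      have h4 : ‖((s * ℓ * (2 * lam * y j * b) : ℝ) : ℂ) * v‖ ^ 2
          = (s * ℓ * (2 * lam * y j * b)) ^ 2 * ‖v‖ ^ 2 := by
        rw [norm_mul, Complex.norm_real, mul_pow, Real.norm_eq_abs, sq_abs]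
      rw [← h4]
      have h5 := pow_le_pow_left₀ (norm_nonneg _) h3 2
      refine h5.trans ?_
      nlinarith [sq_nonneg (‖a j‖ - ‖((s * ℓ * (2 * lam * y j * b) : ℝ) : ℂ) * v‖)]
    have h6 : (s * ℓ * (2 * lam * y j * b)) ^ 2 * ‖v‖ ^ 2
        ≤ 4 * lam ^ 2 * B ^ 2 * (s * ℓ) ^ 2 * ‖v‖ ^ 2 * y j ^ 2 := by
      have h7 : b ^ 2 ≤ B ^ 2 := by gcongr
      have h8 : 4 * lam ^ 2 * b ^ 2 * (s * ℓ) ^ 2 * ‖v‖ ^ 2 * y j ^ 2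
          ≤ 4 * lam ^ 2 * B ^ 2 * (s * ℓ) ^ 2 * ‖v‖ ^ 2 * y j ^ 2 := by gcongr
      linarith
    have h9 : κ j * ((s * ℓ * (2 * lam * y j * b)) ^ 2 * ‖v‖ ^ 2)
        ≤ 1 * ((s * ℓ * (2 * lam * y j * b)) ^ 2 * ‖v‖ ^ 2) :=
      mul_le_mul_of_nonneg_right (hκ1 j) (by positivity)
    have h10 := mul_le_mul_of_nonneg_left h2 (hκ j)
    linarith
  refine (Finset.sum_le_sum fun j _ => h1 j).trans ?_
  rw [Finset.sum_add_distrib, ← Finset.mul_sum, ← Finset.mul_sum]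
  have h2 : 8 * lam ^ 2 * B ^ 2 * (s * ℓ) ^ 2 * ‖v‖ ^ 2 * ∑ j, y j ^ 2
      ≤ 8 * lam ^ 2 * B ^ 2 * (s * ℓ) ^ 2 * ‖v‖ ^ 2 * R := by gcongr
  linarith

variable [DecidableEq ι]

/-- The commutator form for the weight `σ = s ℓ (C₀ - b)`, where `∂ⱼ∂ₖb = b (2λκⱼδⱼₖ + 4λ²yⱼyₖ)`,
in terms of the values of its ingredients at a point: `ℓ₁`, `ℓ₂` are the derivatives of `ℓ`,
`q` is `Δ²b` and `a` is the gradient of `v`. -/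
def formValue (κ y : ι → ℝ) (lam s ℓ ℓ₁ ℓ₂ b c₀ q : ℝ) (a : ι → ℂ) (v : ℂ) : ℝ :=
  (∑ j, ∑ k, 4 * (s * ℓ * (b * (2 * lam * (if j = k then κ j else 0) + 4 * lam ^ 2 * y j * y k)))
      * (a j * (starRingEnd ℂ) (a k)).re)
    + 4 * (∑ j, ∑ k, (s * ℓ * (b * (2 * lam * (if j = k then κ j else 0) + 4 * lam ^ 2 * y j * y k)))
      * (s * ℓ * (2 * lam * y j * b)) * (s * ℓ * (2 * lam * y k * b))) * ‖v‖ ^ 2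
    + (-(s * ℓ * q) - s * ℓ₂ * (c₀ - b)) * ‖v‖ ^ 2
    + ∑ j, 4 * (s * ℓ₁ * (2 * lam * y j * b)) * ((starRingEnd ℂ) v * a j).im

/-- The rank one part of the Hessian sees the gradient only through its radial component, and κy = y
makes the Hessian explicit on ∇σ. Both principal terms become visibly nonnegative. -/
theorem formValue_eq (κ y : ι → ℝ) (hκy : ∀ j, κ j * y j = y j)
    (lam s ℓ ℓ₁ ℓ₂ b c₀ q : ℝ) (a : ι → ℂ) (v : ℂ) :
    formValue κ y lam s ℓ ℓ₁ ℓ₂ b c₀ q a v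
      = 4 * (s * ℓ * b) * (2 * lam * (∑ j, κ j * ‖a j‖ ^ 2)
          + 4 * lam ^ 2 * ‖∑ j, (y j : ℂ) * a j‖ ^ 2)
        + 4 * (s * ℓ * b) ^ 3 * (8 * lam ^ 3 * (∑ j, y j ^ 2)
          + 16 * lam ^ 4 * (∑ j, y j ^ 2) ^ 2) * ‖v‖ ^ 2
        + (-(s * ℓ * q) - s * ℓ₂ * (c₀ - b)) * ‖v‖ ^ 2
        + 8 * lam * s * ℓ₁ * b * ((starRingEnd ℂ) v * ∑ j, (y j : ℂ) * a j).im := by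
  have hsq : ∀ w : ℂ, ‖w‖ ^ 2 = (w * (starRingEnd ℂ) w).re := fun w => by
    rw [Complex.mul_conj, Complex.normSq_eq_norm_sq, Complex.ofReal_re]
  have h1 : ‖∑ j, (y j : ℂ) * a j‖ ^ 2
      = ∑ j, ∑ k, y j * y k * (a j * (starRingEnd ℂ) (a k)).re := by
    rw [hsq, map_sum, Finset.sum_mul_sum, Complex.re_sum]
    refine Finset.sum_congr rfl fun j _ => ?_
    rw [Complex.re_sum]
    refine Finset.sum_congr rfl fun k _ => ?_
    rw [map_mul, Complex.conj_ofReal,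
      show (y j : ℂ) * a j * ((y k : ℂ) * (starRingEnd ℂ) (a k))
        = ((y j * y k : ℝ) : ℂ) * (a j * (starRingEnd ℂ) (a k)) by push_cast; ring,
      Complex.re_ofReal_mul]
  have h2 : ∑ j, κ j * ‖a j‖ ^ 2
      = ∑ j, ∑ k, (if j = k then κ j else 0) * (a j * (starRingEnd ℂ) (a k)).re := by
    refine Finset.sum_congr rfl fun j _ => ?_
    simp [hsq]
  have h3 : (∑ j, y j ^ 2) ^ 2 = ∑ j, ∑ k, y j ^ 2 * y k ^ 2 := by
    rw [sq (∑ j, y j ^ 2), Finset.sum_mul_sum]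
  have h4 : ∑ j, y j ^ 2 = ∑ j, ∑ k, (if j = k then κ j else 0) * (y j * y k) := by
    refine Finset.sum_congr rfl fun j _ => ?_
    simp only [ite_mul, zero_mul, Finset.sum_ite_eq, Finset.mem_univ, if_true]
    rw [← mul_assoc, hκy, sq]
  have h5 : ((starRingEnd ℂ) v * ∑ j, (y j : ℂ) * a j).im
      = ∑ j, y j * ((starRingEnd ℂ) v * a j).im := by
    rw [Finset.mul_sum, Complex.im_sum]
    refine Finset.sum_congr rfl fun j _ => ?_
    rw [show (starRingEnd ℂ) v * ((y j : ℂ) * a j) = (y j : ℂ) * ((starRingEnd ℂ) v * a j) by ring,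
      Complex.im_ofReal_mul]
  rw [h1, h2, h3, h5]
  rw [show 8 * lam ^ 3 * (∑ j, y j ^ 2)
    = 8 * lam ^ 3 * ∑ j, ∑ k, (if j = k then κ j else 0) * (y j * y k) by rw [← h4]]
  unfold formValue
  simp only [Finset.mul_sum, ← Finset.sum_add_distrib, Finset.sum_mul]
  congr 1
  · congr 1
    refine Finset.sum_congr rfl fun j _ => Finset.sum_congr rfl fun k _ => ?_
    ring
  · refine Finset.sum_congr rfl fun j _ => ?_
    ring

/-- The two Hessian terms have a sign, and the others are compared with sℓ³|v|². The mixed term,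
coming from ∇∂ₜσ, also uses up half of the gradient term. -/
theorem formValue_lower_bound {κ y : ι → ℝ} (hκ : ∀ j, 0 ≤ κ j) (hκ1 : ∀ j, κ j ≤ 1)
    (hκy : ∀ j, κ j * y j = y j) {lam s ℓ ℓ₁ ℓ₂ b c₀ q T B R δ q₀ : ℝ}
    (hlam : 0 < lam) (hs : 0 < s) (hT : 0 < T) (hℓ : 1 ≤ T ^ 2 * ℓ)
    (hℓ₁ : |ℓ₁| ≤ 2 * T * ℓ ^ 2) (hℓ₂ : |ℓ₂| ≤ 10 * T ^ 2 * ℓ ^ 3)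
    (hb : 1 ≤ b) (hbB : b ≤ B) (hbc : b ≤ c₀) (hδ : δ ≤ ∑ j, y j ^ 2) (hδ0 : 0 ≤ δ)
    (hR : ∑ j, y j ^ 2 ≤ R) (hq : |q| ≤ q₀) (a : ι → ℂ) (v : ℂ) :
    4 * lam * s * ℓ * (∑ j, κ j * ‖a j‖ ^ 2)
      + (32 * lam ^ 3 * δ * s ^ 3
        - (T ^ 4 * q₀ + 10 * T ^ 2 * c₀ + 16 * lam * T ^ 2 * B ^ 2 * R) * s) * ℓ ^ 3 * ‖v‖ ^ 2
      ≤ formValue κ y lam s ℓ ℓ₁ ℓ₂ b c₀ q a v := by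
  have hℓ0 : 0 < ℓ := by
    by_contra h
    push Not at h
    nlinarith [mul_nonneg (sq_nonneg T) (neg_nonneg.2 h)]
  rw [formValue_eq κ y hκy]
  set A := ∑ j, κ j * ‖a j‖ ^ 2 with hA
  set Y := ∑ j, y j ^ 2 with hY
  set S := ∑ j, (y j : ℂ) * a j with hS
  have hA0 : 0 ≤ A := Finset.sum_nonneg fun j _ => mul_nonneg (hκ j) (sq_nonneg _)
  have hY0 : 0 ≤ Y := Finset.sum_nonneg fun j _ => sq_nonneg _
  have hSA : ‖S‖ ^ 2 ≤ Y * A := sum_weighted_norm_sq_le hκ hκy hκ1 a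
  have hV : 0 ≤ ‖v‖ ^ 2 := sq_nonneg _
  -- The coefficient 8λ is kept whole here because `t4` takes 4λ of it back.
  have t1 : 8 * lam * s * ℓ * A ≤ 4 * (s * ℓ * b) * (2 * lam * A + 4 * lam ^ 2 * ‖S‖ ^ 2) := by
    have h1 : 4 * (s * ℓ * 1) * (2 * lam * A + 0) ≤
        4 * (s * ℓ * b) * (2 * lam * A + 4 * lam ^ 2 * ‖S‖ ^ 2) := by
      gcongr
      positivity
    linarith
  -- The λ³ part already has the full power s³ℓ³; the nonnegative λ⁴ part is dropped, so λ need not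
  -- be large.
  have t2 : 32 * lam ^ 3 * δ * s ^ 3 * ℓ ^ 3 * ‖v‖ ^ 2
      ≤ 4 * (s * ℓ * b) ^ 3 * (8 * lam ^ 3 * Y + 16 * lam ^ 4 * Y ^ 2) * ‖v‖ ^ 2 := by
    have h1 : 4 * (s * ℓ * 1) ^ 3 * (8 * lam ^ 3 * δ + 0) * ‖v‖ ^ 2
        ≤ 4 * (s * ℓ * b) ^ 3 * (8 * lam ^ 3 * Y + 16 * lam ^ 4 * Y ^ 2) * ‖v‖ ^ 2 := by
      gcongr
      positivity
    linarith
  have hq0 : 0 ≤ q₀ := (abs_nonneg q).trans hq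
  have t3 : -(T ^ 4 * q₀ + 10 * T ^ 2 * c₀) * s * ℓ ^ 3 * ‖v‖ ^ 2
      ≤ (-(s * ℓ * q) - s * ℓ₂ * (c₀ - b)) * ‖v‖ ^ 2 := by
    refine mul_le_mul_of_nonneg_right ?_ hV
    have h1 : s * ℓ * q ≤ s * ℓ * q₀ := by
      gcongr; exact (le_abs_self q).trans hq
    -- Lower powers of ℓ are raised to the cube by means of T²ℓ ≥ 1.
    have h2 : s * ℓ * q₀ ≤ s * (T ^ 4 * ℓ ^ 3) * q₀ := by
      gcongr
      have : 1 ≤ (T ^ 2 * ℓ) ^ 2 := one_le_pow₀ hℓ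
      nlinarith
    have h3 : s * ℓ₂ * (c₀ - b) ≤ s * (10 * T ^ 2 * ℓ ^ 3) * c₀ := by
      have h4 : s * ℓ₂ * (c₀ - b) ≤ s * (10 * T ^ 2 * ℓ ^ 3) * (c₀ - b) := by
        have : 0 ≤ c₀ - b := by linarith
        gcongr
        exact (le_abs_self _).trans hℓ₂
      have h5 : s * (10 * T ^ 2 * ℓ ^ 3) * (c₀ - b) ≤ s * (10 * T ^ 2 * ℓ ^ 3) * c₀ := by
        gcongr; linarith
      linarith
    linarith
  have t4 : -(4 * lam * s * ℓ * A + 16 * lam * T ^ 2 * B ^ 2 * R * s * ℓ ^ 3 * ‖v‖ ^ 2)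
      ≤ 8 * lam * s * ℓ₁ * b * ((starRingEnd ℂ) v * S).im := by
    have hB : 0 < B := by linarith
    have h1 : |((starRingEnd ℂ) v * S).im| ≤ ‖v‖ * ‖S‖ := by
      refine (Complex.abs_im_le_norm _).trans ?_
      rw [norm_mul, RCLike.norm_conj]
    have h2 : |8 * lam * s * ℓ₁ * b * ((starRingEnd ℂ) v * S).im|
        ≤ 8 * lam * s * (2 * T * ℓ ^ 2) * B * (‖v‖ * ‖S‖) := by
      rw [abs_mul, abs_mul, abs_mul, abs_of_pos (show 0 < 8 * lam * s by positivity),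
        abs_of_pos (show 0 < b by linarith)]
      gcongr
    have h3 : 8 * lam * s * (2 * T * ℓ ^ 2) * B * (‖v‖ * ‖S‖)
        ≤ 4 * lam * s * ℓ * A + 16 * lam * T ^ 2 * B ^ 2 * R * s * ℓ ^ 3 * ‖v‖ ^ 2 := by
      -- The square completed below has the denominator R, which may vanish when Y = 0; in that case
      -- the radial derivative vanishes as well.
      rcases hY0.eq_or_lt with h0 | h0
      · have : ‖S‖ ^ 2 ≤ 0 := by rw [← h0] at hSA; simpa using hSA
        have hS0 : ‖S‖ = 0 := by nlinarith [norm_nonneg S]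
        rw [hS0]
        have : 0 ≤ R := h0.le.trans hR
        simp only [mul_zero]
        positivity
      · have hRpos : 0 < R := h0.trans_le hR
        have h4 : ‖S‖ ^ 2 ≤ R * A := hSA.trans (by gcongr)
        have h5 : 4 * T * ℓ * B * (‖v‖ * ‖S‖) ≤ ‖S‖ ^ 2 / R + 4 * T ^ 2 * B ^ 2 * R * ℓ ^ 2 * ‖v‖ ^ 2 := by
          have h6 : 0 ≤ (‖S‖ - 2 * T * B * R * ℓ * ‖v‖) ^ 2 / R := by positivity
          have h7 : (‖S‖ - 2 * T * B * R * ℓ * ‖v‖) ^ 2 / R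
              = ‖S‖ ^ 2 / R + 4 * T ^ 2 * B ^ 2 * R * ℓ ^ 2 * ‖v‖ ^ 2
                - 4 * T * ℓ * B * (‖v‖ * ‖S‖) := by
            field_simp
            ring
          linarith
        have h8 : ‖S‖ ^ 2 / R ≤ A := by
          rw [div_le_iff₀ hRpos]; linarith
        have h9 : 4 * lam * s * ℓ * (4 * T * ℓ * B * (‖v‖ * ‖S‖))
            ≤ 4 * lam * s * ℓ * (A + 4 * T ^ 2 * B ^ 2 * R * ℓ ^ 2 * ‖v‖ ^ 2) := by
          gcongr; linarith
        linarith
    have := neg_abs_le (8 * lam * s * ℓ₁ * b * ((starRingEnd ℂ) v * S).im)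
    linarith
  linarith

set_option maxHeartbeats 800000 in
/-- For `s` large, the commutator form controls the weighted energy of `v` and of
`a + s ℓ 2λ b y v`, the weighted gradient of the function `u = e^{sη} v`. -/
theorem formValue_controls {lam T B R δ q₀ c₀ : ℝ} (hlam : 0 < lam) (hT : 0 < T)
    (hδ0 : 0 < δ) (hR0 : 0 ≤ R) (hq0 : 0 ≤ q₀) (hc0 : 0 ≤ c₀) :
    ∃ s₀ : ℝ, 1 ≤ s₀ ∧ ∃ C : ℝ, 1 ≤ C ∧ ∀ (κ y : ι → ℝ) (s ℓ ℓ₁ ℓ₂ b q : ℝ),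
      (∀ j, 0 ≤ κ j) → (∀ j, κ j ≤ 1) → (∀ j, κ j * y j = y j) → s₀ ≤ s → 1 ≤ T ^ 2 * ℓ →
      |ℓ₁| ≤ 2 * T * ℓ ^ 2 → |ℓ₂| ≤ 10 * T ^ 2 * ℓ ^ 3 → 1 ≤ b → b ≤ B → b ≤ c₀ →
      δ ≤ ∑ j, y j ^ 2 → ∑ j, y j ^ 2 ≤ R → |q| ≤ q₀ → ∀ (a : ι → ℂ) (v : ℂ),
      s * (∑ j, κ j * ‖a j - ((s * ℓ * (2 * lam * y j * b) : ℝ) : ℂ) * v‖ ^ 2) + s ^ 3 * ‖v‖ ^ 2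
        ≤ C * formValue κ y lam s ℓ ℓ₁ ℓ₂ b c₀ q a v := by
  set C₄ := T ^ 4 * q₀ + 10 * T ^ 2 * c₀ + 16 * lam * T ^ 2 * B ^ 2 * R with hC₄
  have hC₄0 : 0 ≤ C₄ := by positivity
  set c₃ := 32 * lam ^ 3 * δ with hc₃
  have hc₃0 : 0 < c₃ := by positivity
  -- The second summand pays for the gradient, through 1 ≤ T²ℓ. The third pays for the |v|² terms:
  -- the loss (sℓ)²|v|² in passing from ∇v to ∇u, and s³|v|². The summand 1 gives C ≥ 1, so that
  -- multiplying the norms of M₁v and M₂v by C does no harm later.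
  set C := 1 + T ^ 2 / (2 * lam) + 2 / c₃ * (8 * lam ^ 2 * B ^ 2 * R * T ^ 2 + T ^ 6) with hC
  have hC1 : T ^ 2 / (2 * lam) ≤ C := by
    have : 0 ≤ 2 / c₃ * (8 * lam ^ 2 * B ^ 2 * R * T ^ 2 + T ^ 6) := by positivity
    linarith
  have hC2 : 2 / c₃ * (8 * lam ^ 2 * B ^ 2 * R * T ^ 2 + T ^ 6) ≤ C := by
    have : 0 ≤ T ^ 2 / (2 * lam) := by positivity
    linarith
  have hC3 : 1 ≤ C := by
    have h1 : 0 ≤ 2 / c₃ * (8 * lam ^ 2 * B ^ 2 * R * T ^ 2 + T ^ 6) := by positivity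
    have h2 : 0 ≤ T ^ 2 / (2 * lam) := by positivity
    linarith
  -- From this threshold on C₄s ≤ (c₃/2)s³, so half of the cubic term survives.
  refine ⟨1 + 2 * C₄ / c₃, by have : 0 ≤ 2 * C₄ / c₃ := by positivity
                              linarith, C, hC3, ?_⟩
  intro κ y s ℓ ℓ₁ ℓ₂ b q hκ hκ1 hκy hs hℓ hℓ₁ hℓ₂ hb hbB hbc hδ hR hq a v
  have hs1 : 1 ≤ s := by
    have : 0 ≤ 2 * C₄ / c₃ := by positivity
    linarith
  have hs0 : 0 < s := by linarith
  have hℓ0 : 0 < ℓ := by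
    by_contra h
    push Not at h
    nlinarith [mul_nonneg (sq_nonneg T) (neg_nonneg.2 h)]
  have key := formValue_lower_bound hκ hκ1 hκy hlam hs0 hT hℓ hℓ₁ hℓ₂ hb hbB hbc hδ hδ0.le hR hq a v
  set F := formValue κ y lam s ℓ ℓ₁ ℓ₂ b c₀ q a v
  set A := ∑ j, κ j * ‖a j‖ ^ 2 with hA
  have hA0 : 0 ≤ A := Finset.sum_nonneg fun j _ => mul_nonneg (hκ j) (sq_nonneg _)
  have hlow : c₃ / 2 * s ^ 3 ≤ c₃ * s ^ 3 - C₄ * s := by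
    have h1 : 2 * C₄ ≤ c₃ * s := by
      have : 2 * C₄ / c₃ ≤ s := by linarith
      rw [div_le_iff₀ hc₃0] at this
      linarith
    have h2 : c₃ * s * s ≤ c₃ * s * s ^ 2 := by
      gcongr; nlinarith
    nlinarith
  have key2 : 4 * lam * s * ℓ * A + c₃ / 2 * s ^ 3 * ℓ ^ 3 * ‖v‖ ^ 2 ≤ F := by
    refine le_trans ?_ key
    gcongr
  have hgrad := sum_weighted_norm_sub_sq_le hκ hκ1 (s := s) (lam := lam) (ℓ := ℓ) hb hbB hR a v
  rw [← hA] at hgrad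
  have hℓ2 : ℓ ^ 2 ≤ T ^ 2 * ℓ ^ 3 := by nlinarith [sq_nonneg ℓ]
  have hℓ3 : 1 ≤ T ^ 6 * ℓ ^ 3 := by
    have : 1 ≤ (T ^ 2 * ℓ) ^ 3 := one_le_pow₀ hℓ
    calc (1 : ℝ) ≤ _ := this
      _ = _ := by ring
  have hF1 : 2 * s * A ≤ T ^ 2 / (2 * lam) * (4 * lam * s * ℓ * A) := by
    have : T ^ 2 / (2 * lam) * (4 * lam * s * ℓ * A) = 2 * s * A * (T ^ 2 * ℓ) := by
      field_simp
      ring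
    rw [this]
    exact le_mul_of_one_le_right (by positivity) hℓ
  have hF2 : s * (8 * lam ^ 2 * B ^ 2 * R * (s * ℓ) ^ 2 * ‖v‖ ^ 2) + s ^ 3 * ‖v‖ ^ 2
      ≤ 2 / c₃ * (8 * lam ^ 2 * B ^ 2 * R * T ^ 2 + T ^ 6) * (c₃ / 2 * s ^ 3 * ℓ ^ 3 * ‖v‖ ^ 2) := by
    have h1 : 2 / c₃ * (8 * lam ^ 2 * B ^ 2 * R * T ^ 2 + T ^ 6) * (c₃ / 2 * s ^ 3 * ℓ ^ 3 * ‖v‖ ^ 2)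
        = 8 * lam ^ 2 * B ^ 2 * R * s ^ 3 * ‖v‖ ^ 2 * (T ^ 2 * ℓ ^ 3)
          + s ^ 3 * ‖v‖ ^ 2 * (T ^ 6 * ℓ ^ 3) := by
      field_simp
    rw [h1]
    have h2 : 8 * lam ^ 2 * B ^ 2 * R * s ^ 3 * ‖v‖ ^ 2 * ℓ ^ 2
        ≤ 8 * lam ^ 2 * B ^ 2 * R * s ^ 3 * ‖v‖ ^ 2 * (T ^ 2 * ℓ ^ 3) := by gcongr
    have h3 : s ^ 3 * ‖v‖ ^ 2 * 1 ≤ s ^ 3 * ‖v‖ ^ 2 * (T ^ 6 * ℓ ^ 3) := by gcongr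
    linarith
  have hF3 : T ^ 2 / (2 * lam) * (4 * lam * s * ℓ * A) ≤ C * (4 * lam * s * ℓ * A) := by
    gcongr
  have hF4 : 2 / c₃ * (8 * lam ^ 2 * B ^ 2 * R * T ^ 2 + T ^ 6) * (c₃ / 2 * s ^ 3 * ℓ ^ 3 * ‖v‖ ^ 2)
      ≤ C * (c₃ / 2 * s ^ 3 * ℓ ^ 3 * ‖v‖ ^ 2) := by gcongr
  have hF5 : C * (4 * lam * s * ℓ * A + c₃ / 2 * s ^ 3 * ℓ ^ 3 * ‖v‖ ^ 2) ≤ C * F := by gcongr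
  have hF6 := mul_le_mul_of_nonneg_left hgrad hs0.le
  linarith

end Pointwise

end Carleman
end

noncomputable section

namespace Carleman

/-! ### The weight as a smooth function -/

section SmoothTools

variable {E : Type*} [NormedAddCommGroup E] [NormedSpace ℝ E]

/-- A smooth real-valued function as an element of the algebra of smooth functions. -/
def realSmooth (f : E → ℝ) (hf : ContDiff ℝ (⊤ : ℕ∞) f) : smoothFun E :=
  ⟨fun z => (f z : ℂ), mem_smoothFun.2 (Complex.ofRealCLM.contDiff.comp hf)⟩

theorem fderiv_ofReal_comp_apply {f : E → ℝ} {z : E} (hf : DifferentiableAt ℝ f z) (e : E) :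
    fderiv ℝ (fun y => (f y : ℂ)) z e = ((fderiv ℝ f z e : ℝ) : ℂ) := by
  have := (Complex.ofRealCLM.hasFDerivAt.comp z hf.hasFDerivAt).fderiv
  change fderiv ℝ (Complex.ofRealCLM ∘ f) z e = _
  rw [this]; rfl

theorem dirDeriv_realSmooth_apply (f : E → ℝ) (hf : ContDiff ℝ (⊤ : ℕ∞) f) (e z : E) :
    (dirDeriv e (realSmooth f hf)).1 z = ((fderiv ℝ f z e : ℝ) : ℂ) :=
  fderiv_ofReal_comp_apply (hf.differentiable (by simp) z) e

/-- The exponential of a smooth function. -/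
def smoothExp (f : smoothFun E) : smoothFun E :=
  ⟨fun z => Complex.exp (f.1 z), mem_smoothFun.2 ((smoothFun_contDiff f).cexp)⟩

theorem dirDeriv_smoothExp (e : E) (f : smoothFun E) :
    dirDeriv e (smoothExp f) = dirDeriv e f * smoothExp f := by
  ext z
  have h := ((smoothFun_differentiable f z).hasFDerivAt.cexp).fderiv
  change fderiv ℝ (fun y => Complex.exp (f.1 y)) z e = fderiv ℝ f.1 z e * Complex.exp (f.1 z)
  rw [h]
  simp [mul_comm]

theorem dirDeriv_algebraMap (e : E) (c : ℂ) : dirDeriv e (algebraMap ℂ (smoothFun E) c) = 0 :=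
  Derivation.map_algebraMap _ _

end SmoothTools

variable {m : ℕ}

/-- The component of `x' - x₀'` in the direction `j`, zero for the axial direction. -/
def offset (x₀ : EuclideanSpace ℝ (Fin m)) (j : Fin (m + 1)) (z : SpaceTime m) : ℝ :=
  Fin.lastCases (motive := fun _ => ℝ) 0 (fun i => z.1 i.castSucc - x₀ i) j

/-- The indicator of the transverse directions. -/
def transInd (j : Fin (m + 1)) : ℝ := Fin.lastCases (motive := fun _ => ℝ) 0 (fun _ => 1) j

@[simp] theorem offset_last (x₀ : EuclideanSpace ℝ (Fin m)) (z : SpaceTime m) :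
    offset x₀ (Fin.last m) z = 0 := by simp [offset]

@[simp] theorem offset_castSucc (x₀ : EuclideanSpace ℝ (Fin m)) (i : Fin m) (z : SpaceTime m) :
    offset x₀ i.castSucc z = z.1 i.castSucc - x₀ i := by simp [offset]

@[simp] theorem transInd_last : transInd (Fin.last m) = 0 := by simp [transInd]

@[simp] theorem transInd_castSucc (i : Fin m) : transInd i.castSucc = 1 := by simp [transInd]

theorem transInd_nonneg (j : Fin (m + 1)) : 0 ≤ transInd j := by
  induction j using Fin.lastCases <;> simp

theorem transInd_le_one (j : Fin (m + 1)) : transInd j ≤ 1 := by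
  induction j using Fin.lastCases <;> simp

theorem transInd_mul_offset (x₀ : EuclideanSpace ℝ (Fin m)) (z : SpaceTime m) (j : Fin (m + 1)) :
    transInd j * offset x₀ j z = offset x₀ j z := by
  induction j using Fin.lastCases <;> simp

theorem sum_offset_sq (x₀ : EuclideanSpace ℝ (Fin m)) (z : SpaceTime m) :
    ∑ j, offset x₀ j z ^ 2 = betaTilde x₀ (transverse z.1) := by
  rw [Fin.sum_univ_castSucc, betaTilde, EuclideanSpace.norm_sq_eq]
  simp [transverse]

theorem contDiff_offset (x₀ : EuclideanSpace ℝ (Fin m)) (j : Fin (m + 1)) :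
    ContDiff ℝ (⊤ : ℕ∞) (offset x₀ j) := by
  induction j using Fin.lastCases with
  | last =>
    have : offset x₀ (Fin.last m) = fun _ => 0 := by ext; simp
    rw [this]; exact contDiff_const
  | cast i =>
    have : offset x₀ i.castSucc = fun z => z.1 i.castSucc - x₀ i := by ext; simp
    rw [this]; fun_prop

theorem fderiv_offset (x₀ : EuclideanSpace ℝ (Fin m)) (j : Fin (m + 1)) (z e : SpaceTime m) :
    fderiv ℝ (offset x₀ j) z e = transInd j * e.1 j := by
  induction j using Fin.lastCases with
  | last =>
    have : offset x₀ (Fin.last m) = fun _ => 0 := by ext; simp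
    rw [this]; simp
  | cast i =>
    have : offset x₀ i.castSucc = fun z => z.1 i.castSucc - x₀ i := by ext; simp
    have h : HasFDerivAt (offset x₀ i.castSucc)
        ((EuclideanSpace.proj i.castSucc : Space m →L[ℝ] ℝ).comp
          (ContinuousLinearMap.fst ℝ (Space m) ℝ)) z := by
      rw [this]
      exact (((EuclideanSpace.proj i.castSucc : Space m →L[ℝ] ℝ).comp
          (ContinuousLinearMap.fst ℝ (Space m) ℝ)).hasFDerivAt).sub_const _
    rw [h.fderiv]
    simp

/-- `offset` as an element of the algebra of smooth functions. -/
def offsetS (x₀ : EuclideanSpace ℝ (Fin m)) (j : Fin (m + 1)) : smoothFun (SpaceTime m) :=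
  realSmooth (offset x₀ j) (contDiff_offset x₀ j)

theorem dirDeriv_stDir_offsetS (x₀ : EuclideanSpace ℝ (Fin m)) (j k : Fin (m + 1)) :
    dirDeriv (stDir k) (offsetS x₀ j)
      = algebraMap ℂ _ ((if k = j then transInd k else 0 : ℝ) : ℂ) := by
  ext z
  rw [offsetS, dirDeriv_realSmooth_apply, fderiv_offset]
  change _ = ((if k = j then transInd k else 0 : ℝ) : ℂ)
  by_cases h : k = j
  · subst h; simp [stDir, spaceDir]
  · simp [stDir, spaceDir, h, Ne.symm h]

theorem dirDeriv_timeDir_offsetS (x₀ : EuclideanSpace ℝ (Fin m)) (j : Fin (m + 1)) :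
    dirDeriv timeDir (offsetS x₀ j) = 0 := by
  ext z
  rw [offsetS, dirDeriv_realSmooth_apply, fderiv_offset]
  simp [timeDir]

/-- `b = e^{λβ}` as an element of the algebra of smooth functions. -/
def expBetaS (ω : Set (EuclideanSpace ℝ (Fin m))) (x₀ : EuclideanSpace ℝ (Fin m)) (r lam : ℝ) :
    smoothFun (SpaceTime m) :=
  smoothExp (algebraMap ℂ _ (lam : ℂ) *
    (∑ j, offsetS x₀ j * offsetS x₀ j + algebraMap ℂ _ (weightK ω x₀ r : ℂ)))

theorem expBetaS_apply (ω : Set (EuclideanSpace ℝ (Fin m))) (x₀ : EuclideanSpace ℝ (Fin m))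
    (r lam : ℝ) (z : SpaceTime m) :
    (expBetaS ω x₀ r lam).1 z = ((Real.exp (lam * beta ω x₀ r z.1) : ℝ) : ℂ) := by
  rw [Complex.ofReal_exp]
  change Complex.exp _ = _
  congr 1
  rw [beta, ← sum_offset_sq]
  simp [offsetS, realSmooth, sq]

theorem dirDeriv_stDir_expBetaS (ω : Set (EuclideanSpace ℝ (Fin m)))
    (x₀ : EuclideanSpace ℝ (Fin m)) (r lam : ℝ) (k : Fin (m + 1)) :
    dirDeriv (stDir k) (expBetaS ω x₀ r lam)
      = algebraMap ℂ _ ((2 * lam : ℝ) : ℂ) * offsetS x₀ k * expBetaS ω x₀ r lam := by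
  rw [expBetaS, dirDeriv_smoothExp]
  congr 1
  simp only [Derivation.leibniz, map_add, map_sum, dirDeriv_algebraMap, dirDeriv_stDir_offsetS,
    smul_eq_mul, mul_zero, add_zero]
  rw [Finset.sum_eq_single k]
  · ext z
    have := transInd_mul_offset x₀ z k
    have h : (transInd k : ℂ) * (offset x₀ k z : ℂ) = (offset x₀ k z : ℂ) := by
      exact_mod_cast this
    simp only [if_true]
    change (lam : ℂ) * ((offset x₀ k z : ℂ) * (transInd k : ℂ) + (offset x₀ k z : ℂ) * (transInd k : ℂ))
      = ((2 * lam : ℝ) : ℂ) * (offset x₀ k z : ℂ)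
    push_cast
    linear_combination (2 * (lam : ℂ)) * h
  · intro j _ hj
    simp [Ne.symm hj]
  · simp

theorem dirDeriv_timeDir_expBetaS (ω : Set (EuclideanSpace ℝ (Fin m)))
    (x₀ : EuclideanSpace ℝ (Fin m)) (r lam : ℝ) :
    dirDeriv timeDir (expBetaS ω x₀ r lam) = 0 := by
  rw [expBetaS, dirDeriv_smoothExp]
  simp [Derivation.leibniz, dirDeriv_timeDir_offsetS]

/-- A smooth function of time as an element of the algebra of smooth functions. -/
def timeS (L : ℝ → ℝ) (hL : ContDiff ℝ (⊤ : ℕ∞) L) : smoothFun (SpaceTime m) :=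
  realSmooth (fun z => L z.2) (hL.comp contDiff_snd)

theorem fderiv_comp_snd {L : ℝ → ℝ} {z : SpaceTime m} (hL : DifferentiableAt ℝ L z.2)
    (e : SpaceTime m) : fderiv ℝ (fun z : SpaceTime m => L z.2) z e = e.2 * deriv L z.2 := by
  have h := (hL.hasDerivAt.hasFDerivAt.comp z (hasFDerivAt_snd (𝕜 := ℝ) (p := z))).fderiv
  change fderiv ℝ (L ∘ Prod.snd) z e = _
  rw [h]
  simp

theorem contDiff_deriv_of_contDiff {L : ℝ → ℝ} (hL : ContDiff ℝ (⊤ : ℕ∞) L) :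
    ContDiff ℝ (⊤ : ℕ∞) (deriv L) :=
  (contDiff_infty_iff_deriv.1 hL).2

theorem dirDeriv_stDir_timeS (L : ℝ → ℝ) (hL : ContDiff ℝ (⊤ : ℕ∞) L) (k : Fin (m + 1)) :
    dirDeriv (stDir k) (timeS L hL) = 0 := by
  ext z
  rw [timeS, dirDeriv_realSmooth_apply, fderiv_comp_snd (hL.differentiable (by simp) _)]
  simp [stDir]

theorem dirDeriv_timeDir_timeS (L : ℝ → ℝ) (hL : ContDiff ℝ (⊤ : ℕ∞) L) :
    dirDeriv timeDir (timeS L hL : smoothFun (SpaceTime m))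
      = timeS (deriv L) (contDiff_deriv_of_contDiff hL) := by
  ext z
  rw [timeS, dirDeriv_realSmooth_apply, fderiv_comp_snd (hL.differentiable (by simp) _)]
  simp [timeDir, timeS, realSmooth]

/-- The weight `s ℓ(t) (e^{2λK} - e^{λβ})` as an element of the algebra of smooth functions. -/
def weightS (ω : Set (EuclideanSpace ℝ (Fin m))) (x₀ : EuclideanSpace ℝ (Fin m)) (r lam s : ℝ)
    (L : ℝ → ℝ) (hL : ContDiff ℝ (⊤ : ℕ∞) L) : smoothFun (SpaceTime m) :=
  algebraMap ℂ _ (s : ℂ) * timeS L hL *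
    (algebraMap ℂ _ ((Real.exp (2 * lam * weightK ω x₀ r) : ℝ) : ℂ) - expBetaS ω x₀ r lam)

section Derivatives

variable (ω : Set (EuclideanSpace ℝ (Fin m))) (x₀ : EuclideanSpace ℝ (Fin m)) (r lam s : ℝ)
  (L : ℝ → ℝ) (hL : ContDiff ℝ (⊤ : ℕ∞) L)

theorem weightS_deriv (k : Fin (m + 1)) :
    dirDeriv (stDir k) (weightS ω x₀ r lam s L hL)
      = -(algebraMap ℂ _ (s : ℂ) * timeS L hL *
        (algebraMap ℂ _ ((2 * lam : ℝ) : ℂ) * offsetS x₀ k * expBetaS ω x₀ r lam)) := by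
  simp only [weightS, Derivation.leibniz, map_sub, dirDeriv_algebraMap, dirDeriv_stDir_timeS,
    dirDeriv_stDir_expBetaS, smul_eq_mul]
  ring

theorem weightS_deriv_deriv (j k : Fin (m + 1)) :
    dirDeriv (stDir j) (dirDeriv (stDir k) (weightS ω x₀ r lam s L hL))
      = -(algebraMap ℂ _ (s : ℂ) * timeS L hL * (expBetaS ω x₀ r lam *
        (algebraMap ℂ _ ((2 * lam : ℝ) : ℂ) * algebraMap ℂ _ ((if j = k then transInd j else 0 : ℝ) : ℂ)
          + algebraMap ℂ _ ((2 * lam : ℝ) : ℂ) ^ 2 * offsetS x₀ j * offsetS x₀ k))) := by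
  rw [weightS_deriv]
  simp only [Derivation.leibniz, map_neg, dirDeriv_algebraMap, dirDeriv_stDir_timeS,
    dirDeriv_stDir_expBetaS, dirDeriv_stDir_offsetS, smul_eq_mul]
  ring

theorem weightS_deriv_four (j k : Fin (m + 1)) :
    dirDeriv (stDir j) (dirDeriv (stDir j) (dirDeriv (stDir k) (dirDeriv (stDir k)
        (weightS ω x₀ r lam s L hL))))
      = -(algebraMap ℂ _ (s : ℂ) * timeS L hL * (expBetaS ω x₀ r lam *
        (2 * algebraMap ℂ _ ((2 * lam : ℝ) : ℂ) ^ 2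
            * algebraMap ℂ _ ((if j = k then transInd j else 0 : ℝ) : ℂ) ^ 2
          + 4 * algebraMap ℂ _ ((2 * lam : ℝ) : ℂ) ^ 3
            * algebraMap ℂ _ ((if j = k then transInd j else 0 : ℝ) : ℂ)
            * offsetS x₀ j * offsetS x₀ k
          + (algebraMap ℂ _ ((2 * lam : ℝ) : ℂ) * algebraMap ℂ _ ((transInd j : ℝ) : ℂ)
            + algebraMap ℂ _ ((2 * lam : ℝ) : ℂ) ^ 2 * offsetS x₀ j * offsetS x₀ j)
          * (algebraMap ℂ _ ((2 * lam : ℝ) : ℂ) * algebraMap ℂ _ ((transInd k : ℝ) : ℂ)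
            + algebraMap ℂ _ ((2 * lam : ℝ) : ℂ) ^ 2 * offsetS x₀ k * offsetS x₀ k)))) := by
  rw [weightS_deriv_deriv]
  simp only [Derivation.leibniz, map_neg, map_add, dirDeriv_algebraMap, dirDeriv_stDir_timeS, sq,
    dirDeriv_stDir_expBetaS, dirDeriv_stDir_offsetS, smul_eq_mul, if_true, mul_zero,
    add_zero, zero_add]
  ring

theorem weightS_timeDeriv :
    dirDeriv timeDir (weightS ω x₀ r lam s L hL)
      = weightS ω x₀ r lam s (deriv L) (contDiff_deriv_of_contDiff hL) := by
  simp only [weightS, Derivation.leibniz, map_sub, dirDeriv_algebraMap, dirDeriv_timeDir_timeS,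
    dirDeriv_timeDir_expBetaS, smul_eq_mul]
  ring

end Derivatives

/-- The value of `Δ² e^{λβ}`. -/
def biLapValue (x₀ : EuclideanSpace ℝ (Fin m)) (lam b : ℝ) (z : SpaceTime m) : ℝ :=
  ∑ j, ∑ k, b * (2 * (2 * lam) ^ 2 * (if j = k then transInd j else 0) ^ 2
      + 4 * (2 * lam) ^ 3 * (if j = k then transInd j else 0) * offset x₀ j z * offset x₀ k z
      + (2 * lam * transInd j + (2 * lam) ^ 2 * offset x₀ j z * offset x₀ j z)
        * (2 * lam * transInd k + (2 * lam) ^ 2 * offset x₀ k z * offset x₀ k z))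

/-- This is the bridge from the algebraic commutator form to the pointwise expression that can be
estimated. The time factor is an arbitrary smooth L, since 1/(T² - t²) itself is not globally
smooth. -/
theorem smForm_weightS_re (ω : Set (EuclideanSpace ℝ (Fin m))) (x₀ : EuclideanSpace ℝ (Fin m))
    (r lam s : ℝ) (L : ℝ → ℝ) (hL : ContDiff ℝ (⊤ : ℕ∞) L) (v : smoothFun (SpaceTime m))
    (z : SpaceTime m) :
    ((smForm stDir timeDir (weightS ω x₀ r lam s L hL) v (smoothConj v)).1 z).re
      = formValue transInd (fun j => offset x₀ j z) lam s (L z.2) (deriv L z.2)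
        (deriv (deriv L) z.2) (Real.exp (lam * beta ω x₀ r z.1))
        (Real.exp (2 * lam * weightK ω x₀ r))
        (biLapValue x₀ lam (Real.exp (lam * beta ω x₀ r z.1)) z)
        (fun j => (dirDeriv (stDir j) v).1 z) (v.1 z) := by
  have hb := expBetaS_apply ω x₀ r lam z
  set b := Real.exp (lam * beta ω x₀ r z.1)
  have hY : ∀ j, (offsetS x₀ j).1 z = (offset x₀ j z : ℂ) := fun j => rfl
  have hτ : ∀ L hL, (timeS L hL : smoothFun (SpaceTime m)).1 z = (L z.2 : ℂ) := fun L hL => rfl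
  have hc : ∀ c : ℂ, (algebraMap ℂ (smoothFun (SpaceTime m)) c).1 z = c := fun c => rfl
  have hvv : v.1 z * (starRingEnd ℂ) (v.1 z) = ((‖v.1 z‖ ^ 2 : ℝ) : ℂ) := by
    rw [Complex.mul_conj, Complex.normSq_eq_norm_sq]
  have h2 : (2 : smoothFun (SpaceTime m)).1 z = 2 := rfl
  have h4 : (4 : smoothFun (SpaceTime m)).1 z = 4 := rfl
  -- Derivatives of the weight are replaced from the highest order downwards, so that no inner
  -- derivative is rewritten before the closed form containing it.
  simp only [smForm, algForm, weightS_deriv_four]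
  simp only [weightS_deriv_deriv, weightS_timeDeriv]
  simp only [weightS_deriv]
  simp only [weightS, dirDeriv_smoothConj]
  simp only [Subalgebra.coe_add, Subalgebra.coe_sub, Subalgebra.coe_mul, Subalgebra.coe_neg,
    Subalgebra.coe_pow, Pi.add_apply, Pi.sub_apply, Pi.mul_apply, Pi.neg_apply, Pi.pow_apply,
    smoothFun_sum_apply, hb, hY, hτ, hc, smoothConj_apply, hvv, h2, h4]
  simp only [← Complex.ofReal_mul, ← Complex.ofReal_neg, ← Complex.ofReal_pow, ← Complex.ofReal_add,
    ← Complex.ofReal_sub, ← Complex.ofReal_ofNat, ← Complex.ofReal_sum]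
  rw [formValue, biLapValue]
  simp only [Complex.add_re, Complex.sub_re, Complex.re_sum, Complex.re_ofReal_mul,
    Complex.ofReal_re]
  rw [sub_eq_add_neg]
  congr 1
  · congr 1
    · congr 1
      · refine Finset.sum_congr rfl fun j _ => Finset.sum_congr rfl fun k _ => ?_
        simp only [Complex.mul_re, Complex.conj_re, Complex.conj_im]
        ring
      · rw [← neg_mul, ← mul_neg, ← Finset.sum_neg_distrib]
        congr 2
        refine Finset.sum_congr rfl fun j _ => ?_
        rw [← Finset.sum_neg_distrib]
        refine Finset.sum_congr rfl fun k _ => ?_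
        ring
    · congr 2
      simp only [Finset.mul_sum, Finset.sum_neg_distrib]
  · refine Finset.sum_congr rfl fun j _ => ?_
    simp only [Complex.mul_re, Complex.mul_im, Complex.sub_re, Complex.sub_im, Complex.conj_re,
      Complex.conj_im, Complex.I_re, Complex.I_im, Complex.ofReal_re, Complex.ofReal_im]
    ring

end Carleman
end

noncomputable section

namespace Carleman

variable {m : ℕ}

/-! ### The factor `1 / ((T + t)(T - t))` -/

/-- A smooth function that coincides with `1 / ((T + t)(T - t))` where `T² - t² > 2ε`. -/
def regTime (T ε t : ℝ) : ℝ :=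
  ((T ^ 2 - t ^ 2) * Real.smoothTransition ((T ^ 2 - t ^ 2) / ε - 1)
    + (1 - Real.smoothTransition ((T ^ 2 - t ^ 2) / ε - 1)))⁻¹

/-- The denominator is a convex combination of T² - t² and 1 in which the first weight vanishes once
T² - t² ≤ ε. The regularisation gives a globally smooth weight that agrees with sη on the support of
a given test function. -/
theorem regTime_denom_pos {ε : ℝ} (hε : 0 < ε) (T t : ℝ) :
    0 < (T ^ 2 - t ^ 2) * Real.smoothTransition ((T ^ 2 - t ^ 2) / ε - 1)
      + (1 - Real.smoothTransition ((T ^ 2 - t ^ 2) / ε - 1)) := by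
  set x := T ^ 2 - t ^ 2
  have h1 := Real.smoothTransition.le_one (x / ε - 1)
  have h0 := Real.smoothTransition.nonneg (x / ε - 1)
  rcases h0.eq_or_lt with h | h
  · rw [← h]; norm_num
  · have hx : 0 < x := by
      by_contra hx
      push Not at hx
      have : x / ε - 1 ≤ 0 := by
        have := div_nonpos_of_nonpos_of_nonneg hx hε.le
        linarith
      rw [Real.smoothTransition.zero_of_nonpos this] at h
      exact lt_irrefl _ h
    have := mul_pos hx h
    linarith

theorem contDiff_regTime {ε : ℝ} (hε : 0 < ε) (T : ℝ) : ContDiff ℝ (⊤ : ℕ∞) (regTime T ε) := by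
  have h1 : ContDiff ℝ (⊤ : ℕ∞) fun t : ℝ => Real.smoothTransition ((T ^ 2 - t ^ 2) / ε - 1) :=
    Real.smoothTransition.contDiff.comp (by fun_prop)
  refine ContDiff.inv ?_ fun t => (regTime_denom_pos hε T t).ne'
  exact ContDiff.add (ContDiff.mul (by fun_prop) h1) (contDiff_const.sub h1)

theorem regTime_eq {T ε t : ℝ} (hε : 0 < ε) (h : 2 * ε < T ^ 2 - t ^ 2) :
    regTime T ε t = (T ^ 2 - t ^ 2)⁻¹ := by
  have : 1 ≤ (T ^ 2 - t ^ 2) / ε - 1 := by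
    rw [le_sub_iff_add_le, le_div_iff₀ hε]; linarith
  rw [regTime, Real.smoothTransition.one_of_one_le this]
  simp

theorem isOpen_setOf_lt_sq_sub (T ε : ℝ) : IsOpen {t : ℝ | 2 * ε < T ^ 2 - t ^ 2} :=
  isOpen_lt continuous_const (by fun_prop)

theorem deriv_regTime {T ε t : ℝ} (hε : 0 < ε) (h : 2 * ε < T ^ 2 - t ^ 2) :
    deriv (regTime T ε) t = 2 * t * ((T ^ 2 - t ^ 2)⁻¹) ^ 2 := by
  have heq : regTime T ε =ᶠ[𝓝 t] fun t => (T ^ 2 - t ^ 2)⁻¹ := by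
    filter_upwards [(isOpen_setOf_lt_sq_sub T ε).mem_nhds h] with y hy using regTime_eq hε hy
  have hne : T ^ 2 - t ^ 2 ≠ 0 := by linarith
  have hd : HasDerivAt (fun t : ℝ => T ^ 2 - t ^ 2) (-(2 * t)) t := by
    simpa using (hasDerivAt_pow 2 t).const_sub (T ^ 2)
  rw [heq.deriv_eq, (hd.fun_inv hne).deriv]
  field_simp

theorem deriv_deriv_regTime {T ε t : ℝ} (hε : 0 < ε) (h : 2 * ε < T ^ 2 - t ^ 2) :
    deriv (deriv (regTime T ε)) t
      = 2 * ((T ^ 2 - t ^ 2)⁻¹) ^ 2 + 8 * t ^ 2 * ((T ^ 2 - t ^ 2)⁻¹) ^ 3 := by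
  have heq : deriv (regTime T ε) =ᶠ[𝓝 t] fun t => 2 * t * ((T ^ 2 - t ^ 2)⁻¹) ^ 2 := by
    filter_upwards [(isOpen_setOf_lt_sq_sub T ε).mem_nhds h] with y hy using deriv_regTime hε hy
  have hne : T ^ 2 - t ^ 2 ≠ 0 := by linarith
  have hd : HasDerivAt (fun t : ℝ => T ^ 2 - t ^ 2) (-(2 * t)) t := by
    simpa using (hasDerivAt_pow 2 t).const_sub (T ^ 2)
  have h2 := ((hasDerivAt_id t).const_mul 2).mul ((hd.fun_inv hne).fun_pow 2)
  rw [heq.deriv_eq]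
  refine (h2.deriv).trans ?_
  simp
  field_simp
  ring

/-- Here ℓ' = 2tℓ² and ℓ'' = 2ℓ² + 8t²ℓ³. The constant 10 is 2 + 8, with ℓ² ≤ T²ℓ³. -/
theorem regTime_bounds {T ε t : ℝ} (hT : 0 < T) (hε : 0 < ε) (h : 2 * ε < T ^ 2 - t ^ 2) :
    1 ≤ T ^ 2 * regTime T ε t ∧ |deriv (regTime T ε) t| ≤ 2 * T * regTime T ε t ^ 2 ∧
      |deriv (deriv (regTime T ε)) t| ≤ 10 * T ^ 2 * regTime T ε t ^ 3 := by
  rw [deriv_regTime hε h, deriv_deriv_regTime hε h, regTime_eq hε h]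
  have hpos : 0 < T ^ 2 - t ^ 2 := by linarith
  have htT : |t| ≤ T := abs_le_of_sq_le_sq (by linarith) hT.le
  set ℓ := (T ^ 2 - t ^ 2)⁻¹ with hℓ
  have hℓ0 : 0 < ℓ := inv_pos.2 hpos
  have h1 : 1 ≤ T ^ 2 * ℓ := by
    rw [hℓ, ← div_eq_mul_inv, le_div_iff₀ hpos]
    nlinarith [sq_nonneg t]
  refine ⟨h1, ?_, ?_⟩
  · rw [abs_mul, abs_mul, abs_of_pos (show (0 : ℝ) < 2 by norm_num),
      abs_of_nonneg (sq_nonneg ℓ)]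
    gcongr
  · rw [abs_of_nonneg (by positivity)]
    have h2 : t ^ 2 ≤ T ^ 2 := by linarith
    have h3 : 8 * t ^ 2 * ℓ ^ 3 ≤ 8 * T ^ 2 * ℓ ^ 3 := by gcongr
    have h4 : 2 * ℓ ^ 2 * 1 ≤ 2 * ℓ ^ 2 * (T ^ 2 * ℓ) := by gcongr
    linarith

/-! ### Bounds for the weight on the cross section -/

section Geometry

variable {ω : Set (EuclideanSpace ℝ (Fin m))} {x₀ : EuclideanSpace ℝ (Fin m)}

theorem bddAbove_betaTilde (hωb : Bornology.IsBounded ω) (x₀ : EuclideanSpace ℝ (Fin m)) :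
    BddAbove (betaTilde x₀ '' ω) := by
  obtain ⟨R, hR⟩ := hωb.subset_closedBall x₀
  refine ⟨R ^ 2, ?_⟩
  rintro _ ⟨x, hx, rfl⟩
  have := hR hx
  rw [Metric.mem_closedBall, dist_eq_norm] at this
  exact pow_le_pow_left₀ (norm_nonneg _) this 2

theorem betaTilde_le (hωb : Bornology.IsBounded ω) {x : EuclideanSpace ℝ (Fin m)} (hx : x ∈ ω) :
    betaTilde x₀ x ≤ sSup (betaTilde x₀ '' ω) :=
  le_csSup (bddAbove_betaTilde hωb x₀) (mem_image_of_mem _ hx)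

theorem exists_lt_betaTilde (hx₀ : x₀ ∉ closure ω) :
    ∃ δ : ℝ, 0 < δ ∧ ∀ x ∈ ω, δ ≤ betaTilde x₀ x := by
  rw [Metric.mem_closure_iff] at hx₀
  push Not at hx₀
  obtain ⟨ε, hε, h⟩ := hx₀
  refine ⟨ε ^ 2, by positivity, fun x hx => ?_⟩
  have := h x hx
  rw [dist_comm, dist_eq_norm] at this
  exact pow_le_pow_left₀ hε.le this 2

theorem sSup_betaTilde_pos (hωb : Bornology.IsBounded ω) (hne : ω.Nonempty)
    (hx₀ : x₀ ∉ closure ω) : 0 < sSup (betaTilde x₀ '' ω) := by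
  obtain ⟨δ, hδ, h⟩ := exists_lt_betaTilde hx₀
  obtain ⟨x, hx⟩ := hne
  exact hδ.trans_le ((h x hx).trans (betaTilde_le hωb hx))

theorem beta_nonneg (hωb : Bornology.IsBounded ω) (hne : ω.Nonempty)
    (hx₀ : x₀ ∉ closure ω) {r : ℝ} (hr : 1 < r) (x : Space m) : 0 ≤ beta ω x₀ r x := by
  have h1 := sSup_betaTilde_pos hωb hne hx₀
  have h2 : 0 ≤ betaTilde x₀ (transverse x) := sq_nonneg _
  rw [beta, weightK]
  nlinarith

/-- With S the supremum of β̃ and K = rS, one has β ≤ S + K = 2K - (r - 1)S. The gap given by r > 1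
keeps the numerator of η away from zero. -/
theorem beta_le (hωb : Bornology.IsBounded ω)
    {r : ℝ} {x : Space m} (hx : x ∈ infCylinder ω) :
    beta ω x₀ r x ≤ 2 * weightK ω x₀ r - (r - 1) * sSup (betaTilde x₀ '' ω) := by
  have h1 := betaTilde_le (x₀ := x₀) hωb hx
  rw [beta, weightK]
  linarith

/-- The blow-up of η at t = ±T makes e^{-sη} decay faster than any power of T² - t², which is what
removes the cutoff in time. -/
theorem eta_lower_bound (hωb : Bornology.IsBounded ω) (hne : ω.Nonempty)
    (hx₀ : x₀ ∉ closure ω) {r lam : ℝ} (hr : 1 < r) (hlam : 0 < lam) :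
    ∃ c : ℝ, 0 < c ∧ ∀ T : ℝ, ∀ z ∈ stCylinder ω T,
      c * (T ^ 2 - z.2 ^ 2)⁻¹ ≤ eta ω x₀ r lam T z := by
  have h1 := sSup_betaTilde_pos hωb hne hx₀
  set S := sSup (betaTilde x₀ '' ω)
  refine ⟨Real.exp (2 * lam * weightK ω x₀ r)
    - Real.exp (lam * (2 * weightK ω x₀ r - (r - 1) * S)), ?_, ?_⟩
  · rw [sub_pos, Real.exp_lt_exp]
    have : 0 < lam * ((r - 1) * S) := by
      have : 0 < r - 1 := by linarith
      positivity
    nlinarith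
  · rintro T z ⟨hz, ht⟩
    have hpos : 0 < (T + z.2) * (T - z.2) := mul_pos (by linarith [ht.1]) (by linarith [ht.2])
    rw [eta, show (T + z.2) * (T - z.2) = T ^ 2 - z.2 ^ 2 by ring] at *
    rw [div_eq_mul_inv]
    have : 0 ≤ (T ^ 2 - z.2 ^ 2)⁻¹ := (inv_pos.2 hpos).le
    gcongr
    exact beta_le hωb hz

theorem abs_biLapValue_le {lam R b B : ℝ} (hlam : 0 < lam) (hb : 0 ≤ b) (hbB : b ≤ B)
    {z : SpaceTime m} (hR : ∑ j, offset x₀ j z ^ 2 ≤ R) :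
    |biLapValue x₀ lam b z| ≤ ∑ _j : Fin (m + 1), ∑ _k : Fin (m + 1),
      B * (2 * (2 * lam) ^ 2 + 4 * (2 * lam) ^ 3 * R + (2 * lam + (2 * lam) ^ 2 * R) ^ 2) := by
  have hj : ∀ j, offset x₀ j z ^ 2 ≤ R := fun j =>
    (Finset.single_le_sum (f := fun j => offset x₀ j z ^ 2) (fun j _ => sq_nonneg _)
      (Finset.mem_univ j)).trans hR
  have hR0 : 0 ≤ R := (sq_nonneg _).trans (hj 0)
  have hjk : ∀ j k, |offset x₀ j z * offset x₀ k z| ≤ R := by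
    intro j k
    rw [abs_mul]
    have h1 := hj j
    have h2 := hj k
    rw [← sq_abs] at h1 h2
    nlinarith [sq_nonneg (|offset x₀ j z| - |offset x₀ k z|)]
  refine (Finset.abs_sum_le_sum_abs _ _).trans (Finset.sum_le_sum fun j _ => ?_)
  refine (Finset.abs_sum_le_sum_abs _ _).trans (Finset.sum_le_sum fun k _ => ?_)
  rw [abs_mul, abs_of_nonneg hb]
  have hκ : |(if j = k then transInd j else 0 : ℝ)| ≤ 1 := by
    split_ifs
    · rw [abs_of_nonneg (transInd_nonneg j)]; exact transInd_le_one j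
    · simp
  have hfac : ∀ j, |2 * lam * transInd j + (2 * lam) ^ 2 * offset x₀ j z * offset x₀ j z|
      ≤ 2 * lam + (2 * lam) ^ 2 * R := by
    intro j
    have h0 := transInd_nonneg j
    have h1 := transInd_le_one j
    have h2 : 0 ≤ offset x₀ j z * offset x₀ j z := mul_self_nonneg _
    rw [mul_assoc ((2 * lam) ^ 2), abs_of_nonneg (by positivity)]
    have h3 : 2 * lam * transInd j ≤ 2 * lam * 1 := by gcongr
    have h4 : (2 * lam) ^ 2 * (offset x₀ j z * offset x₀ j z) ≤ (2 * lam) ^ 2 * R := by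
      gcongr
      exact (le_abs_self _).trans (hjk j j)
    linarith
  refine mul_le_mul hbB ?_ (abs_nonneg _) (hb.trans hbB)
  refine (abs_add_le _ _).trans (add_le_add ((abs_add_le _ _).trans (add_le_add ?_ ?_)) ?_)
  · rw [abs_mul, abs_of_pos (show 0 < 2 * (2 * lam) ^ 2 by positivity), abs_pow]
    exact mul_le_of_le_one_right (by positivity) (pow_le_one₀ (abs_nonneg _) hκ)
  · rw [mul_assoc, mul_assoc, abs_mul, abs_of_pos (show 0 < 4 * (2 * lam) ^ 3 by positivity),
      abs_mul]
    gcongr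
    calc _ ≤ 1 * R := mul_le_mul hκ (hjk j k) (abs_nonneg _) zero_le_one
      _ = R := one_mul R
  · rw [abs_mul, sq (2 * lam + (2 * lam) ^ 2 * R)]
    exact mul_le_mul (hfac j) (hfac k) (abs_nonneg _) ((abs_nonneg _).trans (hfac j))

end Geometry

end Carleman
end

noncomputable section

namespace Carleman

variable {m : ℕ}

/-! ### The Carleman estimate for test functions -/

instance isAddHaarMeasure_spaceTime : (volume : Measure (SpaceTime m)).IsAddHaarMeasure :=
  Measure.prod.instIsAddHaarMeasure volume volume

/-- `e^{sη} M₂ (e^{-sη} u)` at the point `z`, in terms of the values of `u` and of its gradient. -/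
def transport (s : ℝ) (η : SpaceTime m → ℝ) (z : SpaceTime m) (u : ℂ) (G : Fin (m + 1) → ℂ) : ℂ :=
  Complex.I * ((s * pderiv timeDir η z : ℝ) : ℂ) * u
    + ∑ j, ((2 * s * pderiv (stDir j) η z : ℝ) : ℂ)
      * (G j - ((s * pderiv (stDir j) η z : ℝ) : ℂ) * u)
    + ((s * ∑ j, pderiv (stDir j) (pderiv (stDir j) η) z : ℝ) : ℂ) * u

/-- The density of the left-hand side of the Carleman estimate, in terms of the values of `u`, of
its gradient and of `i ∂ₜu + Δu`. -/
def energyDensity (s : ℝ) (η : SpaceTime m → ℝ) (z : SpaceTime m) (u : ℂ) (G : Fin (m + 1) → ℂ)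
    (h : ℂ) : ℝ :=
  Real.exp (-s * η z) ^ 2 * (s * ∑ i : Fin m, ‖G i.castSucc‖ ^ 2 + s ^ 3 * ‖u‖ ^ 2
    + (‖h - transport s η z u G‖ ^ 2 + ‖transport s η z u G‖ ^ 2))

/-- The Carleman estimate for a function with gradient `G` and with `i ∂ₜu + Δu = h`. -/
def CarlemanEstimate (U : Set (SpaceTime m)) (s C : ℝ) (η : SpaceTime m → ℝ) (u : SpaceTime m → ℂ)
    (G : Fin (m + 1) → SpaceTime m → ℂ) (h : SpaceTime m → ℂ) : Prop :=
  ∫⁻ z in U, ENNReal.ofReal (energyDensity s η z (u z) (fun j => G j z) (h z))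
    ≤ ENNReal.ofReal C * ∫⁻ z in U, ENNReal.ofReal (Real.exp (-s * η z) ^ 2 * ‖h z‖ ^ 2)

/-- The classical expression `i ∂ₜu + Δu`. -/
def schrodingerClassical (u : SpaceTime m → ℂ) (z : SpaceTime m) : ℂ :=
  Complex.I * fderiv ℝ u z timeDir
    + ∑ j, fderiv ℝ (fun y => fderiv ℝ u y (stDir j)) z (stDir j)

theorem dirDeriv_eq_ofReal {E : Type*} [NormedAddCommGroup E] [NormedSpace ℝ E]
    {f : smoothFun E} {g : E → ℝ} {U : Set E} (hU : IsOpen U)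
    (hfg : ∀ z ∈ U, f.1 z = (g z : ℂ)) (e : E) :
    ∀ z ∈ U, (dirDeriv e f).1 z = ((fderiv ℝ g z e : ℝ) : ℂ) := by
  intro z hz
  have h1 : g =ᶠ[𝓝 z] fun y => Complex.reCLM (f.1 y) := by
    filter_upwards [hU.mem_nhds hz] with y hy
    simp [hfg y hy]
  have hd : DifferentiableAt ℝ g z :=
    (Complex.reCLM.differentiableAt.comp z (smoothFun_differentiable f z)).congr_of_eventuallyEq h1
  have h2 : f.1 =ᶠ[𝓝 z] fun y => (g y : ℂ) := by
    filter_upwards [hU.mem_nhds hz] with y hy using hfg y hy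
  rw [dirDeriv_apply, h2.fderiv_eq, fderiv_ofReal_comp_apply hd]

theorem weightS_eq_eta {ω : Set (EuclideanSpace ℝ (Fin m))} {x₀ : EuclideanSpace ℝ (Fin m)}
    {r lam s T ε : ℝ} (hε : 0 < ε) (z : SpaceTime m) (hz : 2 * ε < T ^ 2 - z.2 ^ 2) :
    (weightS ω x₀ r lam s (regTime T ε) (contDiff_regTime hε T)).1 z
      = ((s * eta ω x₀ r lam T z : ℝ) : ℂ) := by
  change (s : ℂ) * (regTime T ε z.2 : ℂ)
    * (((Real.exp (2 * lam * weightK ω x₀ r) : ℝ) : ℂ) - (expBetaS ω x₀ r lam).1 z) = _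
  rw [expBetaS_apply, regTime_eq hε hz, eta,
    show (T + z.2) * (T - z.2) = T ^ 2 - z.2 ^ 2 by ring]
  push_cast
  ring

theorem pderiv_const_mul {η : SpaceTime m → ℝ} {z : SpaceTime m} (c : ℝ)
    (h : DifferentiableAt ℝ η z) (e : SpaceTime m) :
    fderiv ℝ (fun y => c * η y) z e = c * pderiv e η z := by
  rw [fderiv_const_mul h]; rfl

theorem contDiffAt_eta (ω : Set (EuclideanSpace ℝ (Fin m))) (x₀ : EuclideanSpace ℝ (Fin m))
    (r lam : ℝ) {T : ℝ} {z : SpaceTime m} (hz : z.2 ∈ Ioo (-T) T) :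
    ContDiffAt ℝ (⊤ : ℕ∞) (eta ω x₀ r lam T) z := by
  have hpos : 0 < T ^ 2 - z.2 ^ 2 := by nlinarith [hz.1, hz.2]
  -- A quarter of the value at z, so that 2ε < T² - t² holds near z and η agrees there with a
  -- globally smooth weight.
  set ε := (T ^ 2 - z.2 ^ 2) / 4 with hε'
  have hε : 0 < ε := by positivity
  have hopen : IsOpen {y : SpaceTime m | 2 * ε < T ^ 2 - y.2 ^ 2} :=
    (isOpen_setOf_lt_sq_sub T ε).preimage continuous_snd
  have hmem : z ∈ {y : SpaceTime m | 2 * ε < T ^ 2 - y.2 ^ 2} := by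
    change 2 * ε < T ^ 2 - z.2 ^ 2
    linarith
  have h : ContDiffAt ℝ (⊤ : ℕ∞) (fun y => Complex.reCLM
      ((weightS ω x₀ r lam 1 (regTime T ε) (contDiff_regTime hε T)).1 y)) z :=
    (Complex.reCLM.contDiff.comp (smoothFun_contDiff _)).contDiffAt
  refine h.congr_of_eventuallyEq ?_
  filter_upwards [hopen.mem_nhds hmem] with y hy
  rw [weightS_eq_eta hε y hy]
  simp

theorem contDiffAt_pderiv {η : SpaceTime m → ℝ} {z : SpaceTime m}
    (h : ContDiffAt ℝ (⊤ : ℕ∞) η z) (e : SpaceTime m) :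
    ContDiffAt ℝ (⊤ : ℕ∞) (pderiv e η) z :=
  (h.fderiv_right (m := (⊤ : ℕ∞)) (by simp)).clm_apply contDiffAt_const

/-! ### Derivatives of the regularised weight on the region where it equals sη -/

section Values

variable {ω : Set (EuclideanSpace ℝ (Fin m))} {x₀ : EuclideanSpace ℝ (Fin m)}
  {r lam s T ε : ℝ}

theorem mem_Ioo_of_lt_sq_sub (hT : 0 < T) (hε : 0 < ε) {t : ℝ} (h : 2 * ε < T ^ 2 - t ^ 2) :
    t ∈ Ioo (-T) T :=
  abs_lt.1 (abs_lt_of_sq_lt_sq (by linarith) hT.le)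

theorem dirDeriv_weightS (hT : 0 < T) (hε : 0 < ε) (e : SpaceTime m) (z : SpaceTime m)
    (hz : 2 * ε < T ^ 2 - z.2 ^ 2) :
    (dirDeriv e (weightS ω x₀ r lam s (regTime T ε) (contDiff_regTime hε T))).1 z
      = ((s * pderiv e (eta ω x₀ r lam T) z : ℝ) : ℂ) := by
  have hopen : IsOpen {y : SpaceTime m | 2 * ε < T ^ 2 - y.2 ^ 2} :=
    (isOpen_setOf_lt_sq_sub T ε).preimage continuous_snd
  rw [dirDeriv_eq_ofReal hopen (fun y hy => weightS_eq_eta hε y hy) e z hz,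
    pderiv_const_mul s ((contDiffAt_eta ω x₀ r lam
      (mem_Ioo_of_lt_sq_sub hT hε hz)).differentiableAt (by simp))]

theorem dirDeriv_dirDeriv_weightS (hT : 0 < T) (hε : 0 < ε) (e e' : SpaceTime m)
    (z : SpaceTime m) (hz : 2 * ε < T ^ 2 - z.2 ^ 2) :
    (dirDeriv e' (dirDeriv e
        (weightS ω x₀ r lam s (regTime T ε) (contDiff_regTime hε T)))).1 z
      = ((s * pderiv e' (pderiv e (eta ω x₀ r lam T)) z : ℝ) : ℂ) := by
  have hopen : IsOpen {y : SpaceTime m | 2 * ε < T ^ 2 - y.2 ^ 2} :=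
    (isOpen_setOf_lt_sq_sub T ε).preimage continuous_snd
  rw [dirDeriv_eq_ofReal hopen (fun y hy => dirDeriv_weightS hT hε e y hy) e' z hz,
    pderiv_const_mul s ((contDiffAt_pderiv (contDiffAt_eta ω x₀ r lam
      (mem_Ioo_of_lt_sq_sub hT hε hz)) e).differentiableAt (by simp))]

end Values

/-! ### The conjugated operators at a point -/

section Evaluate

theorem smM_conj_apply (σ u : smoothFun (SpaceTime m)) (z : SpaceTime m) :
    (smM₁ stDir timeDir Complex.I σ (smoothExp (-σ) * u)
      + smM₂ stDir timeDir Complex.I σ (smoothExp (-σ) * u)).1 z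
      = Complex.exp (-σ.1 z) * schrodingerClassical u.1 z := by
  have h := algM_conj (fun j : Fin (m + 1) => dirDeriv (stDir j)) (dirDeriv timeDir) σ
    (smoothExp (-σ)) u Complex.I (fun j => by rw [dirDeriv_smoothExp, map_neg])
    (by rw [dirDeriv_smoothExp, map_neg])
  rw [smM₁, smM₂, h]
  simp only [Subalgebra.coe_mul, Subalgebra.coe_add, Pi.mul_apply, Pi.add_apply,
    smoothFun_sum_apply]
  rfl

theorem dirDeriv_exp_mul_apply (σ u : smoothFun (SpaceTime m)) (e z : SpaceTime m) :
    (dirDeriv e (smoothExp (-σ) * u)).1 z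
      = Complex.exp (-σ.1 z) * (fderiv ℝ u.1 z e - (dirDeriv e σ).1 z * u.1 z) := by
  have h : dirDeriv e (smoothExp (-σ) * u)
      = smoothExp (-σ) * (dirDeriv e u - dirDeriv e σ * u) := by
    simp only [Derivation.leibniz, dirDeriv_smoothExp, map_neg, smul_eq_mul]
    ring
  rw [h]
  rfl

theorem smM₂_apply {σ u : smoothFun (SpaceTime m)} {z : SpaceTime m} {s : ℝ}
    {η : SpaceTime m → ℝ}
    (h1 : ∀ e, (dirDeriv e σ).1 z = ((s * pderiv e η z : ℝ) : ℂ))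
    (h2 : ∀ e, (dirDeriv e (dirDeriv e σ)).1 z = ((s * pderiv e (pderiv e η) z : ℝ) : ℂ)) :
    (smM₂ stDir timeDir Complex.I σ (smoothExp (-σ) * u)).1 z
      = Complex.exp (-σ.1 z)
        * transport s η z (u.1 z) (fun j => fderiv ℝ u.1 z (stDir j)) := by
  have hc : ∀ c : ℂ, (algebraMap ℂ (smoothFun (SpaceTime m)) c).1 z = c := fun c => rfl
  have hx : (smoothExp (-σ)).1 z = Complex.exp (-σ.1 z) := rfl
  have hn : (2 : smoothFun (SpaceTime m)).1 z = 2 := rfl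
  simp only [smM₂, algM₂, Subalgebra.coe_mul, Subalgebra.coe_add, Pi.mul_apply, Pi.add_apply,
    smoothFun_sum_apply]
  simp only [dirDeriv_exp_mul_apply, h1, h2, hc, hx, hn, transport]
  rw [mul_add, mul_add, Finset.mul_sum]
  congr 1
  · congr 1
    · ring
    · refine Finset.sum_congr rfl fun j _ => ?_
      push_cast
      ring
  · push_cast
    rw [Finset.mul_sum]
    ring

end Evaluate

theorem fderiv_apply_eq_zero_of_notMem_tsupport {E F : Type*} [NormedAddCommGroup E]
    [NormedSpace ℝ E] [NormedAddCommGroup F] [NormedSpace ℝ F] {f : E → F} {z : E}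
    (hz : z ∉ tsupport f) (e : E) : fderiv ℝ f z e = 0 := by
  rw [fderiv_of_notMem_tsupport ℝ hz]; rfl

theorem transport_zero (s : ℝ) (η : SpaceTime m → ℝ) (z : SpaceTime m) :
    transport s η z 0 (fun _ => 0) = 0 := by
  simp [transport]

theorem energyDensity_zero (s : ℝ) (η : SpaceTime m → ℝ) (z : SpaceTime m) :
    energyDensity s η z 0 (fun _ => 0) 0 = 0 := by
  simp [energyDensity, transport_zero]

theorem schrodingerClassical_eq_zero {u : SpaceTime m → ℂ} {z : SpaceTime m}
    (hz : z ∉ tsupport u) : schrodingerClassical u z = 0 := by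
  have h : ∀ j, fderiv ℝ (fun y => fderiv ℝ u y (stDir j)) z (stDir j) = 0 := fun j =>
    fderiv_apply_eq_zero_of_notMem_tsupport
      (fun h => hz (tsupport_fderiv_apply_subset ℝ (stDir j) h)) _
  simp [schrodingerClassical, h, fderiv_apply_eq_zero_of_notMem_tsupport hz]

/-- The energy identity is applied to v = e^{-σ}u, whose right-hand side is the weighted norm of
i∂ₜu + Δu, and the commutator form is bounded below pointwise on the support of u. -/
theorem carlemanEstimate_of_isTest {ω : Set (EuclideanSpace ℝ (Fin m))}
    (hωb : Bornology.IsBounded ω) (hne : ω.Nonempty)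
    {x₀ : EuclideanSpace ℝ (Fin m)} (hx₀ : x₀ ∉ closure ω)
    {r lam T : ℝ} (hr : 1 < r) (hlam : 0 < lam) (hT : 0 < T) :
    ∃ s₀ : ℝ, 1 ≤ s₀ ∧ ∃ C : ℝ, 1 ≤ C ∧ ∀ s : ℝ, s₀ ≤ s → ∀ u : SpaceTime m → ℂ,
      IsTest (stCylinder ω T) u →
      CarlemanEstimate (stCylinder ω T) s C (eta ω x₀ r lam T) u
        (fun j z => fderiv ℝ u z (stDir j)) (schrodingerClassical u) := by
  obtain ⟨δ, hδ, hδω⟩ := exists_lt_betaTilde hx₀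
  set R := sSup (betaTilde x₀ '' ω) with hR
  have hRpos : 0 < R := sSup_betaTilde_pos hωb hne hx₀
  set c₀ := Real.exp (2 * lam * weightK ω x₀ r) with hc₀
  have hc₀pos : 0 < c₀ := Real.exp_pos _
  set q₀ := ∑ _j : Fin (m + 1), ∑ _k : Fin (m + 1),
      c₀ * (2 * (2 * lam) ^ 2 + 4 * (2 * lam) ^ 3 * R + (2 * lam + (2 * lam) ^ 2 * R) ^ 2) with hq₀
  have hq₀0 : 0 ≤ q₀ := Finset.sum_nonneg fun _ _ => Finset.sum_nonneg fun _ _ => by positivity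
  -- Since β ≤ 2K on the cylinder, e^{2λK} serves both as the constant c₀ in the weight and as the
  -- upper bound B for b.
  obtain ⟨s₀, hs₀, C, hC, key⟩ := formValue_controls (ι := Fin (m + 1)) (B := c₀) hlam hT hδ
    hRpos.le hq₀0 hc₀pos.le
  refine ⟨s₀, hs₀, C, hC, fun s hs u hu => ?_⟩
  set η := eta ω x₀ r lam T with hη
  have hs0 : 0 < s := by linarith
  have hpos : ∀ z ∈ tsupport u, 0 < T ^ 2 - z.2 ^ 2 := fun z hz => by
    have := (hu.tsupport_subset hz).2
    nlinarith [this.1, this.2]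
  -- The support of u is compact, hence at a positive distance from t = ±T; ε is chosen so that σ =
  -- sη on it.
  obtain ⟨ε, hε, hεu⟩ : ∃ ε : ℝ, 0 < ε ∧ ∀ z ∈ tsupport u, 2 * ε < T ^ 2 - z.2 ^ 2 := by
    rcases (tsupport u).eq_empty_or_nonempty with h0 | h0
    · exact ⟨1, one_pos, by simp [h0]⟩
    · obtain ⟨z₁, hz₁, hmin⟩ := IsCompact.exists_isMinOn (show IsCompact (tsupport u) from
        hu.hasCompactSupport) h0
        (f := fun z : SpaceTime m => T ^ 2 - z.2 ^ 2) (by fun_prop)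
      refine ⟨(T ^ 2 - z₁.2 ^ 2) / 4, by have := hpos z₁ hz₁; positivity, fun z hz => ?_⟩
      have h1 : T ^ 2 - z₁.2 ^ 2 ≤ T ^ 2 - z.2 ^ 2 := hmin hz
      linarith [hpos z₁ hz₁]
  set σ := weightS ω x₀ r lam s (regTime T ε) (contDiff_regTime hε T) with hσ
  have hσreal : smoothConj σ = σ := by
    ext z
    rw [smoothConj_apply]
    change (starRingEnd ℂ) ((s : ℂ) * (regTime T ε z.2 : ℂ)
      * ((c₀ : ℂ) - (expBetaS ω x₀ r lam).1 z)) = (s : ℂ) * (regTime T ε z.2 : ℂ)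
      * ((c₀ : ℂ) - (expBetaS ω x₀ r lam).1 z)
    rw [expBetaS_apply]
    simp only [map_mul, map_sub, Complex.conj_ofReal]
  set uS : smoothFun (SpaceTime m) := ⟨u, mem_smoothFun.2 hu.contDiff⟩ with huS
  set v := smoothExp (-σ) * uS with hv
  have hvJ : v ∈ compactIdeal (SpaceTime m) :=
    Ideal.mul_mem_left _ _ (mem_compactIdeal.2 hu.hasCompactSupport)
  obtain ⟨hint, hid⟩ := integral_norm_sq_smM (μ := (volume : Measure (SpaceTime m)))
    stDir timeDir hσreal hvJ
  set a := smM₁ stDir timeDir Complex.I σ v with ha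
  set b := smM₂ stDir timeDir Complex.I σ v with hb
  set B := smForm stDir timeDir σ v (smoothConj v) with hB
  have hab : ∀ z, (a + b).1 z = Complex.exp (-σ.1 z) * schrodingerClassical u z :=
    fun z => smM_conj_apply σ uS z
  have hexp : ∀ z ∈ tsupport u, Complex.exp (-σ.1 z) = ((Real.exp (-s * η z) : ℝ) : ℂ) := by
    intro z hz
    rw [hσ, weightS_eq_eta hε z (hεu z hz), Complex.ofReal_exp, ← hη]
    push_cast
    ring_nf
  have hnorm : ∀ z ∈ tsupport u, ∀ c : ℂ, ‖Complex.exp (-σ.1 z) * c‖ ^ 2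
      = Real.exp (-s * η z) ^ 2 * ‖c‖ ^ 2 := by
    intro z hz c
    rw [hexp z hz, norm_mul, mul_pow, Complex.norm_real, Real.norm_eq_abs, sq_abs]
  have hvz : ∀ z, v.1 z = Complex.exp (-σ.1 z) * u z := fun z => rfl
  have hpoint : ∀ z ∈ tsupport u,
      energyDensity s η z (u z) (fun j => fderiv ℝ u z (stDir j)) (schrodingerClassical u z)
        ≤ C * (‖a.1 z‖ ^ 2 + ‖b.1 z‖ ^ 2 + (B.1 z).re) := by
    intro z hz
    have hzε := hεu z hz
    have hzω : transverse z.1 ∈ ω := (hu.tsupport_subset hz).1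
    have hbz : b.1 z = Complex.exp (-σ.1 z)
        * transport s η z (u z) (fun j => fderiv ℝ u z (stDir j)) :=
      smM₂_apply (fun e => dirDeriv_weightS hT hε e z hzε)
        (fun e => dirDeriv_dirDeriv_weightS hT hε e e z hzε)
    have haz : a.1 z = Complex.exp (-σ.1 z) * (schrodingerClassical u z
        - transport s η z (u z) (fun j => fderiv ℝ u z (stDir j))) := by
      have h1 := hab z
      rw [Subalgebra.coe_add, Pi.add_apply, hbz] at h1
      rw [mul_sub, ← h1]
      ring
    obtain ⟨hℓ, hℓ₁, hℓ₂⟩ := regTime_bounds hT hε hzε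
    have hY := sum_offset_sq x₀ z
    have hbeta0 := beta_nonneg hωb hne hx₀ hr z.1
    have hbeta1 : Real.exp (lam * beta ω x₀ r z.1) ≤ c₀ := by
      rw [hc₀, Real.exp_le_exp]
      have h1 := beta_le (x₀ := x₀) (r := r) hωb (show z.1 ∈ infCylinder ω from hzω)
      have h2 : 0 ≤ (r - 1) * R := mul_nonneg (by linarith) hRpos.le
      nlinarith
    have hbeta2 : 1 ≤ Real.exp (lam * beta ω x₀ r z.1) := Real.one_le_exp (by positivity)
    have hYR : ∑ j, offset x₀ j z ^ 2 ≤ R := by rw [hY]; exact betaTilde_le hωb hzω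
    have hform := key transInd (fun j => offset x₀ j z) s (regTime T ε z.2)
      (deriv (regTime T ε) z.2) (deriv (deriv (regTime T ε)) z.2)
      (Real.exp (lam * beta ω x₀ r z.1))
      (biLapValue x₀ lam (Real.exp (lam * beta ω x₀ r z.1)) z)
      transInd_nonneg transInd_le_one (transInd_mul_offset x₀ z) hs hℓ hℓ₁ hℓ₂ hbeta2 hbeta1 hbeta1
      (by rw [hY]; exact hδω _ hzω) hYR
      (abs_biLapValue_le hlam (by positivity) hbeta1 hYR)
      (fun j => (dirDeriv (stDir j) v).1 z) (v.1 z)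
    rw [← smForm_weightS_re ω x₀ r lam s (regTime T ε) (contDiff_regTime hε T) v z] at hform
    have hgrad : ∀ j, (dirDeriv (stDir j) v).1 z
        - ((s * regTime T ε z.2 * (2 * lam * offset x₀ j z
          * Real.exp (lam * beta ω x₀ r z.1)) : ℝ) : ℂ) * v.1 z
        = Complex.exp (-σ.1 z) * fderiv ℝ u z (stDir j) := by
      -- This identifies the combination controlled by the form with e^{-σ}∂ⱼu.
      intro j
      have h1 : (dirDeriv (stDir j) σ).1 z = -((s * regTime T ε z.2 * (2 * lam * offset x₀ j z
          * Real.exp (lam * beta ω x₀ r z.1)) : ℝ) : ℂ) := by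
        rw [hσ, weightS_deriv]
        change -((s : ℂ) * (regTime T ε z.2 : ℂ) * (((2 * lam : ℝ) : ℂ) * (offset x₀ j z : ℂ)
          * (expBetaS ω x₀ r lam).1 z)) = _
        rw [expBetaS_apply]
        push_cast
        ring
      rw [hv, dirDeriv_exp_mul_apply, h1, ← hv, hvz]
      ring
    simp only [hgrad] at hform
    rw [← hσ, ← hB, hvz z] at hform
    simp only [hnorm z hz] at hform
    rw [Fin.sum_univ_castSucc] at hform
    simp only [transInd_castSucc, transInd_last, one_mul, zero_mul, add_zero,
      ← Finset.mul_sum] at hform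
    rw [haz, hbz, hnorm z hz, hnorm z hz, energyDensity]
    set e2 := Real.exp (-s * η z) ^ 2
    have h3 : e2 * (‖schrodingerClassical u z
          - transport s η z (u z) (fun j => fderiv ℝ u z (stDir j))‖ ^ 2
          + ‖transport s η z (u z) (fun j => fderiv ℝ u z (stDir j))‖ ^ 2)
        ≤ C * (e2 * (‖schrodingerClassical u z
          - transport s η z (u z) (fun j => fderiv ℝ u z (stDir j))‖ ^ 2
          + ‖transport s η z (u z) (fun j => fderiv ℝ u z (stDir j))‖ ^ 2)) :=
      le_mul_of_one_le_left (by positivity) hC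
    linarith
  have hzero : ∀ z ∉ tsupport u,
      energyDensity s η z (u z) (fun j => fderiv ℝ u z (stDir j)) (schrodingerClassical u z) = 0 := by
    intro z hz
    simp only [image_eq_zero_of_notMem_tsupport hz, schrodingerClassical_eq_zero hz,
      fderiv_apply_eq_zero_of_notMem_tsupport hz, energyDensity_zero]
  have hdom : ∀ z, ENNReal.ofReal (energyDensity s η z (u z) (fun j => fderiv ℝ u z (stDir j))
      (schrodingerClassical u z)) ≤ ENNReal.ofReal (C * (‖a.1 z‖ ^ 2 + ‖b.1 z‖ ^ 2 + (B.1 z).re)) := by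
    intro z
    by_cases hz : z ∈ tsupport u
    · exact ENNReal.ofReal_le_ofReal (hpoint z hz)
    · rw [hzero z hz, ENNReal.ofReal_zero]; exact zero_le
  -- Nonnegativity is needed everywhere in order to pass between Bochner and Lebesgue integrals. Off
  -- the support σ need not be sη, but the form vanishes there with v and ∇v.
  have hnonneg : ∀ z, 0 ≤ C * (‖a.1 z‖ ^ 2 + ‖b.1 z‖ ^ 2 + (B.1 z).re) := by
    intro z
    by_cases hz : z ∈ tsupport u
    · refine le_trans ?_ (hpoint z hz)
      rw [energyDensity]
      positivity
    · have hu0 := image_eq_zero_of_notMem_tsupport hz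
      have hform : (B.1 z).re = 0 := by
        rw [hB, hσ, smForm_weightS_re]
        have h1 : v.1 z = 0 := by rw [hvz, hu0, mul_zero]
        have h2 : ∀ j, (dirDeriv (stDir j) v).1 z = 0 := fun j => by
          rw [hv, dirDeriv_exp_mul_apply]
          change Complex.exp (-σ.1 z) * (fderiv ℝ u z (stDir j) - (dirDeriv (stDir j) σ).1 z * u z) = 0
          rw [hu0, fderiv_apply_eq_zero_of_notMem_tsupport hz]
          simp
        simp [formValue, h1, h2]
      rw [hform]
      positivity
  have habint : Integrable (fun z => ‖(a + b).1 z‖ ^ 2) (volume : Measure (SpaceTime m)) :=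
    integrable_norm_sq_of_mem_compactIdeal (Ideal.add_mem _
      (smM₁_mem_compactIdeal stDir timeDir Complex.I σ hvJ)
      (smM₂_mem_compactIdeal stDir timeDir Complex.I σ hvJ))
  have hK : MeasurableSet (tsupport u) := (isClosed_tsupport u).measurableSet
  calc ∫⁻ z in stCylinder ω T, ENNReal.ofReal (energyDensity s η z (u z)
        (fun j => fderiv ℝ u z (stDir j)) (schrodingerClassical u z))
      ≤ ∫⁻ z, ENNReal.ofReal (C * (‖a.1 z‖ ^ 2 + ‖b.1 z‖ ^ 2 + (B.1 z).re)) :=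
        (setLIntegral_le_lintegral _ _).trans (lintegral_mono hdom)
    _ = ENNReal.ofReal (∫ z, C * (‖a.1 z‖ ^ 2 + ‖b.1 z‖ ^ 2 + (B.1 z).re)) :=
        (ofReal_integral_eq_lintegral_ofReal (hint.const_mul C) (ae_of_all _ hnonneg)).symm
    _ = ENNReal.ofReal C * ENNReal.ofReal (∫ z, ‖(a + b).1 z‖ ^ 2) := by
        rw [integral_const_mul, hid, ENNReal.ofReal_mul (by linarith)]
    _ = ENNReal.ofReal C * ∫⁻ z, ENNReal.ofReal (‖(a + b).1 z‖ ^ 2) := by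
        rw [ofReal_integral_eq_lintegral_ofReal habint (ae_of_all _ fun z => sq_nonneg _)]
    _ = ENNReal.ofReal C * ∫⁻ z in tsupport u,
          ENNReal.ofReal (Real.exp (-s * η z) ^ 2 * ‖schrodingerClassical u z‖ ^ 2) := by
        congr 1
        rw [← lintegral_indicator hK]
        refine lintegral_congr fun z => ?_
        by_cases hz : z ∈ tsupport u
        · rw [indicator_of_mem hz, hab, hnorm z hz]
        · rw [indicator_of_notMem hz, hab, schrodingerClassical_eq_zero hz]
          simp
    _ ≤ _ := by
        gcongr
        exact hu.tsupport_subset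

end Carleman
end

noncomputable section

namespace Carleman

variable {m : ℕ}

/-! ### Weak solutions -/

section Test

variable {E : Type*} [NormedAddCommGroup E] [NormedSpace ℝ E] {U V : Set E}

theorem IsTest.mono {φ : E → ℂ} (h : IsTest U φ) (hUV : U ⊆ V) : IsTest V φ :=
  ⟨h.contDiff, h.hasCompactSupport, h.tsupport_subset.trans hUV⟩

theorem IsTest.fderiv_apply {φ : E → ℂ} (h : IsTest U φ) (e : E) :
    IsTest U fun z => fderiv ℝ φ z e :=
  ⟨contDiff_fderiv_apply_const h.contDiff e, h.hasCompactSupport.fderiv_apply (𝕜 := ℝ) e,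
    (tsupport_fderiv_apply_subset ℝ e).trans h.tsupport_subset⟩

/-- The factor a is smooth on V only, and the product is smooth everywhere because φ is supported in
V. This admits weights that are singular at the boundary of V. -/
theorem IsTest.mul {φ a : E → ℂ} (h : IsTest V φ) (hV : IsOpen V)
    (ha : ContDiffOn ℝ (⊤ : ℕ∞) a V) (haU : tsupport a ∩ V ⊆ U) :
    IsTest U fun z => a z * φ z := by
  refine ⟨?_, h.hasCompactSupport.mul_left, ?_⟩
  · refine contDiff_iff_contDiffAt.2 fun z => ?_
    by_cases hz : z ∉ tsupport fun z => a z * φ z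
    · exact contDiffAt_const.congr_of_eventuallyEq (notMem_tsupport_iff_eventuallyEq.1 hz)
    rw [not_not] at hz
    have hzV : z ∈ V := h.tsupport_subset (closure_mono (Function.support_mul_subset_right a φ) hz)
    exact ((ha z hzV).contDiffAt (hV.mem_nhds hzV)).mul h.contDiff.contDiffAt
  · intro z hz
    exact haU ⟨closure_mono (Function.support_mul_subset_left a φ) hz,
      h.tsupport_subset (closure_mono (Function.support_mul_subset_right a φ) hz)⟩

theorem contDiffOn_fderiv_apply {a : E → ℂ} (hV : IsOpen V) (ha : ContDiffOn ℝ (⊤ : ℕ∞) a V)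
    (e : E) : ContDiffOn ℝ (⊤ : ℕ∞) (fun z => fderiv ℝ a z e) V :=
  (ha.fderiv_of_isOpen hV (m := (⊤ : ℕ∞)) (by simp)).clm_apply contDiffOn_const

theorem IsTest.eq_zero_of_notMem {φ : E → ℂ} (h : IsTest U φ) {z : E} (hz : z ∉ U) : φ z = 0 :=
  image_eq_zero_of_notMem_tsupport fun h' => hz (h.tsupport_subset h')

theorem IsTest.setIntegral_eq [MeasurableSpace E] {μ : Measure E} {φ : E → ℂ} (h : IsTest U φ)
    (hV : MeasurableSet V) (hUV : U ⊆ V) (f : E → ℂ) :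
    ∫ z in V, f z * φ z ∂μ = ∫ z in U, f z * φ z ∂μ :=
  setIntegral_eq_of_subset_of_forall_sdiff_eq_zero hV hUV fun z hz => by
    rw [h.eq_zero_of_notMem hz.2, mul_zero]

theorem IsTest.integrableOn_of_subset [MeasurableSpace E] {μ : Measure E} {φ : E → ℂ}
    (h : IsTest U φ)
    (hV : MeasurableSet V) {f : E → ℂ}
    (hf : IntegrableOn (fun z => f z * φ z) U μ) : IntegrableOn (fun z => f z * φ z) V μ :=
  hf.of_forall_sdiff_eq_zero hV fun z hz => by rw [h.eq_zero_of_notMem hz.2, mul_zero]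

end Test

/-- The formal transpose of `i ∂ₜ + Δ`. -/
def schrodingerTranspose (φ : SpaceTime m → ℂ) (z : SpaceTime m) : ℂ :=
  -Complex.I * fderiv ℝ φ z timeDir
    + ∑ j, fderiv ℝ (fun y => fderiv ℝ φ y (stDir j)) z (stDir j)

/-- On `U`, the function `w` has the weak spatial gradient `G`, and `i ∂ₜw + Δw = h` in the sense of
distributions. -/
structure WeakSol (U : Set (SpaceTime m)) (w : SpaceTime m → ℂ)
    (G : Fin (m + 1) → SpaceTime m → ℂ) (h : SpaceTime m → ℂ) : Prop where
  integrable : ∀ φ, IsTest U φ → IntegrableOn (fun z => w z * φ z) U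
  integrable_grad : ∀ j φ, IsTest U φ → IntegrableOn (fun z => G j z * φ z) U
  integrable_rhs : ∀ φ, IsTest U φ → IntegrableOn (fun z => h z * φ z) U
  grad : ∀ j φ, IsTest U φ →
    ∫ z in U, w z * fderiv ℝ φ z (stDir j) = -∫ z in U, G j z * φ z
  eqn : ∀ φ, IsTest U φ → ∫ z in U, w z * schrodingerTranspose φ z = ∫ z in U, h z * φ z

/-- The gradient of a product. -/
def mulGrad (a w : SpaceTime m → ℂ) (G : Fin (m + 1) → SpaceTime m → ℂ) (j : Fin (m + 1))
    (z : SpaceTime m) : ℂ :=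
  a z * G j z + fderiv ℝ a z (stDir j) * w z

/-- The value of `i ∂ₜ + Δ` on a product. -/
def mulRhs (a w : SpaceTime m → ℂ) (G : Fin (m + 1) → SpaceTime m → ℂ) (h : SpaceTime m → ℂ)
    (z : SpaceTime m) : ℂ :=
  a z * h z + ∑ j, 2 * (fderiv ℝ a z (stDir j) * G j z) + schrodingerClassical a z * w z

/-- A weak Leibniz rule, obtained by testing with aφ and (∂ⱼa)φ. It serves two purposes: with V the
whole space and a supported in U it extends a localised solution by zero; with U = V it multiplies
by the singular weight e^{-sη}. -/
theorem WeakSol.mul {U V : Set (SpaceTime m)} {w : SpaceTime m → ℂ}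
    {G : Fin (m + 1) → SpaceTime m → ℂ} {h : SpaceTime m → ℂ} (hw : WeakSol U w G h)
    (hV : IsOpen V) (hUV : U ⊆ V) {a : SpaceTime m → ℂ}
    (ha : ContDiffOn ℝ (⊤ : ℕ∞) a V) (haU : tsupport a ∩ V ⊆ U) :
    WeakSol V (fun z => a z * w z) (mulGrad a w G) (mulRhs a w G h) := by
  have hVm := hV.measurableSet
  have hd : ∀ e, ContDiffOn ℝ (⊤ : ℕ∞) (fun z => fderiv ℝ a z e) V :=
    fun e => contDiffOn_fderiv_apply hV ha e
  have hdU : ∀ e, tsupport (fun z => fderiv ℝ a z e) ∩ V ⊆ U := fun e z hz =>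
    haU ⟨tsupport_fderiv_apply_subset ℝ e hz.1, hz.2⟩
  have hdd : ∀ e, ContDiffOn ℝ (⊤ : ℕ∞) (fun z => fderiv ℝ (fun y => fderiv ℝ a y e) z e) V :=
    fun e => contDiffOn_fderiv_apply hV (hd e) e
  have hddU : ∀ e, tsupport (fun z => fderiv ℝ (fun y => fderiv ℝ a y e) z e) ∩ V ⊆ U :=
    fun e z hz => hdU e ⟨tsupport_fderiv_apply_subset ℝ e hz.1, hz.2⟩
  have t0 : ∀ {φ}, IsTest V φ → IsTest U fun z => a z * φ z := fun hφ => hφ.mul hV ha haU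
  have t1 : ∀ {φ}, IsTest V φ → ∀ e, IsTest U fun z => fderiv ℝ a z e * φ z :=
    fun hφ e => hφ.mul hV (hd e) (hdU e)
  have t2 : ∀ {φ}, IsTest V φ → ∀ e,
      IsTest U fun z => fderiv ℝ (fun y => fderiv ℝ a y e) z e * φ z :=
    fun hφ e => hφ.mul hV (hdd e) (hddU e)
  have hda : ∀ z ∈ V, DifferentiableAt ℝ a z := fun z hz =>
    ((ha z hz).contDiffAt (hV.mem_nhds hz)).differentiableAt (by simp)
  have hdda : ∀ e, ∀ z ∈ V, DifferentiableAt ℝ (fun y => fderiv ℝ a y e) z := fun e z hz =>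
    ((hd e z hz).contDiffAt (hV.mem_nhds hz)).differentiableAt (by simp)
  have hdφ : ∀ {φ}, IsTest V φ → ∀ z, DifferentiableAt ℝ φ z := fun hφ z =>
    (hφ.contDiff.differentiable (by simp)) z
  have hpr : ∀ {φ}, IsTest V φ → ∀ e, ∀ z ∈ V, fderiv ℝ (fun y => a y * φ y) z e
      = a z * fderiv ℝ φ z e + fderiv ℝ a z e * φ z := by
    intro φ hφ e z hz
    rw [fderiv_fun_mul (hda z hz) (hdφ hφ z)]
    simp [mul_comm]
  have hpr' : ∀ {φ}, IsTest V φ → ∀ e, ∀ z ∈ V, fderiv ℝ (fun y => fderiv ℝ a y e * φ y) z e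
      = fderiv ℝ a z e * fderiv ℝ φ z e + fderiv ℝ (fun y => fderiv ℝ a y e) z e * φ z := by
    intro φ hφ e z hz
    rw [fderiv_fun_mul (hdda e z hz) (hdφ hφ z)]
    simp [mul_comm]
  -- The mixed term 2∂a∂φ is written through the derivative of the test function (∂a)φ, to which the
  -- weak gradient identity applies.
  have hpr2 : ∀ {φ}, IsTest V φ → ∀ e, ∀ z ∈ V,
      fderiv ℝ (fun x => fderiv ℝ (fun y => a y * φ y) x e) z e
      = a z * fderiv ℝ (fun y => fderiv ℝ φ y e) z e
        + (2 * fderiv ℝ (fun y => fderiv ℝ a y e * φ y) z e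
          - fderiv ℝ (fun y => fderiv ℝ a y e) z e * φ z) := by
    intro φ hφ e z hz
    have heq : (fun x => fderiv ℝ (fun y => a y * φ y) x e) =ᶠ[𝓝 z]
        fun x => a x * fderiv ℝ φ x e + fderiv ℝ a x e * φ x := by
      filter_upwards [hV.mem_nhds hz] with x hx using hpr hφ e x hx
    have hφ' := hφ.fderiv_apply e
    rw [heq.fderiv_eq, fderiv_fun_add ((hda z hz).fun_mul (hdφ hφ' z))
        ((hdda e z hz).fun_mul (hdφ hφ z)),
      add_apply, hpr hφ' e z hz, hpr' hφ e z hz]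
    ring
  refine ⟨?_, ?_, ?_, ?_, ?_⟩
  · intro φ hφ
    refine ((t0 hφ).integrableOn_of_subset hVm (hw.integrable _ (t0 hφ))).congr
      (ae_of_all _ fun z => ?_)
    simp only
    ring
  · intro j φ hφ
    refine (((t0 hφ).integrableOn_of_subset hVm (hw.integrable_grad j _ (t0 hφ))).add
      ((t1 hφ (stDir j)).integrableOn_of_subset hVm (hw.integrable _ (t1 hφ (stDir j))))).congr
      (ae_of_all _ fun z => ?_)
    simp only [Pi.add_apply, mulGrad]
    ring
  · intro φ hφ
    have h1 := (t0 hφ).integrableOn_of_subset hVm (hw.integrable_rhs _ (t0 hφ))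
    have h2 := integrable_finsetSum (μ := volume.restrict V) Finset.univ fun j _ =>
      (((t1 hφ (stDir j)).integrableOn_of_subset hVm
        (hw.integrable_grad j _ (t1 hφ (stDir j)))).const_mul 2)
    have h3 := ((t1 hφ timeDir).integrableOn_of_subset hVm
      (hw.integrable _ (t1 hφ timeDir))).const_mul Complex.I
    have h4 := integrable_finsetSum (μ := volume.restrict V) Finset.univ fun j _ =>
      ((t2 hφ (stDir j)).integrableOn_of_subset hVm (hw.integrable _ (t2 hφ (stDir j))))
    refine ((h1.add h2).add (Integrable.add h3 h4)).congr (ae_of_all _ fun z => ?_)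
    simp only [Pi.add_apply, mulRhs, schrodingerClassical, add_mul, Finset.sum_mul]
    congr 1
    · congr 1
      · ring
      · exact Finset.sum_congr rfl fun j _ => by ring
    · congr 1
      · ring
      · exact Finset.sum_congr rfl fun j _ => by ring
  · intro j φ hφ
    have hi1 := ((t0 hφ).fderiv_apply (stDir j)).integrableOn_of_subset hVm
      (hw.integrable _ ((t0 hφ).fderiv_apply (stDir j)))
    have hi2 := (t1 hφ (stDir j)).integrableOn_of_subset hVm (hw.integrable _ (t1 hφ (stDir j)))
    have hi3 := (t0 hφ).integrableOn_of_subset hVm (hw.integrable_grad j _ (t0 hφ))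
    calc ∫ z in V, (a z * w z) * fderiv ℝ φ z (stDir j)
        = ∫ z in V, (w z * fderiv ℝ (fun y => a y * φ y) z (stDir j)
          - w z * (fderiv ℝ a z (stDir j) * φ z)) :=
          setIntegral_congr_fun hVm fun z hz => by
            simp only [hpr hφ (stDir j) z hz]; ring
      _ = -(∫ z in V, G j z * (a z * φ z)) - ∫ z in V, w z * (fderiv ℝ a z (stDir j) * φ z) := by
          rw [integral_sub hi1 hi2, ((t0 hφ).fderiv_apply (stDir j)).setIntegral_eq hVm hUV,
            hw.grad j _ (t0 hφ), (t0 hφ).setIntegral_eq hVm hUV]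
      _ = -∫ z in V, (G j z * (a z * φ z) + w z * (fderiv ℝ a z (stDir j) * φ z)) := by
          rw [integral_add hi3 hi2]; ring
      _ = _ := by
          congr 1
          exact integral_congr_ae (ae_of_all _ fun z => by simp only [mulGrad]; ring)
  · intro φ hφ
    have hi0 : IntegrableOn (fun z => w z * schrodingerTranspose (fun y => a y * φ y) z) V := by
      have h1 := (((t0 hφ).fderiv_apply timeDir).integrableOn_of_subset hVm
        (hw.integrable _ ((t0 hφ).fderiv_apply timeDir))).const_mul (-Complex.I)
      have h2 := integrable_finsetSum (μ := volume.restrict V) Finset.univ fun j _ =>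
        ((((t0 hφ).fderiv_apply (stDir j)).fderiv_apply (stDir j)).integrableOn_of_subset hVm
          (hw.integrable _ (((t0 hφ).fderiv_apply (stDir j)).fderiv_apply (stDir j))))
      refine (Integrable.add h1 h2).congr (ae_of_all _ fun z => ?_)
      simp only [Pi.add_apply, schrodingerTranspose, mul_add, Finset.mul_sum]
      ring
    have hi1 := ((t1 hφ timeDir).integrableOn_of_subset hVm
      (hw.integrable _ (t1 hφ timeDir))).const_mul Complex.I
    have hi2 : ∀ j, IntegrableOn (fun z => 2 * (w z *
        fderiv ℝ (fun y => fderiv ℝ a y (stDir j) * φ y) z (stDir j))) V := fun j =>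
      ((((t1 hφ (stDir j)).fderiv_apply (stDir j)).integrableOn_of_subset hVm
        (hw.integrable _ ((t1 hφ (stDir j)).fderiv_apply (stDir j))))).const_mul 2
    have hi3 : ∀ j, IntegrableOn (fun z => w z *
        (fderiv ℝ (fun y => fderiv ℝ a y (stDir j)) z (stDir j) * φ z)) V := fun j =>
      (t2 hφ (stDir j)).integrableOn_of_subset hVm (hw.integrable _ (t2 hφ (stDir j)))
    have hi23 : ∀ j, IntegrableOn (fun z => 2 * (w z *
        fderiv ℝ (fun y => fderiv ℝ a y (stDir j) * φ y) z (stDir j)) - w z *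
        (fderiv ℝ (fun y => fderiv ℝ a y (stDir j)) z (stDir j) * φ z)) V :=
      fun j => (hi2 j).sub (hi3 j)
    have hi4 := (t0 hφ).integrableOn_of_subset hVm (hw.integrable_rhs _ (t0 hφ))
    have hi5 : ∀ j, IntegrableOn (fun z => 2 * (G j z * (fderiv ℝ a z (stDir j) * φ z))) V :=
      fun j => ((t1 hφ (stDir j)).integrableOn_of_subset hVm
        (hw.integrable_grad j _ (t1 hφ (stDir j)))).const_mul 2
    have hi53 : ∀ j, IntegrableOn (fun z => 2 * (G j z * (fderiv ℝ a z (stDir j) * φ z)) + w z *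
        (fderiv ℝ (fun y => fderiv ℝ a y (stDir j)) z (stDir j) * φ z)) V :=
      fun j => (hi5 j).add (hi3 j)
    have hs23 := integrable_finsetSum (μ := volume.restrict V) Finset.univ fun j _ => hi23 j
    have hs53 := integrable_finsetSum (μ := volume.restrict V) Finset.univ fun j _ => hi53 j
    have hi01 : IntegrableOn (fun z => w z * schrodingerTranspose (fun y => a y * φ y) z
        + Complex.I * (w z * (fderiv ℝ a z timeDir * φ z))) V := Integrable.add hi0 hi1
    have hi41 : IntegrableOn (fun z => h z * (a z * φ z)
        + Complex.I * (w z * (fderiv ℝ a z timeDir * φ z))) V := Integrable.add hi4 hi1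
    have hvanish : ∫ z in V, w z * schrodingerTranspose (fun y => a y * φ y) z
        = ∫ z in U, w z * schrodingerTranspose (fun y => a y * φ y) z :=
      setIntegral_eq_of_subset_of_forall_sdiff_eq_zero hVm hUV fun z hz => by
        rw [schrodingerTranspose, ((t0 hφ).fderiv_apply timeDir).eq_zero_of_notMem hz.2,
          Finset.sum_eq_zero fun j _ =>
            (((t0 hφ).fderiv_apply (stDir j)).fderiv_apply (stDir j)).eq_zero_of_notMem hz.2]
        simp
    have hterm : ∀ j, ∫ z in V, (2 * (w z *
        fderiv ℝ (fun y => fderiv ℝ a y (stDir j) * φ y) z (stDir j)) - w z *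
        (fderiv ℝ (fun y => fderiv ℝ a y (stDir j)) z (stDir j) * φ z))
        = -∫ z in V, (2 * (G j z * (fderiv ℝ a z (stDir j) * φ z)) + w z *
        (fderiv ℝ (fun y => fderiv ℝ a y (stDir j)) z (stDir j) * φ z)) := by
      intro j
      rw [integral_sub (hi2 j) (hi3 j), integral_add (hi5 j) (hi3 j), integral_const_mul,
        integral_const_mul, ((t1 hφ (stDir j)).fderiv_apply (stDir j)).setIntegral_eq hVm hUV,
        hw.grad j _ (t1 hφ (stDir j)), (t1 hφ (stDir j)).setIntegral_eq hVm hUV]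
      ring
    calc ∫ z in V, (a z * w z) * schrodingerTranspose φ z
        = ∫ z in V, (w z * schrodingerTranspose (fun y => a y * φ y) z
          + Complex.I * (w z * (fderiv ℝ a z timeDir * φ z))
          - ∑ j, (2 * (w z * fderiv ℝ (fun y => fderiv ℝ a y (stDir j) * φ y) z (stDir j))
            - w z * (fderiv ℝ (fun y => fderiv ℝ a y (stDir j)) z (stDir j) * φ z))) := by
          refine setIntegral_congr_fun hVm fun z hz => ?_
          simp only [schrodingerTranspose, hpr hφ timeDir z hz, hpr2 hφ _ z hz]
          simp only [Finset.sum_add_distrib, Finset.sum_sub_distrib, ← Finset.mul_sum,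
            mul_add, mul_sub]
          simp only [mul_left_comm _ (2 : ℂ)]
          ring
      _ = (∫ z in V, h z * (a z * φ z)) + Complex.I * (∫ z in V, w z * (fderiv ℝ a z timeDir * φ z))
          + ∑ j, ∫ z in V, (2 * (G j z * (fderiv ℝ a z (stDir j) * φ z))
            + w z * (fderiv ℝ (fun y => fderiv ℝ a y (stDir j)) z (stDir j) * φ z)) := by
          rw [integral_sub hi01 hs23, integral_add hi0 hi1, integral_const_mul, hvanish,
            hw.eqn _ (t0 hφ), (t0 hφ).setIntegral_eq hVm hUV,
            integral_finsetSum _ fun j _ => hi23 j]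
          simp only [hterm, Finset.sum_neg_distrib, sub_neg_eq_add]
      _ = ∫ z in V, (h z * (a z * φ z) + Complex.I * (w z * (fderiv ℝ a z timeDir * φ z))
          + ∑ j, (2 * (G j z * (fderiv ℝ a z (stDir j) * φ z))
            + w z * (fderiv ℝ (fun y => fderiv ℝ a y (stDir j)) z (stDir j) * φ z))) := by
          rw [integral_add hi41 hs53, integral_add hi4 hi1, integral_const_mul,
            integral_finsetSum _ fun j _ => hi53 j]
      _ = _ := by
          refine integral_congr_ae (ae_of_all _ fun z => ?_)
          simp only [mulRhs, schrodingerClassical, add_mul, Finset.sum_mul,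
            Finset.sum_add_distrib]
          have h1 : ∑ j, 2 * (G j z * (fderiv ℝ a z (stDir j) * φ z))
              = ∑ j, 2 * (fderiv ℝ a z (stDir j) * G j z) * φ z :=
            Finset.sum_congr rfl fun j _ => by ring
          have h2 : ∑ j, w z * (fderiv ℝ (fun y => fderiv ℝ a y (stDir j)) z (stDir j) * φ z)
              = ∑ j, fderiv ℝ (fun y => fderiv ℝ a y (stDir j)) z (stDir j) * w z * φ z :=
            Finset.sum_congr rfl fun j _ => by ring
          rw [h1, h2]
          ring

end Carleman
end

noncomputable section

namespace Carleman

variable {m : ℕ}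

/-! ### Stability of the Carleman estimate under limits -/

theorem measurable_eta (ω : Set (EuclideanSpace ℝ (Fin m))) (x₀ : EuclideanSpace ℝ (Fin m))
    (r lam T : ℝ) : Measurable (eta ω x₀ r lam T) := by
  have h1 : Measurable fun z : SpaceTime m => beta ω x₀ r z.1 := by
    have : (fun z : SpaceTime m => beta ω x₀ r z.1)
        = fun z => ∑ j, offset x₀ j z ^ 2 + weightK ω x₀ r := by
      ext z; rw [sum_offset_sq, beta]
    rw [this]
    have h : ∀ j, Measurable (offset x₀ j) := fun j => (contDiff_offset x₀ j).continuous.measurable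
    fun_prop
  unfold eta
  fun_prop

theorem aemeasurable_transport {μ : Measure (SpaceTime m)} (s : ℝ)
    (η : SpaceTime m → ℝ) {u : SpaceTime m → ℂ} {G : Fin (m + 1) → SpaceTime m → ℂ}
    (hu : AEMeasurable u μ) (hG : ∀ j, AEMeasurable (G j) μ) :
    AEMeasurable (fun z => transport s η z (u z) (fun j => G j z)) μ := by
  have h1 : ∀ e (g : SpaceTime m → ℝ), Measurable (pderiv e g) := fun e g =>
    measurable_fderiv_apply_const ℝ g e
  have h2 := h1 timeDir η
  have h3 : ∀ j, Measurable (pderiv (stDir j) η) := fun j => h1 (stDir j) η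
  have h4 : ∀ j, Measurable (pderiv (stDir j) (pderiv (stDir j) η)) := fun j => h1 (stDir j) _
  unfold transport
  refine AEMeasurable.add (AEMeasurable.add ?_ ?_) ?_
  · exact (Measurable.aemeasurable (by fun_prop)).mul hu
  · refine Finset.aemeasurable_fun_sum _ fun j _ => ?_
    exact (Measurable.aemeasurable (by have := h3 j; fun_prop)).mul ((hG j).sub
      ((Measurable.aemeasurable (by have := h3 j; fun_prop)).mul hu))
  · exact (Measurable.aemeasurable (by fun_prop)).mul hu

theorem aemeasurable_energyDensity {μ : Measure (SpaceTime m)} (s : ℝ)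
    {η : SpaceTime m → ℝ} (hη : Measurable η) {u : SpaceTime m → ℂ}
    {G : Fin (m + 1) → SpaceTime m → ℂ} {h : SpaceTime m → ℂ}
    (hu : AEMeasurable u μ) (hG : ∀ j, AEMeasurable (G j) μ) (hh : AEMeasurable h μ) :
    AEMeasurable (fun z => energyDensity s η z (u z) (fun j => G j z) (h z)) μ := by
  have h1 := aemeasurable_transport s η hu hG
  unfold energyDensity
  refine AEMeasurable.mul (Measurable.aemeasurable (by fun_prop)) ?_
  refine AEMeasurable.add (AEMeasurable.add ?_ ?_) ?_
  · exact (Finset.aemeasurable_fun_sum _ fun j _ => (hG _).norm.pow_const 2).const_mul _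
  · exact (hu.norm.pow_const 2).const_mul _
  · exact ((hh.sub h1).norm.pow_const 2).add (h1.norm.pow_const 2)

theorem tendsto_energyDensity {ι : Type*} {l : Filter ι} (s : ℝ) (η : SpaceTime m → ℝ)
    (z : SpaceTime m) {u : ι → ℂ} {G : ι → Fin (m + 1) → ℂ} {h : ι → ℂ} {u₀ : ℂ}
    {G₀ : Fin (m + 1) → ℂ} {h₀ : ℂ} (hu : Tendsto u l (𝓝 u₀))
    (hG : ∀ j, Tendsto (fun k => G k j) l (𝓝 (G₀ j))) (hh : Tendsto h l (𝓝 h₀)) :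
    Tendsto (fun k => energyDensity s η z (u k) (G k) (h k)) l
      (𝓝 (energyDensity s η z u₀ G₀ h₀)) := by
  have ht : Tendsto (fun k => transport s η z (u k) (G k)) l (𝓝 (transport s η z u₀ G₀)) := by
    unfold transport
    refine Tendsto.add (Tendsto.add (hu.const_mul _) ?_) (hu.const_mul _)
    exact tendsto_finsetSum _ fun j _ => ((hG j).sub (hu.const_mul _)).const_mul _
  unfold energyDensity
  refine Tendsto.const_mul _ (Tendsto.add (Tendsto.add (Tendsto.const_mul _ ?_) ?_) ?_)
  · exact tendsto_finsetSum _ fun j _ => (hG _).norm.pow 2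
  · exact (hu.norm.pow 2).const_mul _
  · exact ((hh.sub ht).norm.pow 2).add (ht.norm.pow 2)

/-- The left side is lower semicontinuous under a.e. convergence by Fatou. Hence no convergence of
norms is asked of u and G, only asymptotic control of the weighted norm of h. -/
theorem CarlemanEstimate.of_tendsto {U : Set (SpaceTime m)} {s C : ℝ} (hC : 0 < C)
    {η : SpaceTime m → ℝ} (hη : Measurable η) {u : ℕ → SpaceTime m → ℂ}
    {G : ℕ → Fin (m + 1) → SpaceTime m → ℂ} {h : ℕ → SpaceTime m → ℂ}
    {u₀ : SpaceTime m → ℂ} {G₀ : Fin (m + 1) → SpaceTime m → ℂ} {h₀ : SpaceTime m → ℂ}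
    (hum : ∀ k, AEMeasurable (u k) (volume.restrict U))
    (hGm : ∀ k j, AEMeasurable (G k j) (volume.restrict U))
    (hhm : ∀ k, AEMeasurable (h k) (volume.restrict U))
    (hu : ∀ᵐ z ∂(volume.restrict U), Tendsto (fun k => u k z) atTop (𝓝 (u₀ z)))
    (hG : ∀ j, ∀ᵐ z ∂(volume.restrict U), Tendsto (fun k => G k j z) atTop (𝓝 (G₀ j z)))
    (hh : ∀ᵐ z ∂(volume.restrict U), Tendsto (fun k => h k z) atTop (𝓝 (h₀ z)))
    (hest : ∀ᶠ k in atTop, CarlemanEstimate U s C η (u k) (G k) (h k))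
    (hrhs : ∀ b : ℝ≥0∞, ∫⁻ z in U, ENNReal.ofReal (Real.exp (-s * η z) ^ 2 * ‖h₀ z‖ ^ 2) < b →
      ∀ᶠ k in atTop, ∫⁻ z in U, ENNReal.ofReal (Real.exp (-s * η z) ^ 2 * ‖h k z‖ ^ 2) ≤ b) :
    CarlemanEstimate U s C η u₀ G₀ h₀ := by
  have hC0 : ENNReal.ofReal C ≠ 0 := by simpa using hC
  rw [CarlemanEstimate, mul_comm, ← ENNReal.div_le_iff hC0 ENNReal.ofReal_ne_top]
  -- It suffices to treat every b strictly above the limiting right-hand integral, which is the form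
  -- of `hrhs`.
  refine le_of_forall_gt_imp_ge_of_dense fun b hb => ?_
  rw [ENNReal.div_le_iff hC0 ENNReal.ofReal_ne_top, mul_comm]
  have hlim : ∀ᵐ z ∂(volume.restrict U),
      ENNReal.ofReal (energyDensity s η z (u₀ z) (fun j => G₀ j z) (h₀ z))
        = liminf (fun k => ENNReal.ofReal (energyDensity s η z (u k z) (fun j => G k j z) (h k z)))
          atTop := by
    filter_upwards [hu, ae_all_iff.2 hG, hh] with z h1 h2 h3
    exact ((ENNReal.continuous_ofReal.tendsto _).comp
      (tendsto_energyDensity s η z h1 h2 h3)).liminf_eq.symm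
  rw [lintegral_congr_ae hlim]
  refine (lintegral_liminf_le' fun k =>
    (aemeasurable_energyDensity s hη (hum k) (hGm k) (hhm k)).ennreal_ofReal).trans ?_
  refine liminf_le_of_frequently_le' (Eventually.frequently ?_)
  filter_upwards [hest, hrhs b hb] with k h1 h2
  exact h1.trans (by gcongr)

/-! ### Mollification -/

section Mollify

variable {E : Type*} [NormedAddCommGroup E] [NormedSpace ℝ E] [FiniteDimensional ℝ E]
  [MeasurableSpace E] [BorelSpace E] {μ : Measure E} [μ.IsAddHaarMeasure]

open ContinuousLinearMap in
/-- The mollification of `g` with the kernel `ρ`. -/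
def mollify (μ : Measure E) (ρ : E → ℝ) (g : E → ℂ) : E → ℂ := convolution ρ g (lsmul ℝ ℝ) μ

theorem mollify_apply (ρ : E → ℝ) (g : E → ℂ) (x : E) :
    mollify μ ρ g x = ∫ y, (ρ (x - y) : ℂ) * g y ∂μ := by
  rw [mollify, convolution_eq_swap]
  simp

theorem contDiff_mollify {ρ : E → ℝ} {g : E → ℂ} (hρ : ContDiff ℝ (⊤ : ℕ∞) ρ)
    (hρc : HasCompactSupport ρ) (hg : LocallyIntegrable g μ) :
    ContDiff ℝ (⊤ : ℕ∞) (mollify μ ρ g) :=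
  hρc.contDiff_convolution_left _ hρ hg

theorem fderiv_mollify {ρ : E → ℝ} {g : E → ℂ} (hρ : ContDiff ℝ (⊤ : ℕ∞) ρ)
    (hρc : HasCompactSupport ρ) (hg : LocallyIntegrable g μ) (x e : E) :
    fderiv ℝ (mollify μ ρ g) x e = mollify μ (fun y => fderiv ℝ ρ y e) g x := by
  have h := (hρc.hasFDerivAt_convolution_left (μ := μ) (ContinuousLinearMap.lsmul ℝ ℝ)
    (hρ.of_le (by simp)) hg x).fderiv
  rw [mollify, h, mollify, convolution_eq_swap, convolution_eq_swap,
    ContinuousLinearMap.integral_apply]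
  · rfl
  · have hc : HasCompactSupport (fderiv ℝ ρ) := hρc.fderiv ℝ
    have := (hc.convolutionExists_left (μ := μ)
      (ContinuousLinearMap.precompL E (ContinuousLinearMap.lsmul ℝ ℝ : ℝ →L[ℝ] ℂ →L[ℝ] ℂ))
      (hρ.continuous_fderiv (by simp)) hg x)
    exact this.integrable_swap

/-- The square of an average is at most the average of the square. -/
theorem enorm_mollify_sq_le {ρ : E → ℝ} (hρ : Continuous ρ) (hρ0 : ∀ x, 0 ≤ ρ x)
    (hρ1 : ∫⁻ x, ENNReal.ofReal (ρ x) ∂μ = 1) {g : E → ℂ} (hg : AEMeasurable g μ) (x : E) :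
    ‖mollify μ ρ g x‖ₑ ^ 2 ≤ ∫⁻ y, ENNReal.ofReal (ρ (x - y)) * ‖g y‖ₑ ^ 2 ∂μ := by
  rw [mollify_apply]
  have hm : Measurable fun y => ENNReal.ofReal (ρ (x - y)) := by fun_prop
  have h1 : ∫⁻ y, ENNReal.ofReal (ρ (x - y)) ∂μ = 1 := by
    rw [lintegral_sub_left_eq_self (fun y => ENNReal.ofReal (ρ y)) x, hρ1]
  have h2 : ‖∫ y, (ρ (x - y) : ℂ) * g y ∂μ‖ₑ ≤ ∫⁻ y, ENNReal.ofReal (ρ (x - y)) * ‖g y‖ₑ ∂μ := by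
    refine (enorm_integral_le_lintegral_enorm _).trans (lintegral_mono fun y => ?_)
    rw [enorm_mul]
    gcongr
    rw [← ofReal_norm, Complex.norm_real, Real.norm_of_nonneg (hρ0 _)]
  -- Jensen's inequality for the probability measure with density ρ(x - ·).
  set ν := μ.withDensity fun y => ENNReal.ofReal (ρ (x - y)) with hν
  have hνp : IsProbabilityMeasure ν := ⟨by rw [hν, withDensity_apply _ MeasurableSet.univ]; simpa using h1⟩
  have hgν : AEMeasurable g ν := hg.mono_ac (withDensity_absolutelyContinuous _ _)
  have h3 := eLpNorm_le_eLpNorm_of_exponent_le (p := 1) (q := 2) (by norm_num)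
    hgν.aestronglyMeasurable
  rw [eLpNorm_one_eq_lintegral_enorm, eLpNorm_eq_lintegral_rpow_enorm_toReal (by norm_num) (by norm_num)] at h3
  have h4 : (∫⁻ y, ‖g y‖ₑ ∂ν) ^ 2 ≤ ∫⁻ y, ‖g y‖ₑ ^ 2 ∂ν := by
    refine (pow_le_pow_left₀ zero_le h3 2).trans (le_of_eq ?_)
    rw [← ENNReal.rpow_natCast, ← ENNReal.rpow_mul]
    norm_num
  rw [lintegral_withDensity_eq_lintegral_mul₀ hm.aemeasurable hg.enorm,
    lintegral_withDensity_eq_lintegral_mul₀ hm.aemeasurable (hg.enorm.pow_const 2)] at h4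
  exact (pow_le_pow_left₀ zero_le h2 2).trans h4

/-- A weighted `L²` norm of a mollification, for a weight that varies by at most `ε` at the scale of
the kernel. -/
theorem lintegral_mollify_sq_le {ρ : E → ℝ} (hρ : Continuous ρ) (hρ0 : ∀ x, 0 ≤ ρ x)
    (hρ1 : ∫⁻ x, ENNReal.ofReal (ρ x) ∂μ = 1) {g : E → ℂ} (hg : AEMeasurable g μ)
    {U : Set E} {W : E → ℝ≥0∞} (hW : Measurable W) {ε : ℝ≥0∞}
    (hWε : ∀ y, g y ≠ 0 → ∀ z ∈ U, ρ (z - y) ≠ 0 → W z ≤ W y + ε) (hU : MeasurableSet U) :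
    ∫⁻ z in U, W z * ‖mollify μ ρ g z‖ₑ ^ 2 ∂μ
      ≤ ∫⁻ y, (W y + ε) * ‖g y‖ₑ ^ 2 ∂μ := by
  -- Tonelli requires joint measurability, hence a measurable representative of g.
  set g' := hg.mk g with hg'
  have hgg : g =ᵐ[μ] g' := hg.ae_eq_mk
  have hg'm : Measurable g' := hg.measurable_mk
  calc ∫⁻ z in U, W z * ‖mollify μ ρ g z‖ₑ ^ 2 ∂μ
      ≤ ∫⁻ z in U, ∫⁻ y, W z * (ENNReal.ofReal (ρ (z - y)) * ‖g' y‖ₑ ^ 2) ∂μ ∂μ := by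
        refine lintegral_mono fun z => ?_
        rw [lintegral_const_mul _ (by fun_prop)]
        gcongr
        refine (enorm_mollify_sq_le hρ hρ0 hρ1 hg z).trans (le_of_eq ?_)
        refine lintegral_congr_ae ?_
        filter_upwards [hgg] with y hy
        rw [hy]
    _ = ∫⁻ y, ∫⁻ z in U, W z * (ENNReal.ofReal (ρ (z - y)) * ‖g' y‖ₑ ^ 2) ∂μ ∂μ := by
        refine lintegral_lintegral_swap (Measurable.aemeasurable ?_)
        change Measurable fun p : E × E => W p.1 * (ENNReal.ofReal (ρ (p.1 - p.2)) * ‖g' p.2‖ₑ ^ 2)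
        fun_prop
    _ ≤ ∫⁻ y, (W y + ε) * ‖g y‖ₑ ^ 2 ∂μ := by
        refine lintegral_mono_ae ?_
        filter_upwards [hgg] with y hy
        rw [← hy]
        by_cases h0 : g y = 0
        · simp [h0]
        have hle : ∀ z ∈ U, W z * (ENNReal.ofReal (ρ (z - y)) * ‖g y‖ₑ ^ 2)
            ≤ ((W y + ε) * ‖g y‖ₑ ^ 2) * ENNReal.ofReal (ρ (z - y)) := by
          intro z hz
          by_cases h1 : ρ (z - y) = 0
          · simp [h1]
          · rw [mul_comm (ENNReal.ofReal _), ← mul_assoc]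
            gcongr
            exact hWε y h0 z hz h1
        refine (setLIntegral_mono' hU hle).trans ((setLIntegral_le_lintegral _ _).trans ?_)
        rw [lintegral_const_mul _ (by fun_prop),
          lintegral_sub_right_eq_self (fun z => ENNReal.ofReal (ρ z)) y, hρ1, mul_one]

end Mollify

end Carleman
end

noncomputable section

namespace Carleman

variable {m : ℕ}

/-! ### The Carleman estimate for compactly supported weak solutions -/

theorem fderiv_comp_const_sub {E F : Type*} [NormedAddCommGroup E] [NormedSpace ℝ E]
    [NormedAddCommGroup F] [NormedSpace ℝ F] {f : E → F} (hf : Differentiable ℝ f) (x y e : E) :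
    fderiv ℝ (fun y => f (x - y)) y e = -fderiv ℝ f (x - y) e := by
  have h := ((hf (x - y)).hasFDerivAt.comp y ((hasFDerivAt_id (𝕜 := ℝ) y).const_sub x)).fderiv
  change fderiv ℝ (f ∘ HSub.hSub x) y e = _
  rw [h]
  simp

/-- Testing a weak equation with y ↦ ρ(x - y) turns it into a pointwise identity for mollifications.
-/
theorem isTest_kernel {ρ : SpaceTime m → ℝ} (hρ : ContDiff ℝ (⊤ : ℕ∞) ρ)
    (hρc : HasCompactSupport ρ) (x : SpaceTime m) :
    IsTest univ fun y => (ρ (x - y) : ℂ) := by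
  refine ⟨Complex.ofRealCLM.contDiff.comp (hρ.comp (contDiff_const.sub contDiff_id)), ?_,
    subset_univ _⟩
  have h1 : HasCompactSupport fun y => ρ (x - y) := hρc.comp_homeomorph (Homeomorph.subLeft x)
  exact h1.comp_left (g := fun t : ℝ => (t : ℂ)) (by simp)

theorem contDiff_real_fderiv_apply {E : Type*} [NormedAddCommGroup E] [NormedSpace ℝ E]
    {f : E → ℝ} (hf : ContDiff ℝ (⊤ : ℕ∞) f) (e : E) :
    ContDiff ℝ (⊤ : ℕ∞) fun z => fderiv ℝ f z e :=
  (hf.fderiv_right (m := (⊤ : ℕ∞)) (by simp)).clm_apply contDiff_const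

theorem fderiv_kernel {ρ : SpaceTime m → ℝ} (hρ : ContDiff ℝ (⊤ : ℕ∞) ρ)
    (x y e : SpaceTime m) :
    fderiv ℝ (fun y => (ρ (x - y) : ℂ)) y e = -((fderiv ℝ ρ (x - y) e : ℝ) : ℂ) := by
  have hd : Differentiable ℝ ρ := hρ.differentiable (by simp)
  rw [fderiv_ofReal_comp_apply (f := fun y => ρ (x - y))
    ((hd.comp (differentiable_id.const_sub x)) y), fderiv_comp_const_sub hd]
  simp

theorem schrodingerTranspose_kernel {ρ : SpaceTime m → ℝ} (hρ : ContDiff ℝ (⊤ : ℕ∞) ρ)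
    (x y : SpaceTime m) :
    schrodingerTranspose (fun y => (ρ (x - y) : ℂ)) y
      = Complex.I * ((fderiv ℝ ρ (x - y) timeDir : ℝ) : ℂ)
        + ∑ j, ((fderiv ℝ (fun z => fderiv ℝ ρ z (stDir j)) (x - y) (stDir j) : ℝ) : ℂ) := by
  rw [schrodingerTranspose, fderiv_kernel hρ]
  congr 1
  · ring
  · refine Finset.sum_congr rfl fun j _ => ?_
    have h1 : (fun y => fderiv ℝ (fun y => (ρ (x - y) : ℂ)) y (stDir j))
        = fun y => -(((fun z => fderiv ℝ ρ z (stDir j)) (x - y) : ℝ) : ℂ) := by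
      ext y; rw [fderiv_kernel hρ]
    rw [h1, fderiv_fun_neg, neg_apply, fderiv_kernel (contDiff_real_fderiv_apply hρ _), neg_neg]

section

variable {u : SpaceTime m → ℂ} {G : Fin (m + 1) → SpaceTime m → ℂ} {h : SpaceTime m → ℂ}

theorem WeakSol.fderiv_mollify (hw : WeakSol univ u G h) (hu : LocallyIntegrable u)
    {ρ : SpaceTime m → ℝ} (hρ : ContDiff ℝ (⊤ : ℕ∞) ρ) (hρc : HasCompactSupport ρ)
    (x : SpaceTime m) (j : Fin (m + 1)) :
    fderiv ℝ (mollify volume ρ u) x (stDir j) = mollify volume ρ (G j) x := by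
  have h1 := hw.grad j _ (isTest_kernel hρ hρc x)
  simp only [Measure.restrict_univ, fderiv_kernel hρ, mul_neg, integral_neg, neg_inj] at h1
  rw [Carleman.fderiv_mollify hρ hρc hu, mollify_apply, mollify_apply]
  simp only [mul_comm _ (u _), mul_comm _ (G j _)]
  exact h1

/-- The operator has constant coefficients and so commutes with convolution. The sign in the
transpose is compensated by the reflection y ↦ x - y of the kernel. -/
theorem WeakSol.schrodingerClassical_mollify (hw : WeakSol univ u G h) (hu : LocallyIntegrable u)
    {ρ : SpaceTime m → ℝ} (hρ : ContDiff ℝ (⊤ : ℕ∞) ρ) (hρc : HasCompactSupport ρ)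
    (x : SpaceTime m) :
    schrodingerClassical (mollify volume ρ u) x = mollify volume ρ h x := by
  have h1 := hw.eqn _ (isTest_kernel hρ hρc x)
  have hd : ∀ e, ContDiff ℝ (⊤ : ℕ∞) fun z => fderiv ℝ ρ z e := contDiff_real_fderiv_apply hρ
  have hdc : ∀ e, HasCompactSupport fun z => fderiv ℝ ρ z e := fun e =>
    hρc.fderiv_apply (𝕜 := ℝ) e
  have hdd : ∀ e, ContDiff ℝ (⊤ : ℕ∞) fun z => fderiv ℝ (fun z => fderiv ℝ ρ z e) z e :=
    fun e => contDiff_real_fderiv_apply (hd e) e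
  have hddc : ∀ e, HasCompactSupport fun z => fderiv ℝ (fun z => fderiv ℝ ρ z e) z e := fun e =>
    (hdc e).fderiv_apply (𝕜 := ℝ) e
  simp only [Measure.restrict_univ, schrodingerTranspose_kernel hρ] at h1
  have hi1 : Integrable fun y => Complex.I * (u y * ((fderiv ℝ ρ (x - y) timeDir : ℝ) : ℂ)) := by
    have := hw.integrable _ (isTest_kernel (hd timeDir) (hdc timeDir) x)
    rw [integrableOn_univ] at this
    exact this.const_mul _
  have hi2 : ∀ j, Integrable fun y => u y *
      ((fderiv ℝ (fun z => fderiv ℝ ρ z (stDir j)) (x - y) (stDir j) : ℝ) : ℂ) := fun j => by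
    have := hw.integrable _ (isTest_kernel (hdd (stDir j)) (hddc (stDir j)) x)
    rwa [integrableOn_univ] at this
  have h2 : ∀ j, (fun y => fderiv ℝ (mollify volume ρ u) y (stDir j))
      = mollify volume (fun z => fderiv ℝ ρ z (stDir j)) u := fun j => by
    ext y; rw [Carleman.fderiv_mollify hρ hρc hu]
  rw [schrodingerClassical, Carleman.fderiv_mollify hρ hρc hu]
  simp only [h2, Carleman.fderiv_mollify (hd _) (hdc _) hu]
  simp only [mollify_apply, mul_comm _ (u _), mul_comm _ (h _)]
  rw [← h1, ← integral_const_mul, ← integral_finsetSum _ fun j _ => hi2 j,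
    ← integral_add hi1 (integrable_finsetSum _ fun j _ => hi2 j)]
  refine integral_congr_ae (ae_of_all _ fun y => ?_)
  simp only [mul_add, Finset.mul_sum]
  ring

theorem support_mollify_subset {K : Set (SpaceTime m)} (hu : ∀ z ∉ K, u z = 0)
    {ρ : SpaceTime m → ℝ} {δ : ℝ} (hρ : ∀ z, ρ z ≠ 0 → ‖z‖ < δ) :
    Function.support (mollify volume ρ u) ⊆ Metric.thickening δ K := by
  intro x hx
  by_contra hx'
  refine hx ?_
  rw [mollify_apply]
  refine (integral_congr_ae (ae_of_all _ fun y => ?_)).trans (integral_zero _ _)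
  by_cases hy : y ∈ K
  · by_cases h0 : ρ (x - y) = 0
    · simp [h0]
    · exact absurd (Metric.mem_thickening_iff.2 ⟨y, hy, by rw [dist_eq_norm]; exact hρ _ h0⟩) hx'
  · simp [hu y hy]

end

/-- A sequence of bump functions with shrinking supports. -/
def bumpSeq (m k : ℕ) : ContDiffBump (0 : SpaceTime m) where
  rIn := 1 / ((k : ℝ) + 1)
  rOut := 2 * (1 / ((k : ℝ) + 1))
  rIn_pos := by positivity
  rIn_lt_rOut := by
    have : (0 : ℝ) < 1 / ((k : ℝ) + 1) := by positivity
    linarith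

theorem tendsto_bumpSeq_rOut (m : ℕ) : Tendsto (fun k => (bumpSeq m k).rOut) atTop (𝓝 0) := by
  simpa [bumpSeq] using (tendsto_one_div_add_atTop_nhds_zero_nat (𝕜 := ℝ)).const_mul 2

theorem ofReal_sq_mul_norm_sq (x : ℝ) (c : ℂ) :
    ENNReal.ofReal (x ^ 2 * ‖c‖ ^ 2) = ENNReal.ofReal (x ^ 2) * ‖c‖ₑ ^ 2 := by
  rw [ENNReal.ofReal_mul (sq_nonneg x), ENNReal.ofReal_pow (norm_nonneg c), ofReal_norm]

/-- The weight is continuous on the open set U only; a closed thickening of K inside U is compact,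
and uniform continuity holds there. -/
theorem exists_weight_variation {E : Type*} [PseudoMetricSpace E] [ProperSpace E] {U K : Set E}
    (hU : IsOpen U) (hK : IsCompact K) (hKU : K ⊆ U) {f : E → ℝ} (hf : ContinuousOn f U)
    (hf0 : ∀ z, 0 ≤ f z) {ε : ℝ≥0∞} (hε : ε ≠ 0) :
    ∃ δ > 0, ∀ y ∈ K, ∀ z, dist z y < δ →
      ENNReal.ofReal (f z) ≤ ENNReal.ofReal (f y) + ε := by
  obtain ⟨δ₀, hδ₀, hsub⟩ := hK.exists_cthickening_subset_open hU hKU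
  have hK' : IsCompact (Metric.cthickening δ₀ K) := hK.cthickening
  have huc := hK'.uniformContinuousOn_of_continuous (hf.mono hsub)
  obtain ⟨ε', hε'0, hε'⟩ : ∃ ε' : ℝ, 0 < ε' ∧ ENNReal.ofReal ε' ≤ ε := by
    by_cases htop : ε = ⊤
    · exact ⟨1, one_pos, by simp [htop]⟩
    · exact ⟨ε.toReal, ENNReal.toReal_pos hε htop, by rw [ENNReal.ofReal_toReal htop]⟩
  obtain ⟨δ₁, hδ₁, h⟩ := Metric.uniformContinuousOn_iff.1 huc ε' hε'0
  refine ⟨min δ₀ δ₁, lt_min hδ₀ hδ₁, fun y hy z hz => ?_⟩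
  have hz' : z ∈ Metric.cthickening δ₀ K := Metric.thickening_subset_cthickening _ _
    (Metric.mem_thickening_iff.2 ⟨y, hy, hz.trans_le (min_le_left _ _)⟩)
  have h1 := h z hz' y (Metric.self_subset_cthickening K hy) (hz.trans_le (min_le_right _ _))
  rw [Real.dist_eq] at h1
  calc ENNReal.ofReal (f z) ≤ ENNReal.ofReal (f y + ε') :=
        ENNReal.ofReal_le_ofReal (by linarith [le_abs_self (f z - f y)])
    _ = ENNReal.ofReal (f y) + ENNReal.ofReal ε' := ENNReal.ofReal_add (hf0 y) hε'0.le
    _ ≤ _ := by gcongr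

theorem isOpen_stCylinder {ω : Set (EuclideanSpace ℝ (Fin m))} (hω : IsOpen ω) (T : ℝ) :
    IsOpen (stCylinder ω T) := by
  have hc : Continuous (transverse : Space m → EuclideanSpace ℝ (Fin m)) := by
    unfold transverse; fun_prop
  exact (hω.preimage hc).prod isOpen_Ioo

/-- Mollifications of u are test functions in Q once the kernel is smaller than the distance from K
to the complement of Q. On the right, Jensen and the small variation of the weight near K bound the
mollified norm by the original one plus a small multiple of ‖h‖². -/
theorem WeakSol.carlemanEstimate {Q K : Set (SpaceTime m)} (hQ : IsOpen Q) (hK : IsCompact K)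
    (hKQ : K ⊆ Q) {s C : ℝ} (hC : 0 < C) {η : SpaceTime m → ℝ} (hη : Measurable η)
    (hηc : ContinuousOn η Q)
    (hest : ∀ u : SpaceTime m → ℂ, IsTest Q u →
      CarlemanEstimate Q s C η u (fun j z => fderiv ℝ u z (stDir j)) (schrodingerClassical u))
    {u : SpaceTime m → ℂ} {G : Fin (m + 1) → SpaceTime m → ℂ} {h : SpaceTime m → ℂ}
    (hw : WeakSol univ u G h) (hu : MemLp u 2) (hG : ∀ j, MemLp (G j) 2) (hh : MemLp h 2)
    (huK : ∀ z ∉ K, u z = 0) (hhK : ∀ z ∉ K, h z = 0) :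
    CarlemanEstimate Q s C η u G h := by
  have hloc : ∀ {g : SpaceTime m → ℂ}, MemLp g 2 → LocallyIntegrable g :=
    fun hg => hg.locallyIntegrable (by norm_num)
  set ρ : ℕ → SpaceTime m → ℝ := fun k => (bumpSeq m k).normed volume with hρ
  have hρs : ∀ k, ContDiff ℝ (⊤ : ℕ∞) (ρ k) := fun k => (bumpSeq m k).contDiff_normed
  have hρc : ∀ k, HasCompactSupport (ρ k) := fun k => (bumpSeq m k).hasCompactSupport_normed
  have hρ0 : ∀ k z, 0 ≤ ρ k z := fun k z => (bumpSeq m k).nonneg_normed z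
  have hρ1 : ∀ k, ∫⁻ z, ENNReal.ofReal (ρ k z) = 1 := fun k => by
    rw [← ofReal_integral_eq_lintegral_ofReal
      ((hρs k).continuous.integrable_of_hasCompactSupport (hρc k)) (ae_of_all _ (hρ0 k)),
      (bumpSeq m k).integral_normed, ENNReal.ofReal_one]
  have hρsupp : ∀ k z, ρ k z ≠ 0 → ‖z‖ < (bumpSeq m k).rOut := fun k z hz => by
    have : z ∈ Function.support ((bumpSeq m k).normed volume) := hz
    rw [(bumpSeq m k).support_normed_eq] at this
    simpa using this
  have hlim : ∀ {g : SpaceTime m → ℂ}, MemLp g 2 →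
      ∀ᵐ z ∂(volume.restrict Q), Tendsto (fun k => mollify volume (ρ k) g z) atTop (𝓝 (g z)) :=
    -- The value 2 is the ratio of the outer to the inner radius in `bumpSeq`; its boundedness
    -- permits Lebesgue differentiation.
    fun hg => ae_restrict_of_ae (ContDiffBump.ae_convolution_tendsto_right_of_locallyIntegrable
      (K := 2) (tendsto_bumpSeq_rOut m) (Eventually.of_forall fun k => le_rfl) (hloc hg))
  have hmeas : ∀ {g : SpaceTime m → ℂ}, MemLp g 2 → ∀ k,
      AEMeasurable (mollify volume (ρ k) g) (volume.restrict Q) := fun hg k =>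
    (contDiff_mollify (hρs k) (hρc k) (hloc hg)).continuous.measurable.aemeasurable
  have hW : Measurable fun z => ENNReal.ofReal (Real.exp (-s * η z) ^ 2) := by fun_prop
  refine CarlemanEstimate.of_tendsto hC hη (u := fun k => mollify volume (ρ k) u)
    (G := fun k j => mollify volume (ρ k) (G j)) (h := fun k => mollify volume (ρ k) h)
    (hmeas hu) (fun k j => hmeas (hG j) k) (hmeas hh) (hlim hu) (fun j => hlim (hG j)) (hlim hh)
    ?_ ?_
  · obtain ⟨δ, hδ, hsub⟩ := hK.exists_cthickening_subset_open hQ hKQ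
    filter_upwards [(tendsto_bumpSeq_rOut m).eventually_lt_const hδ] with k hk
    have hts : tsupport (mollify volume (ρ k) u) ⊆ Metric.cthickening δ K :=
      closure_minimal ((support_mollify_subset huK fun z hz => (hρsupp k z hz).trans hk).trans
        (Metric.thickening_subset_cthickening _ _)) Metric.isClosed_cthickening
    have ht : IsTest Q (mollify volume (ρ k) u) :=
      ⟨contDiff_mollify (hρs k) (hρc k) (hloc hu),
        HasCompactSupport.of_support_subset_isCompact (hK.cthickening (r := δ))
          ((subset_tsupport _).trans hts), hts.trans hsub⟩
    have h1 := hest _ ht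
    have e1 : (fun (j : Fin (m + 1)) z => fderiv ℝ (mollify volume (ρ k) u) z (stDir j))
        = fun j => mollify volume (ρ k) (G j) := by
      ext j z; exact hw.fderiv_mollify (hloc hu) (hρs k) (hρc k) z j
    have e2 : schrodingerClassical (mollify volume (ρ k) u) = mollify volume (ρ k) h := by
      ext z; exact hw.schrodingerClassical_mollify (hloc hu) (hρs k) (hρc k) z
    rwa [e1, e2] at h1
  · intro b hb
    simp only [ofReal_sq_mul_norm_sq] at hb ⊢
    set R := ∫⁻ z in Q, ENNReal.ofReal (Real.exp (-s * η z) ^ 2) * ‖h z‖ₑ ^ 2 with hR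
    set N := ∫⁻ z, ‖h z‖ₑ ^ 2 with hN
    have hNtop : N ≠ ⊤ := by
      have := hh.eLpNorm_lt_top
      rw [eLpNorm_lt_top_iff_lintegral_rpow_enorm_lt_top (by norm_num) (by norm_num)] at this
      simpa using this.ne
    -- The tolerance 1/n in the weight is chosen so that the error ‖h‖²/n fits below b.
    have hex : ∃ n : ℕ, R + (n : ℝ≥0∞)⁻¹ * N < b := by
      have h1 : Tendsto (fun n : ℕ => R + (n : ℝ≥0∞)⁻¹ * N) atTop (𝓝 (R + 0 * N)) :=
        tendsto_const_nhds.add (ENNReal.Tendsto.mul_const ENNReal.tendsto_inv_nat_nhds_zero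
          (Or.inr hNtop))
      rw [zero_mul, add_zero] at h1
      exact (h1.eventually_lt_const hb).exists
    obtain ⟨n, hn⟩ := hex
    obtain ⟨δ, hδ, hvar⟩ := exists_weight_variation hQ hK hKQ
      (f := fun z => Real.exp (-s * η z) ^ 2) (by fun_prop) (fun z => sq_nonneg _)
      (ε := (n : ℝ≥0∞)⁻¹) (by simp)
    filter_upwards [(tendsto_bumpSeq_rOut m).eventually_lt_const hδ] with k hk
    refine (lintegral_mollify_sq_le (hρs k).continuous (hρ0 k) (hρ1 k)
      hh.aestronglyMeasurable.aemeasurable hW (ε := (n : ℝ≥0∞)⁻¹) ?_ hQ.measurableSet).trans ?_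
    · intro y hy z _ hz
      have hyK : y ∈ K := by by_contra h0; exact hy (hhK y h0)
      refine hvar y hyK z ?_
      rw [dist_eq_norm]
      exact (hρsupp k _ hz).trans hk
    · refine le_trans (le_of_eq ?_) hn.le
      simp only [add_mul]
      rw [lintegral_add_right' _ ((hh.aestronglyMeasurable.aemeasurable.enorm.pow_const 2).const_mul _),
        lintegral_const_mul'' _ (hh.aestronglyMeasurable.aemeasurable.enorm.pow_const 2)]
      congr 1
      rw [hR, ← lintegral_indicator hQ.measurableSet]
      refine lintegral_congr fun z => ?_
      by_cases hz : z ∈ Q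
      · rw [indicator_of_mem hz]
      · rw [indicator_of_notMem hz, hhK z fun h0 => hz (hKQ h0)]
        simp

end Carleman
end

noncomputable section

namespace Carleman

variable {m : ℕ}

/-! ### Cutoff functions in time and in the axial direction -/

theorem deriv_smoothTransition_eq_zero {x : ℝ} (hx : x ∉ Icc (0 : ℝ) 1) :
    deriv Real.smoothTransition x = 0 := by
  rw [mem_Icc, not_and_or, not_le, not_le] at hx
  rcases hx with hx | hx
  · have : Real.smoothTransition =ᶠ[𝓝 x] fun _ => 0 := by
      filter_upwards [isOpen_Iio.mem_nhds hx] with y hy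
      exact Real.smoothTransition.zero_of_nonpos (le_of_lt hy)
    rw [this.deriv_eq, deriv_const]
  · have : Real.smoothTransition =ᶠ[𝓝 x] fun _ => 1 := by
      filter_upwards [isOpen_Ioi.mem_nhds hx] with y hy
      exact Real.smoothTransition.one_of_one_le (le_of_lt hy)
    rw [this.deriv_eq, deriv_const]

theorem exists_bound_deriv_smoothTransition :
    ∃ c : ℝ, 0 ≤ c ∧ ∀ x, |deriv Real.smoothTransition x| ≤ c := by
  have hc : Continuous (deriv Real.smoothTransition) :=
    (Real.smoothTransition.contDiff (n := 1)).continuous_deriv le_rfl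
  have hs : HasCompactSupport (deriv Real.smoothTransition) :=
    HasCompactSupport.intro isCompact_Icc fun x hx => deriv_smoothTransition_eq_zero hx
  obtain ⟨c, hc'⟩ := hc.bounded_above_of_compact_support hs
  exact ⟨c, (norm_nonneg _).trans (hc' 0), hc'⟩

/-- A smooth function of time that vanishes where `T² - t² ≤ 1 / (k + 1)`. -/
def timeCutoff (T : ℝ) (k : ℕ) (t : ℝ) : ℝ :=
  Real.smoothTransition (((k : ℝ) + 1) * (T ^ 2 - t ^ 2) - 1)

/-- A smooth function with compact support that equals one near the origin. -/
def axialBump (y : ℝ) : ℝ := Real.smoothTransition (2 - y ^ 2)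

theorem contDiff_timeCutoff (T : ℝ) (k : ℕ) : ContDiff ℝ (⊤ : ℕ∞) (timeCutoff T k) :=
  Real.smoothTransition.contDiff.comp (by fun_prop)

theorem contDiff_axialBump : ContDiff ℝ (⊤ : ℕ∞) axialBump :=
  Real.smoothTransition.contDiff.comp (by fun_prop)

theorem axialBump_eq_zero {y : ℝ} (hy : 2 ≤ |y|) : axialBump y = 0 :=
  Real.smoothTransition.zero_of_nonpos (by
    have := sq_abs y
    nlinarith)

theorem hasCompactSupport_axialBump : HasCompactSupport axialBump :=
  HasCompactSupport.intro (isCompact_Icc (a := (-2 : ℝ)) (b := 2)) fun y hy => by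
    refine axialBump_eq_zero ?_
    by_contra h
    push Not at h
    exact hy ⟨by linarith [(abs_lt.1 h).1], by linarith [(abs_lt.1 h).2]⟩

theorem timeCutoff_eq_zero {T t : ℝ} {k : ℕ} (h : ((k : ℝ) + 1) * (T ^ 2 - t ^ 2) < 1) :
    timeCutoff T k t = 0 :=
  Real.smoothTransition.zero_of_nonpos (by linarith)

/-- The derivative has size k + 1 and lives where 1 ≤ (k + 1)(T² - t²) ≤ 2. Two powers of T² - t²
thus turn growth into decay of order 1/(k + 1). -/
theorem exists_timeCutoff_deriv_bound {T : ℝ} (hT : 0 < T) :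
    ∃ c : ℝ, 0 ≤ c ∧ ∀ k : ℕ, ∀ t ∈ Ioo (-T) T,
      |deriv (timeCutoff T k) t| * (T ^ 2 - t ^ 2) ^ 2 ≤ c / ((k : ℝ) + 1) := by
  obtain ⟨c, hc, hb⟩ := exists_bound_deriv_smoothTransition
  refine ⟨8 * c * T, by positivity, fun k t ht => ?_⟩
  have hk : (0 : ℝ) < (k : ℝ) + 1 := by positivity
  set x := ((k : ℝ) + 1) * (T ^ 2 - t ^ 2) - 1 with hx
  have hd : HasDerivAt (fun t : ℝ => ((k : ℝ) + 1) * (T ^ 2 - t ^ 2) - 1)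
      (((k : ℝ) + 1) * (-(2 * t))) t := by
    have h1 : HasDerivAt (fun t : ℝ => T ^ 2 - t ^ 2) (-(2 * t)) t := by
      simpa using (hasDerivAt_pow 2 t).const_sub (T ^ 2)
    exact (h1.const_mul _).sub_const _
  have hST : DifferentiableAt ℝ Real.smoothTransition x :=
    (Real.smoothTransition.contDiff (n := 1)).differentiable (by simp) x
  have hder : deriv (timeCutoff T k) t
      = deriv Real.smoothTransition x * (((k : ℝ) + 1) * (-(2 * t))) :=
    (hST.hasDerivAt.comp t hd).deriv
  have hpos : 0 < T ^ 2 - t ^ 2 := by nlinarith [ht.1, ht.2]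
  by_cases hmem : x ∈ Icc (0 : ℝ) 1
  · have h1 : T ^ 2 - t ^ 2 ≤ 2 / ((k : ℝ) + 1) := by
      rw [le_div_iff₀ hk]; linarith [hmem.2]
    have h2 : |t| ≤ T := (abs_lt.2 ht).le
    rw [hder, abs_mul, abs_mul, abs_of_pos hk, abs_neg, abs_mul,
      abs_of_pos (show (0 : ℝ) < 2 by norm_num)]
    calc |deriv Real.smoothTransition x| * (((k : ℝ) + 1) * (2 * |t|)) * (T ^ 2 - t ^ 2) ^ 2
        ≤ c * (((k : ℝ) + 1) * (2 * T)) * (2 / ((k : ℝ) + 1)) ^ 2 := by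
          gcongr
          exact hb x
      _ = 8 * c * T / ((k : ℝ) + 1) := by field_simp; ring
  · rw [hder, deriv_smoothTransition_eq_zero hmem]
    simp only [zero_mul, abs_zero]
    positivity

/-- The product of the cutoffs in time and in the axial direction. -/
def cutoff (T : ℝ) (k : ℕ) (z : SpaceTime m) : ℝ :=
  timeCutoff T k z.2 * axialBump (((k : ℝ) + 1)⁻¹ * z.1 (Fin.last m))

theorem contDiff_cutoff (T : ℝ) (k : ℕ) : ContDiff ℝ (⊤ : ℕ∞) (cutoff T k : SpaceTime m → ℝ) :=
  ContDiff.mul ((contDiff_timeCutoff T k).comp contDiff_snd)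
    (contDiff_axialBump.comp (by fun_prop))

theorem abs_cutoff_le_one (T : ℝ) (k : ℕ) (z : SpaceTime m) : |cutoff T k z| ≤ 1 := by
  have h1 := Real.smoothTransition.le_one (((k : ℝ) + 1) * (T ^ 2 - z.2 ^ 2) - 1)
  have h2 := Real.smoothTransition.nonneg (((k : ℝ) + 1) * (T ^ 2 - z.2 ^ 2) - 1)
  have h3 := Real.smoothTransition.le_one (2 - (((k : ℝ) + 1)⁻¹ * z.1 (Fin.last m)) ^ 2)
  have h4 := Real.smoothTransition.nonneg (2 - (((k : ℝ) + 1)⁻¹ * z.1 (Fin.last m)) ^ 2)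
  rw [cutoff, timeCutoff, axialBump, abs_of_nonneg (mul_nonneg h2 h4)]
  exact mul_le_one₀ h1 h4 h3

theorem abs_timeCutoff_le_one (T : ℝ) (k : ℕ) (t : ℝ) : |timeCutoff T k t| ≤ 1 := by
  rw [timeCutoff, abs_of_nonneg (Real.smoothTransition.nonneg _)]
  exact Real.smoothTransition.le_one _

theorem abs_axialBump_le_one (y : ℝ) : |axialBump y| ≤ 1 := by
  rw [axialBump, abs_of_nonneg (Real.smoothTransition.nonneg _)]
  exact Real.smoothTransition.le_one _

theorem hasFDerivAt_axial {g : ℝ → ℝ} (hg : Differentiable ℝ g) (c : ℝ) (z : SpaceTime m) :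
    HasFDerivAt (fun z : SpaceTime m => g (c * z.1 (Fin.last m)))
      ((deriv g (c * z.1 (Fin.last m)) * c) • ((EuclideanSpace.proj (Fin.last m) :
        Space m →L[ℝ] ℝ).comp (ContinuousLinearMap.fst ℝ (Space m) ℝ))) z := by
  have h1 : HasFDerivAt (fun z : SpaceTime m => c * z.1 (Fin.last m))
      (c • ((EuclideanSpace.proj (Fin.last m) :
        Space m →L[ℝ] ℝ).comp (ContinuousLinearMap.fst ℝ (Space m) ℝ))) z :=
    (((EuclideanSpace.proj (Fin.last m) :
        Space m →L[ℝ] ℝ).comp (ContinuousLinearMap.fst ℝ (Space m) ℝ)).hasFDerivAt).const_mul c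
  have h2 := (hg (c * z.1 (Fin.last m))).hasDerivAt.comp_hasFDerivAt z h1
  rw [smul_smul] at h2
  exact h2

theorem fderiv_time_mul_axial {f g : ℝ → ℝ} (hf : Differentiable ℝ f) (hg : Differentiable ℝ g)
    (c : ℝ) (z e : SpaceTime m) :
    fderiv ℝ (fun z : SpaceTime m => f z.2 * g (c * z.1 (Fin.last m))) z e
      = e.2 * deriv f z.2 * g (c * z.1 (Fin.last m))
        + f z.2 * (c * deriv g (c * z.1 (Fin.last m)) * e.1 (Fin.last m)) := by
  have h1 : DifferentiableAt ℝ (fun z : SpaceTime m => f z.2) z :=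
    (hf z.2).comp z differentiableAt_snd
  have h2 := hasFDerivAt_axial hg c z
  rw [fderiv_fun_mul h1 h2.differentiableAt, h2.fderiv]
  simp only [add_apply, smul_apply, smul_eq_mul, fderiv_comp_snd (hf z.2),
    ContinuousLinearMap.comp_apply, ContinuousLinearMap.coe_fst', PiLp.proj_apply]
  ring

section

variable (T : ℝ) (k : ℕ)

theorem fderiv_cutoff (z e : SpaceTime m) :
    fderiv ℝ (cutoff T k) z e
      = e.2 * deriv (timeCutoff T k) z.2 * axialBump (((k : ℝ) + 1)⁻¹ * z.1 (Fin.last m))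
        + timeCutoff T k z.2 * (((k : ℝ) + 1)⁻¹
          * deriv axialBump (((k : ℝ) + 1)⁻¹ * z.1 (Fin.last m)) * e.1 (Fin.last m)) :=
  fderiv_time_mul_axial ((contDiff_timeCutoff T k).differentiable (by simp))
    (contDiff_axialBump.differentiable (by simp)) _ z e

theorem fderiv_cutoff_castSucc (i : Fin m) (z : SpaceTime m) :
    fderiv ℝ (cutoff T k) z (stDir i.castSucc) = 0 := by
  rw [fderiv_cutoff]
  simp [stDir, spaceDir]

theorem fderiv_cutoff_last (z : SpaceTime m) :
    fderiv ℝ (cutoff T k) z (stDir (Fin.last m))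
      = timeCutoff T k z.2 * (((k : ℝ) + 1)⁻¹
          * deriv axialBump (((k : ℝ) + 1)⁻¹ * z.1 (Fin.last m))) := by
  rw [fderiv_cutoff]
  simp [stDir, spaceDir]

theorem fderiv_cutoff_timeDir (z : SpaceTime m) :
    fderiv ℝ (cutoff T k) z timeDir
      = deriv (timeCutoff T k) z.2 * axialBump (((k : ℝ) + 1)⁻¹ * z.1 (Fin.last m)) := by
  rw [fderiv_cutoff]
  simp [timeDir]

theorem fderiv_fderiv_cutoff_last (z : SpaceTime m) :
    fderiv ℝ (fun y => fderiv ℝ (cutoff T k) y (stDir (Fin.last m))) z (stDir (Fin.last m))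
      = timeCutoff T k z.2 * (((k : ℝ) + 1)⁻¹ * (((k : ℝ) + 1)⁻¹
          * deriv (deriv axialBump) (((k : ℝ) + 1)⁻¹ * z.1 (Fin.last m)))) := by
  simp only [fderiv_cutoff_last]
  have h := fderiv_time_mul_axial (m := m) ((contDiff_timeCutoff T k).differentiable (by simp))
    (g := fun y => ((k : ℝ) + 1)⁻¹ * deriv axialBump y)
    (((contDiff_deriv_of_contDiff contDiff_axialBump).differentiable (by simp)).const_mul _)
    (((k : ℝ) + 1)⁻¹) z (stDir (Fin.last m))
  rw [h, deriv_const_mul_field]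
  simp [stDir, spaceDir]

end

theorem exists_axialBump_bounds : ∃ c : ℝ, 0 ≤ c ∧ (∀ y, |deriv axialBump y| ≤ c) ∧
    ∀ y, |deriv (deriv axialBump) y| ≤ c := by
  have h1 := contDiff_deriv_of_contDiff contDiff_axialBump
  have h2 := contDiff_deriv_of_contDiff h1
  obtain ⟨c₁, hc₁⟩ := h1.continuous.bounded_above_of_compact_support hasCompactSupport_axialBump.deriv
  obtain ⟨c₂, hc₂⟩ := h2.continuous.bounded_above_of_compact_support
    hasCompactSupport_axialBump.deriv.deriv
  exact ⟨max c₁ c₂, ((norm_nonneg _).trans (hc₁ 0)).trans (le_max_left _ _),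
    fun y => (hc₁ y).trans (le_max_left _ _), fun y => (hc₂ y).trans (le_max_right _ _)⟩

/-- The derivatives of the cutoffs are of order `1 / (k + 1)`, up to a power of the distance to the
initial and final times. -/
theorem exists_cutoff_bounds {T : ℝ} (hT : 0 < T) :
    ∃ c : ℝ, 0 ≤ c ∧ ∀ (k : ℕ) (z : SpaceTime m),
      |fderiv ℝ (cutoff T k) z (stDir (Fin.last m))| ≤ c / ((k : ℝ) + 1) ∧
      |fderiv ℝ (fun y => fderiv ℝ (cutoff T k) y (stDir (Fin.last m))) z (stDir (Fin.last m))|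
        ≤ c / ((k : ℝ) + 1) ∧
      (z.2 ∈ Ioo (-T) T → |fderiv ℝ (cutoff T k) z timeDir| * (T ^ 2 - z.2 ^ 2) ^ 2
        ≤ c / ((k : ℝ) + 1)) := by
  obtain ⟨c₁, hc₁, h1, h2⟩ := exists_axialBump_bounds
  obtain ⟨c₂, hc₂, h3⟩ := exists_timeCutoff_deriv_bound hT
  refine ⟨c₁ + c₂, by positivity, fun k z => ?_⟩
  have hk : (0 : ℝ) < (k : ℝ) + 1 := by positivity
  have hk1 : ((k : ℝ) + 1)⁻¹ ≤ 1 := inv_le_one_of_one_le₀ (by linarith [(Nat.cast_nonneg k : (0 : ℝ) ≤ k)])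
  have hle : c₁ / ((k : ℝ) + 1) ≤ (c₁ + c₂) / ((k : ℝ) + 1) := by gcongr; linarith
  refine ⟨?_, ?_, fun hz => ?_⟩
  · rw [fderiv_cutoff_last, abs_mul, abs_mul, abs_of_pos (inv_pos.2 hk)]
    refine le_trans ?_ hle
    calc |timeCutoff T k z.2| * (((k : ℝ) + 1)⁻¹
          * |deriv axialBump (((k : ℝ) + 1)⁻¹ * z.1 (Fin.last m))|)
        ≤ 1 * (((k : ℝ) + 1)⁻¹ * c₁) := by
          gcongr
          · exact abs_timeCutoff_le_one T k _
          · exact h1 _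
      _ = c₁ / ((k : ℝ) + 1) := by rw [one_mul, div_eq_inv_mul]
  · rw [fderiv_fderiv_cutoff_last, abs_mul, abs_mul, abs_mul, abs_of_pos (inv_pos.2 hk)]
    refine le_trans ?_ hle
    calc |timeCutoff T k z.2| * (((k : ℝ) + 1)⁻¹ * (((k : ℝ) + 1)⁻¹
          * |deriv (deriv axialBump) (((k : ℝ) + 1)⁻¹ * z.1 (Fin.last m))|))
        ≤ 1 * (((k : ℝ) + 1)⁻¹ * (1 * c₁)) := by
          gcongr
          · exact abs_timeCutoff_le_one T k _
          · exact h2 _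
      _ = c₁ / ((k : ℝ) + 1) := by rw [one_mul, one_mul, div_eq_inv_mul]
  · rw [fderiv_cutoff_timeDir, abs_mul]
    calc |deriv (timeCutoff T k) z.2| * |axialBump (((k : ℝ) + 1)⁻¹ * z.1 (Fin.last m))|
          * (T ^ 2 - z.2 ^ 2) ^ 2
        ≤ |deriv (timeCutoff T k) z.2| * 1 * (T ^ 2 - z.2 ^ 2) ^ 2 := by
          gcongr
          exact abs_axialBump_le_one _
      _ ≤ c₂ / ((k : ℝ) + 1) := by rw [mul_one]; exact h3 k _ hz
      _ ≤ _ := by gcongr; linarith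

theorem tendsto_cutoff {T : ℝ} {z : SpaceTime m} (hz : z.2 ∈ Ioo (-T) T) :
    Tendsto (fun k => cutoff T k z) atTop (𝓝 1) := by
  have hpos : 0 < T ^ 2 - z.2 ^ 2 := by nlinarith [hz.1, hz.2]
  have h1 : Tendsto (fun k : ℕ => timeCutoff T k z.2) atTop (𝓝 1) := by
    refine tendsto_const_nhds.congr' ?_
    obtain ⟨N, hN⟩ := exists_nat_gt (2 / (T ^ 2 - z.2 ^ 2))
    filter_upwards [eventually_ge_atTop N] with k hk
    refine (Real.smoothTransition.one_of_one_le ?_).symm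
    have h2 : 2 / (T ^ 2 - z.2 ^ 2) ≤ (k : ℝ) + 1 := by
      have : (N : ℝ) ≤ k := by exact_mod_cast hk
      linarith
    rw [div_le_iff₀ hpos] at h2
    linarith
  have h2 : Tendsto (fun k : ℕ => axialBump (((k : ℝ) + 1)⁻¹ * z.1 (Fin.last m))) atTop (𝓝 1) := by
    have h3 : Tendsto (fun k : ℕ => ((k : ℝ) + 1)⁻¹ * z.1 (Fin.last m)) atTop (𝓝 0) := by
      simpa [one_div] using
        (tendsto_one_div_add_atTop_nhds_zero_nat (𝕜 := ℝ)).mul_const (z.1 (Fin.last m))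
    have h4 : axialBump 0 = 1 := Real.smoothTransition.one_of_one_le (by norm_num)
    have h5 := (contDiff_axialBump.continuous.tendsto 0).comp h3
    rwa [h4] at h5
  simpa [cutoff] using h1.mul h2

/-! ### Supports of the cutoffs -/

theorem norm_sq_eq_transverse (x : Space m) :
    ‖x‖ ^ 2 = ‖transverse x‖ ^ 2 + x (Fin.last m) ^ 2 := by
  rw [EuclideanSpace.norm_sq_eq, EuclideanSpace.norm_sq_eq, Fin.sum_univ_castSucc]
  simp [transverse]

theorem continuous_transverse : Continuous (transverse : Space m → EuclideanSpace ℝ (Fin m)) := by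
  unfold transverse; fun_prop

/-- The compact set outside of which the cutoffs vanish. -/
def cutoffSet (K : Set (EuclideanSpace ℝ (Fin m))) (T : ℝ) (k : ℕ) : Set (SpaceTime m) :=
  {z | transverse z.1 ∈ K ∧ |z.1 (Fin.last m)| ≤ 2 * ((k : ℝ) + 1) ∧
    1 ≤ ((k : ℝ) + 1) * (T ^ 2 - z.2 ^ 2)}

theorem isCompact_cutoffSet {K : Set (EuclideanSpace ℝ (Fin m))} (hK : IsCompact K) (T : ℝ)
    (k : ℕ) : IsCompact (cutoffSet K T k) := by
  have hk : (0 : ℝ) < (k : ℝ) + 1 := by positivity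
  refine Metric.isCompact_of_isClosed_isBounded ?_ ?_
  · refine IsClosed.inter ?_ (IsClosed.inter ?_ ?_)
    · exact hK.isClosed.preimage (continuous_transverse.comp continuous_fst)
    · exact isClosed_le (f := fun z : SpaceTime m => |z.1 (Fin.last m)|)
        (g := fun _ => 2 * ((k : ℝ) + 1)) (by fun_prop) continuous_const
    · exact isClosed_le (f := fun _ : SpaceTime m => (1 : ℝ))
        (g := fun z => ((k : ℝ) + 1) * (T ^ 2 - z.2 ^ 2)) continuous_const (by fun_prop)
  · obtain ⟨R, hR⟩ := hK.isBounded.exists_norm_le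
    refine isBounded_iff_forall_norm_le.2 ⟨|R| + 2 * ((k : ℝ) + 1) + |T|, ?_⟩
    rintro z ⟨h1, h2, h3⟩
    have h4 : z.2 ^ 2 ≤ T ^ 2 := by
      by_contra h
      push Not at h
      nlinarith
    have h5 : |z.2| ≤ |T| := sq_le_sq.1 h4
    have h6 : ‖z.1‖ ≤ |R| + 2 * ((k : ℝ) + 1) := by
      refine abs_le_of_sq_le_sq' ?_ (by positivity) |>.2
      rw [norm_sq_eq_transverse]
      have h7 : ‖transverse z.1‖ ≤ |R| := (hR _ h1).trans (le_abs_self R)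
      have h8 : ‖transverse z.1‖ ^ 2 ≤ |R| ^ 2 := by gcongr
      have h9 : z.1 (Fin.last m) ^ 2 ≤ (2 * ((k : ℝ) + 1)) ^ 2 := by
        rw [← sq_abs]; gcongr
      nlinarith [abs_nonneg R]
    rw [Prod.norm_def, Real.norm_eq_abs]
    exact max_le (by linarith [abs_nonneg T]) (by linarith [norm_nonneg z.1])

theorem cutoffSet_subset {ω K : Set (EuclideanSpace ℝ (Fin m))} (hKω : K ⊆ ω) {T : ℝ}
    (hT : 0 < T) (k : ℕ) : cutoffSet K T k ⊆ stCylinder ω T := by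
  rintro z ⟨h1, -, h3⟩
  refine ⟨hKω h1, ?_⟩
  have hk : (0 : ℝ) < (k : ℝ) + 1 := by positivity
  have h4 : z.2 ^ 2 < T ^ 2 := by
    by_contra h
    push Not at h
    nlinarith
  exact abs_lt.1 (abs_lt_of_sq_lt_sq h4 hT.le)

theorem cutoff_eq_zero {T : ℝ} {k : ℕ} {z : SpaceTime m}
    (hz : ¬ (|z.1 (Fin.last m)| ≤ 2 * ((k : ℝ) + 1) ∧ 1 ≤ ((k : ℝ) + 1) * (T ^ 2 - z.2 ^ 2))) :
    cutoff T k z = 0 := by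
  have hk : (0 : ℝ) < (k : ℝ) + 1 := by positivity
  rw [not_and_or, not_le, not_le] at hz
  rcases hz with hz | hz
  · rw [cutoff, axialBump_eq_zero, mul_zero]
    rw [abs_mul, abs_of_pos (inv_pos.2 hk), inv_mul_eq_div, le_div_iff₀ hk]
    exact hz.le
  · rw [cutoff, timeCutoff_eq_zero hz, zero_mul]

end Carleman
end

noncomputable section

namespace Carleman

variable {m : ℕ}

/-! ### Localisation in the transverse variable -/

/-- The projection onto the transverse variable as a continuous linear map. -/
def transverseCLM (m : ℕ) : SpaceTime m →L[ℝ] EuclideanSpace ℝ (Fin m) :=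
  LinearMap.toContinuousLinearMap
    { toFun := fun z => transverse z.1
      map_add' := fun x y => by ext i; simp [transverse]
      map_smul' := fun c x => by ext i; simp [transverse] }

theorem transverseCLM_apply (z : SpaceTime m) : transverseCLM m z = transverse z.1 := rfl

theorem transverseCLM_stDir_last : transverseCLM m (stDir (Fin.last m)) = 0 := by
  ext i
  simp [transverseCLM_apply, transverse, stDir, spaceDir, Fin.castSucc_ne_last]

theorem transverseCLM_timeDir : transverseCLM m timeDir = 0 := by
  ext i
  simp [transverseCLM_apply, transverse, timeDir]

/-- A function of the transverse variable as a function on space-time. -/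
def pullTransverse (χ : EuclideanSpace ℝ (Fin m) → ℝ) (z : SpaceTime m) : ℂ :=
  (χ (transverse z.1) : ℂ)

theorem contDiff_pullTransverse {χ : EuclideanSpace ℝ (Fin m) → ℝ} (hχ : ContDiff ℝ (⊤ : ℕ∞) χ) :
    ContDiff ℝ (⊤ : ℕ∞) (pullTransverse χ) :=
  Complex.ofRealCLM.contDiff.comp (hχ.comp (transverseCLM m).contDiff)

theorem fderiv_pullTransverse {χ : EuclideanSpace ℝ (Fin m) → ℝ} (hχ : ContDiff ℝ (⊤ : ℕ∞) χ)
    (e : SpaceTime m) :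
    (fun z => fderiv ℝ (pullTransverse χ) z e)
      = pullTransverse fun y => fderiv ℝ χ y (transverseCLM m e) := by
  ext z
  have hd : DifferentiableAt ℝ χ (transverseCLM m z) := hχ.differentiable (by simp) _
  have h1 : DifferentiableAt ℝ (fun y : SpaceTime m => χ (transverseCLM m y)) z :=
    hd.comp z (transverseCLM m).differentiableAt
  change fderiv ℝ (fun y : SpaceTime m => ((χ (transverseCLM m y) : ℝ) : ℂ)) z e = _
  rw [fderiv_ofReal_comp_apply h1]
  have h2 := (hd.hasFDerivAt.comp z (transverseCLM m).hasFDerivAt).fderiv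
  change ((fderiv ℝ (χ ∘ transverseCLM m) z e : ℝ) : ℂ) = _
  rw [h2]
  rfl

theorem fderiv_pullTransverse_last {χ : EuclideanSpace ℝ (Fin m) → ℝ}
    (hχ : ContDiff ℝ (⊤ : ℕ∞) χ) (z : SpaceTime m) :
    fderiv ℝ (pullTransverse χ) z (stDir (Fin.last m)) = 0 := by
  have h := congrFun (fderiv_pullTransverse hχ (stDir (Fin.last m))) z
  simpa [transverseCLM_stDir_last, pullTransverse] using h

theorem fderiv_pullTransverse_timeDir {χ : EuclideanSpace ℝ (Fin m) → ℝ}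
    (hχ : ContDiff ℝ (⊤ : ℕ∞) χ) (z : SpaceTime m) :
    fderiv ℝ (pullTransverse χ) z timeDir = 0 := by
  have h := congrFun (fderiv_pullTransverse hχ timeDir) z
  simpa [transverseCLM_timeDir, pullTransverse] using h

theorem mulGrad_mul {a b : SpaceTime m → ℂ} (ha : ContDiff ℝ (⊤ : ℕ∞) a)
    (hb : ContDiff ℝ (⊤ : ℕ∞) b) (w : SpaceTime m → ℂ) (G : Fin (m + 1) → SpaceTime m → ℂ)
    (j : Fin (m + 1)) (z : SpaceTime m) :
    mulGrad (fun y => a y * b y) w G j z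
      = b z * mulGrad a w G j z + a z * (fderiv ℝ b z (stDir j) * w z) := by
  simp only [mulGrad]
  rw [fderiv_fun_mul (ha.differentiable (by simp) z) (hb.differentiable (by simp) z)]
  simp only [add_apply, smul_apply, smul_eq_mul]
  ring

/-- When the gradients of a and b have no common direction the cross term ∇a·∇b disappears and the
two commutators separate. The choice h = 0 in the last term isolates the commutator with b. -/
theorem mulRhs_mul {a b : SpaceTime m → ℂ} (ha : ContDiff ℝ (⊤ : ℕ∞) a)
    (hb : ContDiff ℝ (⊤ : ℕ∞) b) (w : SpaceTime m → ℂ) (G : Fin (m + 1) → SpaceTime m → ℂ)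
    (h : SpaceTime m → ℂ) (z : SpaceTime m)
    (hab : ∀ j, fderiv ℝ a z (stDir j) * fderiv ℝ b z (stDir j) = 0) :
    mulRhs (fun y => a y * b y) w G h z
      = b z * mulRhs a w G h z + a z * mulRhs b w G 0 z := by
  have hda := ha.differentiable (by simp)
  have hdb := hb.differentiable (by simp)
  have h1 : ∀ e y, fderiv ℝ (fun y => a y * b y) y e
      = a y * fderiv ℝ b y e + b y * fderiv ℝ a y e := by
    intro e y
    rw [fderiv_fun_mul (hda y) (hdb y)]
    simp only [add_apply, smul_apply, smul_eq_mul]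
  have h2 : ∀ j, fderiv ℝ (fun x => fderiv ℝ (fun y => a y * b y) x (stDir j)) z (stDir j)
      = a z * fderiv ℝ (fun x => fderiv ℝ b x (stDir j)) z (stDir j)
        + b z * fderiv ℝ (fun x => fderiv ℝ a x (stDir j)) z (stDir j) := by
    intro j
    have hda' := (contDiff_fderiv_apply_const ha (stDir j)).differentiable (by simp)
    have hdb' := (contDiff_fderiv_apply_const hb (stDir j)).differentiable (by simp)
    simp only [h1]
    rw [fderiv_fun_add ((hda z).fun_mul (hdb' z)) ((hdb z).fun_mul (hda' z)),
      fderiv_fun_mul (hda z) (hdb' z), fderiv_fun_mul (hdb z) (hda' z)]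
    simp only [add_apply, smul_apply, smul_eq_mul]
    linear_combination 2 * hab j
  simp only [mulRhs, schrodingerClassical, h2]
  simp only [h1, Pi.zero_apply, Finset.sum_add_distrib, add_mul, mul_add, Finset.sum_mul,
    Finset.mul_sum]
  ring_nf

theorem normSqL2_eq_lintegral {F : Type*} [NormedAddCommGroup F] (U : Set (SpaceTime m))
    (g : SpaceTime m → F) : normSqL2 U g = ∫⁻ z in U, ENNReal.ofReal (‖g z‖ ^ 2) := by
  have h1 := eLpNorm_nnreal_pow_eq_lintegral (μ := volume.restrict U) (p := 2) (f := g)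
    (by norm_num)
  have h2 : normSqL2 U g = ∫⁻ z in U, ‖g z‖ₑ ^ (((2 : NNReal) : ℝ)) := by
    rw [← h1, normSqL2]
    simp
  rw [h2]
  refine lintegral_congr fun z => ?_
  rw [ENNReal.ofReal_pow (norm_nonneg _), ofReal_norm]
  simp

theorem norm_expWeight_mul (y : ℝ) (c : ℂ) : ‖(Real.exp y : ℂ) * c‖ ^ 2
    = Real.exp y ^ 2 * ‖c‖ ^ 2 := by
  rw [norm_mul, Complex.norm_real, Real.norm_of_nonneg (Real.exp_pos _).le, mul_pow]

theorem lintegral_eq_normSqL2 (U : Set (SpaceTime m)) (s : ℝ) (η : SpaceTime m → ℝ)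
    (h : SpaceTime m → ℂ) :
    ∫⁻ z in U, ENNReal.ofReal (Real.exp (-s * η z) ^ 2 * ‖h z‖ ^ 2)
      = normSqL2 U fun z => (Real.exp (-s * η z) : ℂ) * h z := by
  simp only [normSqL2_eq_lintegral, norm_expWeight_mul]

theorem IsTest.memLp_mul {U : Set (SpaceTime m)} (hU : MeasurableSet U) {φ g : SpaceTime m → ℂ}
    (hφ : IsTest U φ) (hg : MemLp g 2 (volume.restrict U)) :
    MemLp (fun z => φ z * g z) 2 := by
  have h1 : (fun z => φ z * g z) = U.indicator fun z => φ z * g z := by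
    ext z
    by_cases hz : z ∈ U
    · simp [hz]
    · simp [hz, hφ.eq_zero_of_notMem hz]
  obtain ⟨c, hc⟩ := hφ.contDiff.continuous.bounded_above_of_compact_support hφ.hasCompactSupport
  rw [h1, memLp_indicator_iff_restrict hU]
  refine MemLp.of_le_mul (c := c) hg (hφ.contDiff.continuous.aestronglyMeasurable.mul hg.1)
    (ae_of_all _ fun z => ?_)
  rw [norm_mul]
  gcongr
  exact hc z

section

variable {T : ℝ} (k : ℕ)

theorem contDiff_ofReal_cutoff :
    ContDiff ℝ (⊤ : ℕ∞) fun z : SpaceTime m => (cutoff T k z : ℂ) :=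
  Complex.ofRealCLM.contDiff.comp (contDiff_cutoff T k)

theorem fderiv_ofReal_cutoff (e : SpaceTime m) :
    (fun z => fderiv ℝ (fun y : SpaceTime m => (cutoff T k y : ℂ)) z e)
      = fun z => ((fderiv ℝ (cutoff T k) z e : ℝ) : ℂ) := by
  ext z
  rw [fderiv_ofReal_comp_apply ((contDiff_cutoff T k).differentiable (by simp) z)]

theorem mulRhs_cutoff (w : SpaceTime m → ℂ) (G : Fin (m + 1) → SpaceTime m → ℂ)
    (z : SpaceTime m) :
    mulRhs (fun y => (cutoff T k y : ℂ)) w G 0 z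
      = 2 * ((fderiv ℝ (cutoff T k) z (stDir (Fin.last m)) : ℝ) : ℂ) * G (Fin.last m) z
        + (Complex.I * ((fderiv ℝ (cutoff T k) z timeDir : ℝ) : ℂ)
          + ((fderiv ℝ (fun y => fderiv ℝ (cutoff T k) y (stDir (Fin.last m))) z
            (stDir (Fin.last m)) : ℝ) : ℂ)) * w z := by
  have h1 : ∀ e y, fderiv ℝ (fun y : SpaceTime m => (cutoff T k y : ℂ)) y e
      = ((fderiv ℝ (cutoff T k) y e : ℝ) : ℂ) := fun e y => congrFun (fderiv_ofReal_cutoff k e) y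
  have h2 : ∀ j, fderiv ℝ (fun y : SpaceTime m => ((fderiv ℝ (cutoff T k) y (stDir j) : ℝ) : ℂ)) z
      (stDir j) = ((fderiv ℝ (fun y => fderiv ℝ (cutoff T k) y (stDir j)) z (stDir j) : ℝ) : ℂ) :=
    fun j => fderiv_ofReal_comp_apply
      ((contDiff_real_fderiv_apply (contDiff_cutoff T k) _).differentiable (by simp) z) _
  simp only [mulRhs, schrodingerClassical, h1, h2, Fin.sum_univ_castSucc,
    fderiv_cutoff_castSucc]
  simp
  ring

theorem fderiv_pullTransverse_mul_fderiv_cutoff {χ : EuclideanSpace ℝ (Fin m) → ℝ}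
    (hχ : ContDiff ℝ (⊤ : ℕ∞) χ) (z : SpaceTime m) (j : Fin (m + 1)) :
    fderiv ℝ (pullTransverse χ) z (stDir j)
      * fderiv ℝ (fun y : SpaceTime m => (cutoff T k y : ℂ)) z (stDir j) = 0 := by
  have h := congrFun (fderiv_ofReal_cutoff (T := T) k (stDir j)) z
  rw [h]
  induction j using Fin.lastCases with
  | last => rw [fderiv_pullTransverse_last hχ, zero_mul]
  | cast i => rw [fderiv_cutoff_castSucc]; simp

theorem isTest_pullTransverse_mul_cutoff {χ : EuclideanSpace ℝ (Fin m) → ℝ}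
    (hχ : ContDiff ℝ (⊤ : ℕ∞) χ) (hχc : HasCompactSupport χ) :
    IsTest (cutoffSet (tsupport χ) T k) fun z => pullTransverse χ z * (cutoff T k z : ℂ) := by
  have hK := isCompact_cutoffSet hχc T k
  have hsub : tsupport (fun z => pullTransverse χ z * (cutoff T k z : ℂ))
      ⊆ cutoffSet (tsupport χ) T k := by
    refine closure_minimal (fun z hz => ?_) hK.isClosed
    by_contra hz'
    refine hz ?_
    by_cases h1 : transverse z.1 ∈ tsupport χ
    · have h2 : cutoff T k z = 0 := cutoff_eq_zero fun h2 => hz' ⟨h1, h2⟩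
      simp [h2]
    · simp [pullTransverse, image_eq_zero_of_notMem_tsupport h1]
  exact ⟨(contDiff_pullTransverse hχ).mul (contDiff_ofReal_cutoff k),
    hK.of_isClosed_subset (isClosed_tsupport _) hsub, hsub⟩

end

/-- The Carleman estimate for a weak solution localised to a compact set. -/
theorem WeakSol.carlemanEstimate_pullTransverse_mul_cutoff
    {ω : Set (EuclideanSpace ℝ (Fin m))} (hω : IsOpen ω) {T : ℝ} (hT : 0 < T) {s C : ℝ}
    (hC : 0 < C) {η : SpaceTime m → ℝ} (hη : Measurable η) (hηc : ContinuousOn η (stCylinder ω T))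
    (hest : ∀ u : SpaceTime m → ℂ, IsTest (stCylinder ω T) u →
      CarlemanEstimate (stCylinder ω T) s C η u (fun j z => fderiv ℝ u z (stDir j))
        (schrodingerClassical u))
    {w : SpaceTime m → ℂ} {G : Fin (m + 1) → SpaceTime m → ℂ} {h : SpaceTime m → ℂ}
    (hw : WeakSol (stCylinder ω T) w G h) (hwL : MemLp w 2 (volume.restrict (stCylinder ω T)))
    (hGL : ∀ j, MemLp (G j) 2 (volume.restrict (stCylinder ω T)))
    (hhL : MemLp h 2 (volume.restrict (stCylinder ω T)))
    {χ : EuclideanSpace ℝ (Fin m) → ℝ} (hχ : ContDiff ℝ (⊤ : ℕ∞) χ) (hχc : HasCompactSupport χ)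
    (hχω : tsupport χ ⊆ ω) (k : ℕ) :
    CarlemanEstimate (stCylinder ω T) s C η
      (fun z => pullTransverse χ z * (cutoff T k z : ℂ) * w z)
      (mulGrad (fun z => pullTransverse χ z * (cutoff T k z : ℂ)) w G)
      (mulRhs (fun z => pullTransverse χ z * (cutoff T k z : ℂ)) w G h) := by
  have hQ := isOpen_stCylinder hω T
  have hK := isCompact_cutoffSet hχc T k
  have hKQ := cutoffSet_subset hχω hT k
  have htK := isTest_pullTransverse_mul_cutoff (T := T) k hχ hχc
  have ht := htK.mono hKQ
  set Θ : SpaceTime m → ℂ := fun z => pullTransverse χ z * (cutoff T k z : ℂ)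
  -- The solution is extended by zero to all of space-time, which is possible because Θ is supported
  -- in a compact part of the cylinder.
  have h1 := hw.mul isOpen_univ (subset_univ _) (a := Θ) ht.contDiff.contDiffOn
    (inter_subset_left.trans ht.tsupport_subset)
  refine h1.carlemanEstimate hQ hK hKQ hC hη hηc hest (ht.memLp_mul hQ.measurableSet hwL)
    (fun j => (ht.memLp_mul hQ.measurableSet (hGL j)).add
      ((ht.fderiv_apply _).memLp_mul hQ.measurableSet hwL)) ?_ ?_ ?_
  · have e1 := ht.memLp_mul hQ.measurableSet hhL
    have e2 := memLp_finsetSum (μ := volume) (p := 2) Finset.univ fun j _ =>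
      ((ht.fderiv_apply (stDir j)).memLp_mul hQ.measurableSet (hGL j)).const_mul 2
    have e3 := ((ht.fderiv_apply timeDir).memLp_mul hQ.measurableSet hwL).const_mul Complex.I
    have e4 := memLp_finsetSum (μ := volume) (p := 2) Finset.univ fun j _ =>
      (((ht.fderiv_apply (stDir j)).fderiv_apply (stDir j)).memLp_mul hQ.measurableSet hwL)
    refine ((e1.add e2).add (e3.add e4)).ae_eq (ae_of_all _ fun z => ?_)
    simp only [Pi.add_apply, mulRhs, schrodingerClassical, add_mul, Finset.sum_mul]
    ring
  · intro z hz
    rw [htK.eq_zero_of_notMem hz, zero_mul]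
  · intro z hz
    simp only [mulRhs, schrodingerClassical, htK.eq_zero_of_notMem hz,
      (htK.fderiv_apply _).eq_zero_of_notMem hz,
      ((htK.fderiv_apply _).fderiv_apply _).eq_zero_of_notMem hz]
    simp

/-- From e^x ≥ x²/2. The two powers of q = T² - t² are exactly the price of differentiating the
cutoff in time. -/
theorem exp_neg_le_of_le {c q y s : ℝ} (hc : 0 < c) (hq : 0 < q) (hs : 1 ≤ s)
    (hy : c * q⁻¹ ≤ y) : Real.exp (-s * y) ≤ 2 / c ^ 2 * q ^ 2 := by
  have hy0 : 0 < c * q⁻¹ := by positivity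
  have h1 : c * q⁻¹ ≤ s * y := by nlinarith
  have h2 := Real.quadratic_le_exp_of_nonneg hy0.le
  have h3 : Real.exp (c * q⁻¹) ≤ Real.exp (s * y) := Real.exp_le_exp.2 h1
  have h4 : (c * q⁻¹) ^ 2 / 2 ≤ Real.exp (s * y) := by linarith
  rw [neg_mul, Real.exp_neg]
  calc (Real.exp (s * y))⁻¹ ≤ ((c * q⁻¹) ^ 2 / 2)⁻¹ := inv_anti₀ (by positivity) h4
    _ = 2 / c ^ 2 * q ^ 2 := by field_simp

theorem exp_neg_mul_le_one {s y : ℝ} (hs : 1 ≤ s) (hy : 0 ≤ y) : Real.exp (-s * y) ≤ 1 :=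
  Real.exp_le_one_iff.2 (by nlinarith)

/-- The commutator of `i ∂ₜ + Δ` with the cutoffs tends to zero, with the weight. -/
theorem exists_norm_mulRhs_cutoff_le {ω : Set (EuclideanSpace ℝ (Fin m))}
    {x₀ : EuclideanSpace ℝ (Fin m)} (hωb : Bornology.IsBounded ω) (hne : ω.Nonempty)
    (hx₀ : x₀ ∉ closure ω) {r lam T : ℝ} (hr : 1 < r) (hlam : 0 < lam) (hT : 0 < T) :
    ∃ c : ℝ, 0 ≤ c ∧ ∀ s : ℝ, 1 ≤ s → ∀ (k : ℕ) (w : SpaceTime m → ℂ)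
      (G : Fin (m + 1) → SpaceTime m → ℂ), ∀ z ∈ stCylinder ω T,
      Real.exp (-s * eta ω x₀ r lam T z)
          * ‖mulRhs (fun y => (cutoff T k y : ℂ)) w G 0 z‖
        ≤ c / ((k : ℝ) + 1) * (‖G (Fin.last m) z‖ + ‖w z‖) := by
  obtain ⟨c₁, hc₁, hlow⟩ := eta_lower_bound hωb hne hx₀ hr hlam
  obtain ⟨c₂, hc₂, hb⟩ := exists_cutoff_bounds (m := m) hT
  refine ⟨2 * c₂ + 2 / c₁ ^ 2 * c₂, by positivity, fun s hs k w G z hz => ?_⟩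
  have hq : 0 < T ^ 2 - z.2 ^ 2 := by nlinarith [hz.2.1, hz.2.2]
  have hη := hlow T z hz
  have hη0 : 0 ≤ eta ω x₀ r lam T z := le_trans (by positivity) hη
  have e1 := exp_neg_mul_le_one hs hη0
  have e2 := exp_neg_le_of_le hc₁ hq hs hη
  obtain ⟨b1, b2, b3⟩ := hb k z
  have b3 := b3 hz.2
  rw [mulRhs_cutoff]
  set E := Real.exp (-s * eta ω x₀ r lam T z)
  have hE : 0 < E := Real.exp_pos _
  set Dn := fderiv ℝ (cutoff T k) z (stDir (Fin.last m))
  set Dt := fderiv ℝ (cutoff T k) z timeDir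
  set Dnn := fderiv ℝ (fun y => fderiv ℝ (cutoff T k) y (stDir (Fin.last m))) z
    (stDir (Fin.last m))
  set q := T ^ 2 - z.2 ^ 2
  set κ := (k : ℝ) + 1
  have hκ : 0 < κ := by positivity
  -- For the axial derivatives e^{-sη} ≤ 1 is enough; only the time derivative, in `t3`, consumes
  -- the decay of the weight.
  have t1 : E * |Dn| ≤ c₂ / κ := (mul_le_of_le_one_left (abs_nonneg _) e1).trans b1
  have t2 : E * |Dnn| ≤ c₂ / κ := (mul_le_of_le_one_left (abs_nonneg _) e1).trans b2
  have t3 : E * |Dt| ≤ 2 / c₁ ^ 2 * (c₂ / κ) := by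
    calc E * |Dt| ≤ 2 / c₁ ^ 2 * q ^ 2 * |Dt| := by gcongr
      _ = 2 / c₁ ^ 2 * (|Dt| * q ^ 2) := by ring
      _ ≤ _ := by gcongr
  have n1 : ‖2 * (Dn : ℂ) * G (Fin.last m) z + (Complex.I * (Dt : ℂ) + (Dnn : ℂ)) * w z‖
      ≤ 2 * |Dn| * ‖G (Fin.last m) z‖ + (|Dt| + |Dnn|) * ‖w z‖ := by
    refine (norm_add_le _ _).trans ?_
    rw [norm_mul, norm_mul, norm_mul, Complex.norm_real, Real.norm_eq_abs]
    have n2 : ‖Complex.I * (Dt : ℂ) + (Dnn : ℂ)‖ ≤ |Dt| + |Dnn| := by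
      refine (norm_add_le _ _).trans ?_
      simp
    have : ‖(2 : ℂ)‖ = 2 := by simp
    rw [this]
    gcongr
  have hA := norm_nonneg (G (Fin.last m) z)
  have hB := norm_nonneg (w z)
  have hcd : 0 ≤ c₂ / κ := by positivity
  have hcc : 0 ≤ 2 / c₁ ^ 2 * (c₂ / κ) := by positivity
  calc E * ‖2 * (Dn : ℂ) * G (Fin.last m) z + (Complex.I * (Dt : ℂ) + (Dnn : ℂ)) * w z‖
      ≤ E * (2 * |Dn| * ‖G (Fin.last m) z‖ + (|Dt| + |Dnn|) * ‖w z‖) := by gcongr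
    _ = 2 * (E * |Dn|) * ‖G (Fin.last m) z‖ + (E * |Dt| + E * |Dnn|) * ‖w z‖ := by ring
    _ ≤ 2 * (c₂ / κ) * ‖G (Fin.last m) z‖ + (2 / c₁ ^ 2 * (c₂ / κ) + c₂ / κ) * ‖w z‖ := by gcongr
    _ ≤ (2 * (c₂ / κ) + 2 / c₁ ^ 2 * (c₂ / κ)) * (‖G (Fin.last m) z‖ + ‖w z‖) := by
      nlinarith [mul_nonneg hcd hB, mul_nonneg hcc hA]
    _ = _ := by ring

theorem tendsto_fderiv_cutoff {T : ℝ} (hT : 0 < T) (z : SpaceTime m)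
    (j : Fin (m + 1)) :
    Tendsto (fun k => fderiv ℝ (cutoff T k) z (stDir j)) atTop (𝓝 0) := by
  obtain ⟨c, hc, hb⟩ := exists_cutoff_bounds (m := m) hT
  induction j using Fin.lastCases with
  | cast i => simp [fderiv_cutoff_castSucc]
  | last =>
    refine squeeze_zero_norm (fun k => (hb k z).1) ?_
    simpa [div_eq_mul_inv] using (tendsto_one_div_add_atTop_nhds_zero_nat (𝕜 := ℝ)).const_mul c

theorem tendsto_mulRhs_cutoff {T : ℝ} (hT : 0 < T) {z : SpaceTime m} (hz : z.2 ∈ Ioo (-T) T)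
    (w : SpaceTime m → ℂ) (G : Fin (m + 1) → SpaceTime m → ℂ) :
    Tendsto (fun k => mulRhs (fun y => (cutoff T k y : ℂ)) w G 0 z) atTop (𝓝 0) := by
  obtain ⟨c, hc, hb⟩ := exists_cutoff_bounds (m := m) hT
  have hlim : Tendsto (fun k : ℕ => c / ((k : ℝ) + 1)) atTop (𝓝 0) := by
    simpa [div_eq_mul_inv] using (tendsto_one_div_add_atTop_nhds_zero_nat (𝕜 := ℝ)).const_mul c
  have hq : 0 < (T ^ 2 - z.2 ^ 2) ^ 2 := by
    have : 0 < T ^ 2 - z.2 ^ 2 := by nlinarith [hz.1, hz.2]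
    positivity
  have h1 := tendsto_fderiv_cutoff hT z (Fin.last m)
  have h2 : Tendsto (fun k => fderiv ℝ (fun y => fderiv ℝ (cutoff T k) y (stDir (Fin.last m))) z
      (stDir (Fin.last m))) atTop (𝓝 0) := squeeze_zero_norm (fun k => (hb k z).2.1) hlim
  have h3 : Tendsto (fun k => fderiv ℝ (cutoff T k) z timeDir) atTop (𝓝 0) := by
    refine squeeze_zero_norm (a := fun k : ℕ => c / ((k : ℝ) + 1) / (T ^ 2 - z.2 ^ 2) ^ 2)
      (fun k => ?_) (by simpa using hlim.div_const ((T ^ 2 - z.2 ^ 2) ^ 2))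
    rw [le_div_iff₀ hq]
    exact (hb k z).2.2 hz
  have c1 := (Complex.continuous_ofReal.tendsto 0).comp h1
  have c2 := (Complex.continuous_ofReal.tendsto 0).comp h2
  have c3 := (Complex.continuous_ofReal.tendsto 0).comp h3
  simp only [mulRhs_cutoff]
  have := ((c1.const_mul 2).mul_const (G (Fin.last m) z)).add
    (((c3.const_mul Complex.I).add c2).mul_const (w z))
  simpa using this

/-- The Carleman estimate for a weak solution localised in the transverse variable. -/
theorem WeakSol.carlemanEstimate_pullTransverse
    {ω : Set (EuclideanSpace ℝ (Fin m))} (hω : IsOpen ω) (hωb : Bornology.IsBounded ω)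
    (hne : ω.Nonempty) {x₀ : EuclideanSpace ℝ (Fin m)} (hx₀ : x₀ ∉ closure ω)
    {r lam T : ℝ} (hr : 1 < r) (hlam : 0 < lam) (hT : 0 < T) {s C : ℝ} (hs : 1 ≤ s) (hC : 0 < C)
    (hest : ∀ u : SpaceTime m → ℂ, IsTest (stCylinder ω T) u →
      CarlemanEstimate (stCylinder ω T) s C (eta ω x₀ r lam T) u
        (fun j z => fderiv ℝ u z (stDir j)) (schrodingerClassical u))
    {w : SpaceTime m → ℂ} {G : Fin (m + 1) → SpaceTime m → ℂ} {h : SpaceTime m → ℂ}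
    (hw : WeakSol (stCylinder ω T) w G h) (hwL : MemLp w 2 (volume.restrict (stCylinder ω T)))
    (hGL : ∀ j, MemLp (G j) 2 (volume.restrict (stCylinder ω T)))
    (hhL : MemLp h 2 (volume.restrict (stCylinder ω T)))
    {χ : EuclideanSpace ℝ (Fin m) → ℝ} (hχ : ContDiff ℝ (⊤ : ℕ∞) χ) (hχc : HasCompactSupport χ)
    (hχω : tsupport χ ⊆ ω) :
    CarlemanEstimate (stCylinder ω T) s C (eta ω x₀ r lam T)
      (fun z => pullTransverse χ z * w z) (mulGrad (pullTransverse χ) w G)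
      (mulRhs (pullTransverse χ) w G h) := by
  have hQm := (isOpen_stCylinder hω T).measurableSet
  have hη := measurable_eta ω x₀ r lam T
  have hηc : ContinuousOn (eta ω x₀ r lam T) (stCylinder ω T) := fun z hz =>
    (contDiffAt_eta ω x₀ r lam hz.2).continuousAt.continuousWithinAt
  have hX := contDiff_pullTransverse hχ
  have hκ : ∀ k, ContDiff ℝ (⊤ : ℕ∞) fun z : SpaceTime m => (cutoff T k z : ℂ) :=
    fun k => contDiff_ofReal_cutoff k
  have hΘ := fun k => hX.mul (hκ k)
  have hrhs : ∀ k z, mulRhs (fun z => pullTransverse χ z * (cutoff T k z : ℂ)) w G h z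
      = (cutoff T k z : ℂ) * mulRhs (pullTransverse χ) w G h z
        + pullTransverse χ z * mulRhs (fun y => (cutoff T k y : ℂ)) w G 0 z := fun k z =>
    mulRhs_mul hX (hκ k) w G h z (fderiv_pullTransverse_mul_fderiv_cutoff k hχ z)
  have hwm := hwL.1.aemeasurable
  have hGm := fun j => (hGL j).1.aemeasurable
  have hhm := hhL.1.aemeasurable
  have hdm : ∀ (a : SpaceTime m → ℂ) e, Measurable fun z => fderiv ℝ a z e :=
    fun a e => measurable_fderiv_apply_const ℝ a e
  have hgradm : ∀ (a : SpaceTime m → ℂ), Continuous a → ∀ j,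
      AEMeasurable (mulGrad a w G j) (volume.restrict (stCylinder ω T)) := fun a ha j =>
    (ha.measurable.aemeasurable.mul (hGm j)).add ((hdm a (stDir j)).aemeasurable.mul hwm)
  have hrhsm : ∀ (a g : SpaceTime m → ℂ), Continuous a →
      AEMeasurable g (volume.restrict (stCylinder ω T)) →
      AEMeasurable (mulRhs a w G g) (volume.restrict (stCylinder ω T)) := by
    intro a g ha hg
    refine ((ha.measurable.aemeasurable.mul hg).add
      (Finset.aemeasurable_fun_sum _ fun j _ =>
        ((hdm a (stDir j)).aemeasurable.mul (hGm j)).const_mul 2)).add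
      (AEMeasurable.mul (Measurable.aemeasurable ?_) hwm)
    exact ((hdm a timeDir).const_mul _).add (Finset.measurable_fun_sum _ fun j _ => hdm _ _)
  refine CarlemanEstimate.of_tendsto hC hη
    (u := fun k z => pullTransverse χ z * (cutoff T k z : ℂ) * w z)
    (G := fun k => mulGrad (fun z => pullTransverse χ z * (cutoff T k z : ℂ)) w G)
    (h := fun k => mulRhs (fun z => pullTransverse χ z * (cutoff T k z : ℂ)) w G h)
    (fun k => (hΘ k).continuous.measurable.aemeasurable.mul hwm)
    (fun k j => hgradm _ (hΘ k).continuous j) (fun k => hrhsm _ h (hΘ k).continuous hhm)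
    ?_ ?_ ?_ (Eventually.of_forall fun k => hw.carlemanEstimate_pullTransverse_mul_cutoff hω hT hC
      hη hηc hest hwL hGL hhL hχ hχc hχω k) ?_
  · filter_upwards [ae_restrict_mem hQm] with z hz
    have h1 := (Complex.continuous_ofReal.tendsto 1).comp (tendsto_cutoff hz.2)
    simpa using (h1.const_mul (pullTransverse χ z)).mul_const (w z)
  · intro j
    filter_upwards [ae_restrict_mem hQm] with z hz
    have h1 := (Complex.continuous_ofReal.tendsto 1).comp (tendsto_cutoff hz.2)
    have h2 := (Complex.continuous_ofReal.tendsto 0).comp (tendsto_fderiv_cutoff hT z j)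
    have h3 := (h1.mul_const (mulGrad (pullTransverse χ) w G j z)).add
      ((h2.mul_const (w z)).const_mul (pullTransverse χ z))
    simp only [mulGrad_mul hX (hκ _)]
    have h4 : ∀ k, fderiv ℝ (fun y : SpaceTime m => (cutoff T k y : ℂ)) z (stDir j)
        = ((fderiv ℝ (cutoff T k) z (stDir j) : ℝ) : ℂ) := fun k =>
      congrFun (fderiv_ofReal_cutoff k (stDir j)) z
    simp only [h4]
    simpa using h3
  · filter_upwards [ae_restrict_mem hQm] with z hz
    have h1 := (Complex.continuous_ofReal.tendsto 1).comp (tendsto_cutoff hz.2)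
    have h3 := (h1.mul_const (mulRhs (pullTransverse χ) w G h z)).add
      ((tendsto_mulRhs_cutoff hT hz.2 w G).const_mul (pullTransverse χ z))
    simp only [hrhs]
    simpa using h3
  · intro b hb
    obtain ⟨c, hc, hbound⟩ := exists_norm_mulRhs_cutoff_le hωb hne hx₀ hr hlam hT
    obtain ⟨A, hA⟩ := hχ.continuous.bounded_above_of_compact_support hχc
    have hA0 : 0 ≤ A := (norm_nonneg _).trans (hA 0)
    set μ := volume.restrict (stCylinder ω T)
    set H := mulRhs (pullTransverse χ) w G h with hH
    set W : SpaceTime m → ℂ := fun z => (Real.exp (-s * eta ω x₀ r lam T z) : ℂ) with hW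
    have hWm : Measurable W := by fun_prop
    have hWn : ∀ z, ‖W z‖ = Real.exp (-s * eta ω x₀ r lam T z) := fun z => by
      rw [hW, Complex.norm_real, Real.norm_of_nonneg (Real.exp_pos _).le]
    -- No weight appears in D, since the commutator bound has used it; finiteness comes from w and
    -- the axial derivative being in L².
    set D := eLpNorm (fun z => ‖G (Fin.last m) z‖ + ‖w z‖) 2 μ with hD
    have hDtop : D ≠ ⊤ := ((hGL (Fin.last m)).norm.add hwL.norm).2.ne
    -- Minkowski's inequality: the cutoff has modulus at most 1 in the main term, and the commutator
    -- term is O(1/(k + 1)).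
    have hmono : ∀ k : ℕ, eLpNorm (fun z => W z
        * mulRhs (fun z => pullTransverse χ z * (cutoff T k z : ℂ)) w G h z) 2 μ
        ≤ eLpNorm (fun z => W z * H z) 2 μ + ENNReal.ofReal (A * (c / ((k : ℝ) + 1))) * D := by
      intro k
      have hdec : (fun z => W z
          * mulRhs (fun z => pullTransverse χ z * (cutoff T k z : ℂ)) w G h z)
          = (fun z => W z * ((cutoff T k z : ℂ) * H z)) + fun z => W z * (pullTransverse χ z
            * mulRhs (fun y => (cutoff T k y : ℂ)) w G 0 z) := by
        ext z
        simp only [hrhs, Pi.add_apply]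
        ring
      rw [hdec]
      refine (eLpNorm_add_le ?_ ?_ (by norm_num)).trans (add_le_add ?_ ?_)
      · exact (hWm.aemeasurable.mul ((hκ k).continuous.measurable.aemeasurable.mul
          (hrhsm _ h hX.continuous hhm))).aestronglyMeasurable
      · exact (hWm.aemeasurable.mul (hX.continuous.measurable.aemeasurable.mul
          (hrhsm _ 0 (hκ k).continuous aemeasurable_zero))).aestronglyMeasurable
      · refine eLpNorm_mono fun z => ?_
        rw [norm_mul, norm_mul, norm_mul]
        gcongr
        refine mul_le_of_le_one_left (norm_nonneg _) ?_
        rw [Complex.norm_real]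
        exact abs_cutoff_le_one T k z
      · refine eLpNorm_le_mul_eLpNorm_of_ae_le_mul ?_ 2
        filter_upwards [ae_restrict_mem hQm] with z hz
        have h1 := hbound s hs k w G z hz
        rw [norm_mul, norm_mul, hWn, pullTransverse, Complex.norm_real]
        calc Real.exp (-s * eta ω x₀ r lam T z) * (‖χ (transverse z.1)‖
              * ‖mulRhs (fun y => (cutoff T k y : ℂ)) w G 0 z‖)
            = ‖χ (transverse z.1)‖ * (Real.exp (-s * eta ω x₀ r lam T z)
              * ‖mulRhs (fun y => (cutoff T k y : ℂ)) w G 0 z‖) := by ring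
          _ ≤ A * (c / ((k : ℝ) + 1) * (‖G (Fin.last m) z‖ + ‖w z‖)) := by
              gcongr
              exact hA _
          _ = A * (c / ((k : ℝ) + 1)) * ‖‖G (Fin.last m) z‖ + ‖w z‖‖ := by
              rw [Real.norm_of_nonneg (by positivity), mul_assoc]
    have hlim : Tendsto (fun k : ℕ => (eLpNorm (fun z => W z * H z) 2 μ
        + ENNReal.ofReal (A * (c / ((k : ℝ) + 1))) * D) ^ 2) atTop
        (𝓝 (eLpNorm (fun z => W z * H z) 2 μ ^ 2)) := by
      have h1 : Tendsto (fun k : ℕ => A * (c / ((k : ℝ) + 1))) atTop (𝓝 0) := by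
        simpa [div_eq_mul_inv] using
          ((tendsto_one_div_add_atTop_nhds_zero_nat (𝕜 := ℝ)).const_mul c).const_mul A
      have h2 := ENNReal.Tendsto.mul_const (ENNReal.tendsto_ofReal h1) (Or.inr hDtop)
      have h3 := ENNReal.Tendsto.pow (n := 2) (h2.const_add (eLpNorm (fun z => W z * H z) 2 μ))
      simpa using h3
    rw [lintegral_eq_normSqL2] at hb
    filter_upwards [hlim.eventually (gt_mem_nhds hb)] with k hk
    rw [lintegral_eq_normSqL2]
    refine le_trans ?_ hk.le
    rw [normSqL2]
    gcongr
    exact hmono k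

end Carleman
end

noncomputable section

namespace Carleman

variable {m : ℕ}

/-! ### The estimate away from the lateral boundary -/

/-- A smooth Urysohn function for the closed sets closure ω₃ ∪ ωᶜ and closure (ω \ ω₂). Its
vanishing near ∂ω removes boundary terms, and being locally constant outside closure ω₂ \ closure ω₃
it confines the commutator to Q₃ \ Q₂. -/
theorem exists_transverse_cutoff {ω ω₂ ω₃ : Set (EuclideanSpace ℝ (Fin m))} (hω : IsOpen ω)
    (hωb : Bornology.IsBounded ω) (hfr₃ : frontier ω ⊆ frontier ω₃)
    (hsep : Disjoint (closure ω₃) (closure (ω \ ω₂))) :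
    ∃ χ : EuclideanSpace ℝ (Fin m) → ℝ, ContDiff ℝ (⊤ : ℕ∞) χ ∧ HasCompactSupport χ ∧
      tsupport χ ⊆ ω ∧ (∀ x, |χ x| ≤ 1) ∧ (∀ x ∈ ω \ closure ω₂, χ =ᶠ[𝓝 x] fun _ => 1) ∧
      ∀ x ∈ ω, x ∉ closure ω₂ \ closure ω₃ → ∃ c, χ =ᶠ[𝓝 x] fun _ => c := by
  have hd : Disjoint (closure ω₃ ∪ ωᶜ) (closure (ω \ ω₂)) := by
    refine Disjoint.union_left hsep (disjoint_left.2 fun x hx hx' => ?_)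
    -- A point outside ω that is a limit of points of ω lies on ∂ω ⊆ ∂ω₃, hence in closure ω₃,
    -- contrary to `hsep`.
    have h1 : x ∈ frontier ω := by
      rw [hω.frontier_eq]
      exact ⟨closure_mono sdiff_subset hx', hx⟩
    exact disjoint_left.1 hsep (frontier_subset_closure (hfr₃ h1)) hx'
  obtain ⟨χ, h0, h1, hI⟩ := exists_contMDiffMap_zero_one_nhds_of_isClosed
    (I := modelWithCornersSelf ℝ (EuclideanSpace ℝ (Fin m))) (n := (⊤ : ℕ∞))
    (isClosed_closure.union hω.isClosed_compl) isClosed_closure hd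
  have h0' : ∀ x ∈ closure ω₃ ∪ ωᶜ, (χ : EuclideanSpace ℝ (Fin m) → ℝ) =ᶠ[𝓝 x] fun _ => 0 :=
    fun x hx => eventually_nhdsSet_iff_forall.1 h0 x hx
  have h1' : ∀ x ∈ ω \ closure ω₂, (χ : EuclideanSpace ℝ (Fin m) → ℝ) =ᶠ[𝓝 x] fun _ => 1 :=
    fun x hx => eventually_nhdsSet_iff_forall.1 h1 x
      (subset_closure ⟨hx.1, fun h => hx.2 (subset_closure h)⟩)
  have hts : tsupport χ ⊆ ω := fun x hx => by
    by_contra hxω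
    exact notMem_tsupport_iff_eventuallyEq.2 (h0' x (Or.inr hxω)) hx
  refine ⟨χ, χ.contMDiff.contDiff, ?_, hts, fun x => ?_, h1', fun x hx hx' => ?_⟩
  · exact Metric.isCompact_of_isClosed_isBounded (isClosed_tsupport _) (hωb.subset hts)
  · rw [abs_of_nonneg (hI x).1]
    exact (hI x).2
  · by_cases h3 : x ∈ closure ω₃
    · exact ⟨0, h0' x (Or.inl h3)⟩
    · exact ⟨1, h1' x ⟨hx, fun h2 => hx' ⟨h2, h3⟩⟩⟩

theorem eventuallyEq_pullTransverse {χ : EuclideanSpace ℝ (Fin m) → ℝ} {z : SpaceTime m} {c : ℝ}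
    (h : χ =ᶠ[𝓝 (transverse z.1)] fun _ => c) :
    pullTransverse χ =ᶠ[𝓝 z] fun _ => (c : ℂ) := by
  filter_upwards [((transverseCLM m).continuous.tendsto z).eventually h] with y hy
  exact congrArg _ hy

theorem fderiv_eq_zero_of_eventuallyEq_const {a : SpaceTime m → ℂ} {z : SpaceTime m} {c : ℂ}
    (h : a =ᶠ[𝓝 z] fun _ => c) (e : SpaceTime m) : fderiv ℝ a z e = 0 := by
  rw [h.fderiv_eq]
  simp

theorem fderiv_fderiv_eq_zero_of_eventuallyEq_const {a : SpaceTime m → ℂ} {z : SpaceTime m}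
    {c : ℂ} (h : a =ᶠ[𝓝 z] fun _ => c) (e : SpaceTime m) :
    fderiv ℝ (fun y => fderiv ℝ a y e) z e = 0 := by
  refine fderiv_eq_zero_of_eventuallyEq_const (c := 0) ?_ e
  filter_upwards [h.eventuallyEq_nhds] with y hy
  exact fderiv_eq_zero_of_eventuallyEq_const hy e

theorem schrodingerClassical_eq_zero_of_eventuallyEq_const {a : SpaceTime m → ℂ}
    {z : SpaceTime m} {c : ℂ} (h : a =ᶠ[𝓝 z] fun _ => c) : schrodingerClassical a z = 0 := by
  simp [schrodingerClassical, fderiv_eq_zero_of_eventuallyEq_const h,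
    fderiv_fderiv_eq_zero_of_eventuallyEq_const h]

theorem exists_bound_pullTransverse {χ : EuclideanSpace ℝ (Fin m) → ℝ}
    (hχ : ContDiff ℝ (⊤ : ℕ∞) χ) (hχc : HasCompactSupport χ) :
    ∃ B : ℝ, 0 ≤ B ∧ ∀ z : SpaceTime m, (∀ j, ‖fderiv ℝ (pullTransverse χ) z (stDir j)‖ ≤ B) ∧
      ‖schrodingerClassical (pullTransverse χ) z‖ ≤ B := by
  have key : ∀ ψ : EuclideanSpace ℝ (Fin m) → ℝ, Continuous ψ → HasCompactSupport ψ →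
      ∃ B : ℝ, 0 ≤ B ∧ ∀ z : SpaceTime m, ‖pullTransverse ψ z‖ ≤ B := by
    intro ψ h1 h2
    obtain ⟨B, hB⟩ := h1.bounded_above_of_compact_support h2
    refine ⟨B, (norm_nonneg _).trans (hB 0), fun z => ?_⟩
    rw [pullTransverse, Complex.norm_real]
    exact hB _
  have hD : ∀ j, ContDiff ℝ (⊤ : ℕ∞) fun y => fderiv ℝ χ y (transverseCLM m (stDir j)) :=
    fun j => contDiff_real_fderiv_apply hχ _
  have hDc : ∀ j : Fin (m + 1),
      HasCompactSupport fun y => fderiv ℝ χ y (transverseCLM m (stDir j)) :=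
    fun j => hχc.fderiv_apply (𝕜 := ℝ) _
  choose B₁ hB₁ hB₁' using fun j => key _ (hD j).continuous (hDc j)
  choose B₂ hB₂ hB₂' using fun j => key _ (contDiff_real_fderiv_apply (hD j)
    (transverseCLM m (stDir j))).continuous ((hDc j).fderiv_apply (𝕜 := ℝ) _)
  refine ⟨∑ j, B₁ j + ∑ j, B₂ j, add_nonneg (Finset.sum_nonneg fun j _ => hB₁ j)
    (Finset.sum_nonneg fun j _ => hB₂ j), fun z => ⟨fun j => ?_, ?_⟩⟩
  · rw [congrFun (fderiv_pullTransverse hχ (stDir j)) z]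
    have h1 := Finset.single_le_sum (fun i _ => hB₁ i) (Finset.mem_univ j)
    have h2 := Finset.sum_nonneg fun (j : Fin (m + 1)) (_ : j ∈ Finset.univ) => hB₂ j
    linarith [hB₁' j z]
  · rw [schrodingerClassical, fderiv_pullTransverse_timeDir hχ, mul_zero, zero_add]
    refine (norm_sum_le _ _).trans ?_
    have h1 := Finset.sum_nonneg fun (j : Fin (m + 1)) (_ : j ∈ Finset.univ) => hB₁ j
    have h2 : ∑ j, ‖fderiv ℝ (fun y => fderiv ℝ (pullTransverse χ) y (stDir j)) z (stDir j)‖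
        ≤ ∑ j, B₂ j := by
      refine Finset.sum_le_sum fun j _ => ?_
      rw [fderiv_pullTransverse hχ, congrFun (fderiv_pullTransverse (hD j) (stDir j)) z]
      exact hB₂' j z
    linarith

/-- The error made by localising a solution in the transverse variable. -/
theorem exists_norm_sq_localisation_error_le {ω : Set (EuclideanSpace ℝ (Fin m))} {T : ℝ}
    {χ : EuclideanSpace ℝ (Fin m) → ℝ} (hχ : ContDiff ℝ (⊤ : ℕ∞) χ) (hχc : HasCompactSupport χ)
    (hχ1 : ∀ x, |χ x| ≤ 1) {S : Set (SpaceTime m)}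
    (hS : ∀ z ∈ stCylinder ω T, z ∉ S → ∃ c, χ =ᶠ[𝓝 (transverse z.1)] fun _ => c) :
    ∃ c : ℝ, 0 ≤ c ∧ ∀ (w f : SpaceTime m → ℂ) (G : Fin (m + 1) → SpaceTime m → ℂ),
      ∀ z ∈ stCylinder ω T,
      ‖mulRhs (pullTransverse χ) w G (-f) z‖ ^ 2
        ≤ c * (‖f z‖ ^ 2
          + S.indicator (fun z => ∑ i : Fin m, ‖G i.castSucc z‖ ^ 2 + ‖w z‖ ^ 2) z) := by
  obtain ⟨B, hB, hb⟩ := exists_bound_pullTransverse hχ hχc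
  -- The 3 comes from squaring a sum of three terms; 12B²m is 3(2B)² times the factor m from
  -- Cauchy–Schwarz over the transverse directions.
  refine ⟨3 + 12 * B ^ 2 * m + 3 * B ^ 2, by positivity, fun w f G z hz => ?_⟩
  have hX : ‖pullTransverse χ z‖ ≤ 1 := by
    rw [pullTransverse, Complex.norm_real]; exact hχ1 _
  have n1 : ‖pullTransverse χ z * (-f) z‖ ≤ ‖f z‖ := by
    rw [norm_mul, Pi.neg_apply, norm_neg]
    exact mul_le_of_le_one_left (norm_nonneg _) hX
  by_cases hzS : z ∈ S
  · rw [indicator_of_mem hzS, mulRhs, Fin.sum_univ_castSucc, fderiv_pullTransverse_last hχ]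
    obtain ⟨b1, b2⟩ := hb z
    set g := ∑ i : Fin m, ‖G i.castSucc z‖ with hg
    have n2 : ‖∑ i : Fin m, 2 * (fderiv ℝ (pullTransverse χ) z (stDir i.castSucc)
        * G i.castSucc z)‖ ≤ 2 * B * g := by
      rw [hg, Finset.mul_sum]
      refine (norm_sum_le _ _).trans (Finset.sum_le_sum fun i _ => ?_)
      rw [norm_mul, norm_mul, mul_assoc]
      have : ‖(2 : ℂ)‖ = 2 := by simp
      rw [this]
      gcongr
      exact b1 _
    have n3 : ‖schrodingerClassical (pullTransverse χ) z * w z‖ ≤ B * ‖w z‖ := by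
      rw [norm_mul]
      gcongr
    have hg2 : g ^ 2 ≤ m * ∑ i : Fin m, ‖G i.castSucc z‖ ^ 2 := by
      simpa using sq_sum_le_card_mul_sum_sq (s := (Finset.univ : Finset (Fin m)))
        (f := fun i => ‖G i.castSucc z‖)
    have hg0 : 0 ≤ g := Finset.sum_nonneg fun i _ => norm_nonneg _
    set A := ∑ i : Fin m, ‖G i.castSucc z‖ ^ 2
    have hA : 0 ≤ A := Finset.sum_nonneg fun i _ => by positivity
    have hsum : ‖pullTransverse χ z * (-f) z
        + (∑ i : Fin m, 2 * (fderiv ℝ (pullTransverse χ) z (stDir i.castSucc) * G i.castSucc z)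
          + 2 * (0 * G (Fin.last m) z)) + schrodingerClassical (pullTransverse χ) z * w z‖
        ≤ ‖f z‖ + 2 * B * g + B * ‖w z‖ := by
      rw [zero_mul, mul_zero, add_zero]
      exact (norm_add_le _ _).trans (add_le_add ((norm_add_le _ _).trans (add_le_add n1 n2)) n3)
    calc _ ≤ (‖f z‖ + 2 * B * g + B * ‖w z‖) ^ 2 := by gcongr
      _ ≤ 3 * (‖f z‖ ^ 2 + (2 * B * g) ^ 2 + (B * ‖w z‖) ^ 2) := by
        nlinarith [sq_nonneg (‖f z‖ - 2 * B * g), sq_nonneg (‖f z‖ - B * ‖w z‖),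
          sq_nonneg (2 * B * g - B * ‖w z‖)]
      _ = 3 * ‖f z‖ ^ 2 + 12 * B ^ 2 * g ^ 2 + 3 * B ^ 2 * ‖w z‖ ^ 2 := by ring
      _ ≤ 3 * ‖f z‖ ^ 2 + 12 * B ^ 2 * (m * A) + 3 * B ^ 2 * ‖w z‖ ^ 2 := by gcongr
      _ ≤ _ := by
        have e1 : 0 ≤ 12 * B ^ 2 * m * (‖f z‖ ^ 2 + ‖w z‖ ^ 2) := by positivity
        have e2 : 0 ≤ 3 * B ^ 2 * (‖f z‖ ^ 2 + A) := by positivity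
        have e3 : 0 ≤ 3 * (A + ‖w z‖ ^ 2) := by positivity
        nlinarith
  · obtain ⟨c, hc⟩ := hS z hz hzS
    have hc' := eventuallyEq_pullTransverse hc
    rw [indicator_of_notMem hzS, mulRhs, schrodingerClassical_eq_zero_of_eventuallyEq_const hc']
    simp only [fderiv_eq_zero_of_eventuallyEq_const hc', zero_mul, mul_zero,
      Finset.sum_const_zero, add_zero]
    have e1 : 0 ≤ (12 * B ^ 2 * m + 3 * B ^ 2 + 2) * ‖f z‖ ^ 2 := by positivity
    calc _ ≤ ‖f z‖ ^ 2 := by gcongr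
      _ ≤ _ := by nlinarith

/-- For h = pw - f, this keeps the potential part h + f multiplied by the cutoff, so that it can be
absorbed; the rest is the source and the commutator. -/
theorem mulRhs_sub (a w g f : SpaceTime m → ℂ) (G : Fin (m + 1) → SpaceTime m → ℂ)
    (z : SpaceTime m) :
    mulRhs a w G g z = a z * (g z + f z) + mulRhs a w G (-f) z := by
  simp only [mulRhs, Pi.neg_apply]
  ring

theorem cube_mul_le_energyDensity {s : ℝ} (hs : 0 ≤ s) (η : SpaceTime m → ℝ) (z : SpaceTime m)
    (u : ℂ) (G : Fin (m + 1) → ℂ) (h : ℂ) :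
    s ^ 3 * (Real.exp (-s * η z) ^ 2 * ‖u‖ ^ 2) ≤ energyDensity s η z u G h := by
  have h1 : 0 ≤ s * ∑ i : Fin m, ‖G i.castSucc‖ ^ 2 :=
    mul_nonneg hs (Finset.sum_nonneg fun i _ => by positivity)
  rw [energyDensity, mul_left_comm]
  gcongr
  have h2 := sq_nonneg ‖h - transport s η z u G‖
  have h3 := sq_nonneg ‖transport s η z u G‖
  linarith

/-- Absorption in the extended half line, where I can be cancelled only if it is finite. -/
theorem ennreal_le_two_mul_of_le_add {L I J : ℝ≥0∞} (hI : I ≠ ⊤) (h1 : 2 * I ≤ L)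
    (h2 : L ≤ I + J) : L ≤ 2 * J := by
  by_cases hJ : J = ⊤
  · simp [hJ]
  have h3 : I ≤ J := by
    have h4 : I + I ≤ I + J := by rw [← two_mul]; exact h1.trans h2
    exact (ENNReal.add_le_add_iff_left hI).1 h4
  calc L ≤ I + J := h2
    _ ≤ J + J := by gcongr
    _ = 2 * J := (two_mul J).symm

/-- Carleman estimate away from the lateral boundary, with a lower order term. -/
theorem exists_carleman_localised {ω ω₂ ω₃ : Set (EuclideanSpace ℝ (Fin m))} (hω : IsOpen ω)
    (hωb : Bornology.IsBounded ω) (hne : ω.Nonempty) (hfr₃ : frontier ω ⊆ frontier ω₃)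
    (hsep : Disjoint (closure ω₃) (closure (ω \ ω₂)))
    {x₀ : EuclideanSpace ℝ (Fin m)} (hx₀ : x₀ ∉ closure ω)
    {r lam T M : ℝ} (hr : 1 < r) (hlam : 0 < lam) (hT : 0 < T) :
    ∃ s₀ : ℝ, 1 ≤ s₀ ∧ ∃ C : ℝ, 0 < C ∧ ∀ s : ℝ, s₀ ≤ s →
      ∀ (w : SpaceTime m → ℂ) (G : Fin (m + 1) → SpaceTime m → ℂ) (h f : SpaceTime m → ℂ),
        WeakSol (stCylinder ω T) w G h → MemLp w 2 (volume.restrict (stCylinder ω T)) →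
        (∀ j, MemLp (G j) 2 (volume.restrict (stCylinder ω T))) →
        MemLp h 2 (volume.restrict (stCylinder ω T)) →
        MemLp f 2 (volume.restrict (stCylinder ω T)) →
        (∀ᵐ z ∂(volume.restrict (stCylinder ω T)), ‖h z + f z‖ ≤ M * ‖w z‖) →
        ∫⁻ z in stCylinder (ω \ closure ω₂) T, ENNReal.ofReal
            (energyDensity s (eta ω x₀ r lam T) z (w z) (fun j => G j z) (h z))
          ≤ ENNReal.ofReal C * (
            (∫⁻ z in stCylinder ω T, ENNReal.ofReal
              (Real.exp (-s * eta ω x₀ r lam T z) ^ 2 * ‖f z‖ ^ 2))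
            + ∫⁻ z in stCylinder (ω \ closure ω₃) T \ stCylinder (ω \ closure ω₂) T,
              ENNReal.ofReal (Real.exp (-s * eta ω x₀ r lam T z) ^ 2
                * (∑ i : Fin m, ‖G i.castSucc z‖ ^ 2 + ‖w z‖ ^ 2))) := by
  obtain ⟨s₁, hs₁, C₁, hC₁, hest⟩ := carlemanEstimate_of_isTest hωb hne hx₀ hr hlam hT
  obtain ⟨χ, hχ, hχc, hχω, hχ1, hχ2, hχ3⟩ := exists_transverse_cutoff hω hωb hfr₃ hsep
  set Q := stCylinder ω T with hQ
  set Q₂ := stCylinder (ω \ closure ω₂) T with hQ₂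
  set S := stCylinder (ω \ closure ω₃) T \ Q₂ with hS
  set η := eta ω x₀ r lam T with hη
  have hQo : IsOpen Q := isOpen_stCylinder hω T
  have hQ₂o : IsOpen Q₂ := isOpen_stCylinder (hω.sdiff isClosed_closure) T
  have hSm : MeasurableSet S :=
    MeasurableSet.diff (isOpen_stCylinder (hω.sdiff isClosed_closure) T).measurableSet
      hQ₂o.measurableSet
  have hSQ : S ⊆ Q := fun z hz => ⟨hz.1.1.1, hz.1.2⟩
  have hQ₂Q : Q₂ ⊆ Q := fun z hz => ⟨hz.1.1, hz.2⟩
  obtain ⟨c, hc, herr⟩ := exists_norm_sq_localisation_error_le (ω := ω) (T := T) (S := S) hχ hχc hχ1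
    (fun z hz hzS => hχ3 _ hz.1 fun h => hzS ⟨⟨⟨hz.1, h.2⟩, hz.2⟩, fun h' => h'.1.2 h.1⟩)
  -- The threshold gives 4C₁M² ≤ s³, which lets the left side absorb the potential. The added 1 in
  -- the second constant keeps it positive when c = 0.
  refine ⟨s₁ + 4 * C₁ * M ^ 2, by nlinarith [sq_nonneg M], 4 * C₁ * c + 1, by positivity, ?_⟩
  intro s hs w G h f hw hwL hGL hhL hfL hhf
  have hss : s₁ ≤ s := by nlinarith [sq_nonneg M]
  have hs1 : 1 ≤ s := hs₁.trans hss
  have hsM : 4 * C₁ * M ^ 2 ≤ s ^ 3 := by nlinarith [mul_self_nonneg s]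
  have hC0 : 0 < C₁ := by linarith
  have hηm : Measurable η := measurable_eta ω x₀ r lam T
  have main := hw.carlemanEstimate_pullTransverse hω hωb hne hx₀ hr hlam hT hs1 hC0 (hest s hss)
    hwL hGL hhL hχ hχc hχω
  rw [CarlemanEstimate] at main
  rw [← hη, ← hQ] at main
  set X : SpaceTime m → ℂ := pullTransverse χ with hX
  have hXc : Continuous X := (contDiff_pullTransverse hχ).continuous
  set E : SpaceTime m → ℝ := fun z => Real.exp (-s * η z) ^ 2 with hE
  have hEm : Measurable E := by fun_prop
  have hE0 : ∀ z, 0 ≤ E z := fun z => by positivity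
  have hη0 : ∀ z ∈ Q, 0 ≤ η z := by
    obtain ⟨c₁, hc₁, hlow⟩ := eta_lower_bound hωb hne hx₀ hr hlam
    intro z hz
    have hq : 0 < T ^ 2 - z.2 ^ 2 := by nlinarith [hz.2.1, hz.2.2]
    exact le_trans (by positivity) (hlow T z hz)
  set L := ∫⁻ z in Q, ENNReal.ofReal (energyDensity s η z (X z * w z)
    (fun j => mulGrad X w G j z) (mulRhs X w G h z)) with hL
  set N := ∫⁻ z in Q, ENNReal.ofReal (E z * ‖X z * w z‖ ^ 2) with hN
  set F := ∫⁻ z in Q, ENNReal.ofReal (E z * ‖f z‖ ^ 2) with hF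
  set R := ∫⁻ z in S, ENNReal.ofReal
    (E z * (∑ i : Fin m, ‖G i.castSucc z‖ ^ 2 + ‖w z‖ ^ 2)) with hR
  have hwm : AEMeasurable w (volume.restrict Q) := hwL.1.aemeasurable
  have hfm : AEMeasurable f (volume.restrict Q) := hfL.1.aemeasurable
  -- Finiteness of the absorbed term, from e^{-sη} ≤ 1, |χ| ≤ 1 and w in L².
  have hNtop : N ≠ ⊤ := by
    have h1 : N ≤ ∫⁻ z in Q, ‖w z‖ₑ ^ 2 := by
      refine setLIntegral_mono' hQo.measurableSet fun z hz => ?_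
      rw [← ofReal_norm, ← ENNReal.ofReal_pow (norm_nonneg _)]
      refine ENNReal.ofReal_le_ofReal ?_
      have e1 := exp_neg_mul_le_one hs1 (hη0 z hz)
      have e2 : E z ≤ 1 := pow_le_one₀ (Real.exp_pos _).le e1
      have e3 : ‖X z * w z‖ ≤ ‖w z‖ := by
        rw [norm_mul]
        refine mul_le_of_le_one_left (norm_nonneg _) ?_
        rw [hX, pullTransverse, Complex.norm_real]
        exact hχ1 _
      calc E z * ‖X z * w z‖ ^ 2 ≤ 1 * ‖w z‖ ^ 2 := by gcongr
        _ = _ := one_mul _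
    have h2 : ∫⁻ z in Q, ‖w z‖ₑ ^ 2 < ⊤ := by
      have := lintegral_rpow_enorm_lt_top_of_eLpNorm_lt_top (p := 2) (by simp) (by simp) hwL.2
      simpa using this
    exact (h1.trans_lt h2).ne
  have hNL : ENNReal.ofReal (s ^ 3) * N ≤ L := by
    rw [hN, ← lintegral_const_mul' _ _ ENNReal.ofReal_ne_top]
    refine lintegral_mono fun z => ?_
    rw [← ENNReal.ofReal_mul (by positivity)]
    exact ENNReal.ofReal_le_ofReal (cube_mul_le_energyDensity (by linarith) η z _ _ _)
  have hrhs : ∫⁻ z in Q, ENNReal.ofReal (E z * ‖mulRhs X w G h z‖ ^ 2)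
      ≤ ENNReal.ofReal (2 * M ^ 2) * N + ENNReal.ofReal (2 * c) * (F + R) := by
    have hRi : R = ∫⁻ z in Q, S.indicator (fun z => ENNReal.ofReal
        (E z * (∑ i : Fin m, ‖G i.castSucc z‖ ^ 2 + ‖w z‖ ^ 2))) z := by
      rw [lintegral_indicator hSm, Measure.restrict_restrict hSm, inter_eq_left.2 hSQ]
    rw [hRi, hN, hF, ← lintegral_add_left' (by fun_prop), ← lintegral_const_mul' _ _
      ENNReal.ofReal_ne_top, ← lintegral_const_mul' _ _ ENNReal.ofReal_ne_top,
      ← lintegral_add_left' (by have := hXc.measurable; fun_prop)]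
    refine lintegral_mono_ae ?_
    filter_upwards [hhf, ae_restrict_mem hQo.measurableSet] with z hz hzQ
    have e1 := herr w f G z hzQ
    have e2 : ‖mulRhs X w G h z‖ ^ 2 ≤ 2 * M ^ 2 * ‖X z * w z‖ ^ 2 + 2 * c * (‖f z‖ ^ 2
          + S.indicator (fun z => ∑ i : Fin m, ‖G i.castSucc z‖ ^ 2 + ‖w z‖ ^ 2) z) := by
      rw [mulRhs_sub X w h f G z]
      have e3 : ‖X z * (h z + f z)‖ ≤ M * ‖X z * w z‖ := by
        rw [norm_mul, norm_mul]
        calc ‖X z‖ * ‖h z + f z‖ ≤ ‖X z‖ * (M * ‖w z‖) := by gcongr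
          _ = _ := by ring
      have e4 : ‖X z * (h z + f z)‖ ^ 2 ≤ (M * ‖X z * w z‖) ^ 2 := by gcongr
      have e5 := norm_add_le (X z * (h z + f z)) (mulRhs X w G (-f) z)
      calc ‖X z * (h z + f z) + mulRhs X w G (-f) z‖ ^ 2
          ≤ (‖X z * (h z + f z)‖ + ‖mulRhs X w G (-f) z‖) ^ 2 := by gcongr
        _ ≤ 2 * ‖X z * (h z + f z)‖ ^ 2 + 2 * ‖mulRhs X w G (-f) z‖ ^ 2 := by
          nlinarith [sq_nonneg (‖X z * (h z + f z)‖ - ‖mulRhs X w G (-f) z‖)]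
        _ ≤ _ := by nlinarith
    have hI : S.indicator (fun z => ENNReal.ofReal
        (E z * (∑ i : Fin m, ‖G i.castSucc z‖ ^ 2 + ‖w z‖ ^ 2))) z = ENNReal.ofReal (E z
        * S.indicator (fun z => ∑ i : Fin m, ‖G i.castSucc z‖ ^ 2 + ‖w z‖ ^ 2) z) := by
      by_cases hzS : z ∈ S
      · simp [hzS]
      · simp [hzS]
    have hI0 : 0 ≤ S.indicator (fun z => ∑ i : Fin m, ‖G i.castSucc z‖ ^ 2 + ‖w z‖ ^ 2) z :=
      indicator_nonneg (fun z _ => by positivity) z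
    have hEz := hE0 z
    rw [hI, ← ENNReal.ofReal_add (by positivity) (by positivity),
      ← ENNReal.ofReal_mul (by positivity), ← ENNReal.ofReal_mul (by positivity),
      ← ENNReal.ofReal_add (by positivity) (by positivity)]
    refine ENNReal.ofReal_le_ofReal ?_
    calc E z * ‖mulRhs X w G h z‖ ^ 2 ≤ E z * (2 * M ^ 2 * ‖X z * w z‖ ^ 2 + 2 * c * (‖f z‖ ^ 2
          + S.indicator (fun z => ∑ i : Fin m, ‖G i.castSucc z‖ ^ 2 + ‖w z‖ ^ 2) z)) := by gcongr
      _ = _ := by ring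
  -- L ≤ I + J with I = 2C₁M²N from the potential; since s³N ≤ L, twice I is at most L.
  have hfin : L ≤ 2 * (ENNReal.ofReal (2 * C₁ * c) * (F + R)) := by
    refine ennreal_le_two_mul_of_le_add (I := ENNReal.ofReal (2 * C₁ * M ^ 2) * N)
      (ENNReal.mul_ne_top ENNReal.ofReal_ne_top hNtop) ?_ ?_
    · refine le_trans ?_ hNL
      rw [← mul_assoc]
      gcongr
      rw [show (2 : ℝ≥0∞) = ENNReal.ofReal 2 by simp, ← ENNReal.ofReal_mul (by norm_num)]
      exact ENNReal.ofReal_le_ofReal (by linarith)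
    · refine main.trans ((mul_le_mul_right hrhs _).trans (le_of_eq ?_))
      rw [mul_add, ← mul_assoc, ← mul_assoc, ← ENNReal.ofReal_mul hC0.le,
        ← ENNReal.ofReal_mul hC0.le]
      congr 3 <;> ring
  -- On Q₂ the cutoff is locally 1, so the localised density is the original one.
  calc ∫⁻ z in Q₂, ENNReal.ofReal (energyDensity s η z (w z) (fun j => G j z) (h z))
      = ∫⁻ z in Q₂, ENNReal.ofReal (energyDensity s η z (X z * w z)
        (fun j => mulGrad X w G j z) (mulRhs X w G h z)) := by
        refine setLIntegral_congr_fun hQ₂o.measurableSet fun z hz => ?_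
        have h1 := eventuallyEq_pullTransverse (hχ2 _ hz.1)
        have h2 : X z = 1 := by simpa using h1.self_of_nhds
        simp only [mulGrad, mulRhs, hX, fderiv_eq_zero_of_eventuallyEq_const h1,
          schrodingerClassical_eq_zero_of_eventuallyEq_const h1]
        simp [← hX, h2]
    _ ≤ L := lintegral_mono_set hQ₂Q
    _ ≤ 2 * (ENNReal.ofReal (2 * C₁ * c) * (F + R)) := hfin
    _ ≤ ENNReal.ofReal (4 * C₁ * c + 1) * (F + R) := by
        rw [← mul_assoc]
        gcongr
        rw [show (2 : ℝ≥0∞) = ENNReal.ofReal 2 by simp, ← ENNReal.ofReal_mul (by norm_num)]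
        exact ENNReal.ofReal_le_ofReal (by linarith)

end Carleman
end

noncomputable section

namespace Carleman

variable {m : ℕ}

/-! ### From distributional to weak solutions -/

theorem isTest_slice {Ω : Set (Space m)} {T : ℝ} {φ : SpaceTime m → ℂ}
    (hφ : IsTest (Ω ×ˢ Ioo (-T) T) φ) (t : ℝ) : IsTest Ω fun x => φ (x, t) := by
  have hsub : tsupport (fun x => φ (x, t)) ⊆ {x | (x, t) ∈ tsupport φ} := by
    refine closure_minimal (fun x hx => subset_tsupport φ hx) ?_
    exact (isClosed_tsupport φ).preimage (continuous_id.prodMk continuous_const)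
  refine ⟨hφ.contDiff.comp (contDiff_id.prodMk contDiff_const), ?_, ?_⟩
  · refine (hφ.hasCompactSupport.image continuous_fst).of_isClosed_subset (isClosed_tsupport _) ?_
    exact fun x hx => ⟨(x, t), hsub hx, rfl⟩
  · exact fun x hx => (hφ.tsupport_subset (hsub hx)).1

theorem fderiv_slice {φ : SpaceTime m → ℂ} (hφ : Differentiable ℝ φ) (x : Space m) (t : ℝ)
    (e : Space m) : fderiv ℝ (fun x => φ (x, t)) x e = fderiv ℝ φ (x, t) (e, 0) := by
  have h := ((hφ (x, t)).hasFDerivAt.comp x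
    ((hasFDerivAt_id (𝕜 := ℝ) x).prodMk (hasFDerivAt_const t x))).fderiv
  change fderiv ℝ (φ ∘ fun x => (x, t)) x e = _
  erw [h]
  simp

theorem IsTest.integrableOn_mul {U : Set (SpaceTime m)} {φ g : SpaceTime m → ℂ}
    (hφ : IsTest U φ) (hg : MemLp g 2 (volume.restrict U)) :
    IntegrableOn (fun z => g z * φ z) U :=
  hg.integrable_mul (q := 2)
    (hφ.contDiff.continuous.memLp_of_hasCompactSupport hφ.hasCompactSupport)

theorem restrict_stCylinder (A : Set (EuclideanSpace ℝ (Fin m))) (T : ℝ) :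
    (volume : Measure (SpaceTime m)).restrict (stCylinder A T)
      = (volume.restrict (infCylinder A)).prod (volume.restrict (Ioo (-T) T)) := by
  rw [Measure.prod_restrict, stCylinder, Measure.volume_eq_prod]

theorem MemL2H10.memLp_grad_apply {ω : Set (EuclideanSpace ℝ (Fin m))} {T : ℝ}
    {w : SpaceTime m → ℂ} {G : SpaceTime m → EuclideanSpace ℂ (Fin (m + 1))}
    (hw : MemL2H10 (infCylinder ω) T w G) (j : Fin (m + 1)) :
    MemLp (fun z => G z j) 2 (volume.restrict (stCylinder ω T)) := by
  refine MemLp.of_le hw.memLp_grad ?_ (ae_of_all _ fun z => PiLp.norm_apply_le (G z) j)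
  exact (EuclideanSpace.proj (𝕜 := ℂ) j).continuous.comp_aestronglyMeasurable hw.memLp_grad.1

/-- Fubini: slices in t of a test function are test functions on the cross section cylinder, and the
weak gradient identity holds on almost every slice. -/
theorem MemL2H10.integral_mul_fderiv {ω : Set (EuclideanSpace ℝ (Fin m))} {T : ℝ}
    {w : SpaceTime m → ℂ} {G : SpaceTime m → EuclideanSpace ℂ (Fin (m + 1))}
    (hw : MemL2H10 (infCylinder ω) T w G) {φ : SpaceTime m → ℂ}
    (hφ : IsTest (stCylinder ω T) φ) (j : Fin (m + 1)) :
    ∫ z in stCylinder ω T, w z * fderiv ℝ φ z (stDir j)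
      = -∫ z in stCylinder ω T, G z j * φ z := by
  have h1 := (hφ.fderiv_apply (stDir j)).integrableOn_mul hw.memLp
  have h2 := hφ.integrableOn_mul (hw.memLp_grad_apply j)
  rw [IntegrableOn, restrict_stCylinder] at h1 h2
  rw [restrict_stCylinder, integral_prod_symm _ h1, integral_prod_symm _ h2, ← integral_neg]
  refine integral_congr_ae ?_
  filter_upwards [hw.slice] with t ht
  have h3 := ht.memH1.weak _ (isTest_slice hφ t) j
  simp only [fderiv_slice (hφ.contDiff.differentiable (by simp))] at h3
  exact h3

theorem dlaplacian_ofFun (U : Set (SpaceTime m)) (w φ : SpaceTime m → ℂ) :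
    dlaplacian (ofFun U w) φ
      = ∑ j, ∫ z in U, w z * fderiv ℝ (fun y => fderiv ℝ φ y (stDir j)) z (stDir j) := by
  simp [dlaplacian, dderiv, ofFun]

section

variable {U : Set (SpaceTime m)} {w : SpaceTime m → ℂ} {G : Fin (m + 1) → SpaceTime m → ℂ}
  {h : SpaceTime m → ℂ}

theorem integral_mul_schrodingerTranspose
    (hw : ∀ φ, IsTest U φ → IntegrableOn (fun z => w z * φ z) U) {φ : SpaceTime m → ℂ}
    (hφ : IsTest U φ) :
    ∫ z in U, w z * schrodingerTranspose φ z
      = -Complex.I * (∫ z in U, w z * fderiv ℝ φ z timeDir)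
        + ∑ j, ∫ z in U, w z * fderiv ℝ (fun y => fderiv ℝ φ y (stDir j)) z (stDir j) := by
  have h1 := (hw _ (hφ.fderiv_apply timeDir)).const_mul (-Complex.I)
  have h2 := fun j => hw _ ((hφ.fderiv_apply (stDir j)).fderiv_apply (stDir j))
  have h3 := integrable_finsetSum (μ := volume.restrict U) Finset.univ fun j _ => h2 j
  rw [← integral_const_mul, ← integral_finsetSum _ fun j _ => h2 j, ← integral_add h1 h3]
  refine integral_congr_ae (ae_of_all _ fun z => ?_)
  simp only [schrodingerTranspose, mul_add, Finset.mul_sum]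
  ring

end

/-- Pw = f reads i∂ₜw + Δw = pw - f; the transpose of i∂ₜ + Δ carries the sign of the distributional
time derivative. -/
theorem weakSol_of_eqOnTest {ω : Set (EuclideanSpace ℝ (Fin m))} {T : ℝ}
    {w : SpaceTime m → ℂ} {G : SpaceTime m → EuclideanSpace ℂ (Fin (m + 1))}
    {p : Space m → ℝ} {f : SpaceTime m → ℂ}
    (hw : MemL2H10 (infCylinder ω) T w G)
    (hp : MemLp (fun z => (p z.1 : ℂ) * w z) 2 (volume.restrict (stCylinder ω T)))
    (hf : MemLp f 2 (volume.restrict (stCylinder ω T)))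
    (heq : EqOnTest (stCylinder ω T) (schrodinger (stCylinder ω T) p w) f) :
    WeakSol (stCylinder ω T) w (fun j z => G z j) (fun z => (p z.1 : ℂ) * w z - f z) := by
  refine ⟨fun φ hφ => hφ.integrableOn_mul hw.memLp,
    fun j φ hφ => hφ.integrableOn_mul (hw.memLp_grad_apply j),
    fun φ hφ => hφ.integrableOn_mul (hp.sub hf),
    fun j φ hφ => hw.integral_mul_fderiv hφ j, fun φ hφ => ?_⟩
  have h1 := heq φ hφ
  simp only [schrodinger, Pi.add_apply, Pi.sub_apply, Pi.smul_apply, dlaplacian_ofFun] at h1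
  simp only [dderiv, ofFun, smul_eq_mul] at h1
  rw [integral_mul_schrodingerTranspose (U := stCylinder ω T) (fun φ hφ => hφ.integrableOn_mul hw.memLp) hφ]
  simp only [sub_mul]
  rw [integral_sub (hφ.integrableOn_mul hp) (hφ.integrableOn_mul hf), ← h1]
  ring

theorem memLp_potential_mul {ω : Set (EuclideanSpace ℝ (Fin m))} {T M : ℝ}
    {w : SpaceTime m → ℂ} {p : Space m → ℝ}
    (hpm : AEStronglyMeasurable p (volume.restrict (infCylinder ω)))
    (hp : ∀ᵐ x ∂(volume.restrict (infCylinder ω)), |p x| ≤ M)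
    (hw : MemLp w 2 (volume.restrict (stCylinder ω T))) :
    MemLp (fun z => (p z.1 : ℂ) * w z) 2 (volume.restrict (stCylinder ω T)) ∧
      ∀ᵐ z ∂(volume.restrict (stCylinder ω T)), ‖(p z.1 : ℂ) * w z‖ ≤ M * ‖w z‖ := by
  have h1 : ∀ᵐ z ∂(volume.restrict (stCylinder ω T)), ‖(p z.1 : ℂ) * w z‖ ≤ M * ‖w z‖ := by
    have h2 : ∀ᵐ z ∂(volume.restrict (stCylinder ω T)), |p z.1| ≤ M := by
      rw [restrict_stCylinder]
      exact Measure.quasiMeasurePreserving_fst.ae hp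
    filter_upwards [h2] with z hz
    rw [norm_mul, Complex.norm_real]
    gcongr
    exact hz
  refine ⟨MemLp.of_le_mul (c := M) hw ?_ h1, h1⟩
  refine AEStronglyMeasurable.mul ?_ hw.1
  rw [restrict_stCylinder]
  exact Complex.continuous_ofReal.comp_aestronglyMeasurable hpm.comp_fst

/-! ### The conjugated operators -/

section Conjugated

variable {Q : Set (SpaceTime m)} {η : SpaceTime m → ℝ} {s : ℝ}

theorem contDiffAt_ofReal {a : SpaceTime m → ℝ} {z : SpaceTime m}
    (h : ContDiffAt ℝ (⊤ : ℕ∞) a z) : ContDiffAt ℝ (⊤ : ℕ∞) (fun y => (a y : ℂ)) z :=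
  Complex.ofRealCLM.contDiff.contDiffAt.comp z h

theorem contDiffAt_expWeight {z : SpaceTime m} (h : ContDiffAt ℝ (⊤ : ℕ∞) η z) :
    ContDiffAt ℝ (⊤ : ℕ∞) (fun y => (Real.exp (-s * η y) : ℂ)) z :=
  contDiffAt_ofReal (contDiffAt_const.mul h).exp

theorem fderiv_expWeight {z : SpaceTime m} (h : ContDiffAt ℝ (⊤ : ℕ∞) η z) (e : SpaceTime m) :
    fderiv ℝ (fun y => (Real.exp (-s * η y) : ℂ)) z e
      = ((-s * pderiv e η z * Real.exp (-s * η z) : ℝ) : ℂ) := by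
  have h1 : DifferentiableAt ℝ (fun y => -s * η y) z :=
    (h.differentiableAt (by simp)).const_mul _
  rw [fderiv_ofReal_comp_apply h1.exp, fderiv_exp h1, smul_apply,
    pderiv_const_mul _ (h.differentiableAt (by simp)), smul_eq_mul]
  congr 1
  ring

theorem fderiv_fderiv_expWeight {z : SpaceTime m} (hQ : IsOpen Q)
    (h : ∀ z ∈ Q, ContDiffAt ℝ (⊤ : ℕ∞) η z) (hz : z ∈ Q) (e : SpaceTime m) :
    fderiv ℝ (fun x => fderiv ℝ (fun y => (Real.exp (-s * η y) : ℂ)) x e) z e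
      = (((s ^ 2 * pderiv e η z ^ 2 - s * pderiv e (pderiv e η) z)
        * Real.exp (-s * η z) : ℝ) : ℂ) := by
  have h0 : (fun x => fderiv ℝ (fun y => (Real.exp (-s * η y) : ℂ)) x e) =ᶠ[𝓝 z]
      fun x => ((-s * pderiv e η x * Real.exp (-s * η x) : ℝ) : ℂ) := by
    filter_upwards [hQ.mem_nhds hz] with x hx using fderiv_expWeight (h x hx) e
  have hd := (h z hz).differentiableAt (n := ((⊤ : ℕ∞) : WithTop ℕ∞)) (by simp)
  have h1 : DifferentiableAt ℝ (fun y => -s * η y) z := hd.const_mul _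
  have h2 : DifferentiableAt ℝ (pderiv e η) z :=
    (contDiffAt_pderiv (h z hz) e).differentiableAt (by simp)
  rw [h0.fderiv_eq, fderiv_ofReal_comp_apply ((h2.const_mul _).fun_mul h1.exp),
    fderiv_fun_mul (h2.const_mul _) h1.exp, fderiv_exp h1, add_apply, smul_apply, smul_apply,
    smul_apply, pderiv_const_mul _ hd, pderiv_const_mul _ h2]
  simp only [smul_eq_mul]
  congr 1
  ring

theorem mulGrad_expWeight (w : SpaceTime m → ℂ) (G : Fin (m + 1) → SpaceTime m → ℂ)
    {z : SpaceTime m} (h : ContDiffAt ℝ (⊤ : ℕ∞) η z) (j : Fin (m + 1)) :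
    mulGrad (fun y => (Real.exp (-s * η y) : ℂ)) w G j z
      = (Real.exp (-s * η z) : ℂ) * (G j z - ((s * pderiv (stDir j) η z : ℝ) : ℂ) * w z) := by
  rw [mulGrad, fderiv_expWeight h]
  push_cast
  ring

/-- The left side is M₁(e^{-sη}w) computed by the product rule. Since (M₁ + M₂)(e^{-sη}w) =
e^{-sη}(i∂ₜ + Δ)w, it is e^{-sη} times the equation's right-hand side minus `transport`, and no time
derivative of w is left. -/
theorem mulRhs_expWeight (w : SpaceTime m → ℂ) (G : Fin (m + 1) → SpaceTime m → ℂ)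
    (g : SpaceTime m → ℂ) {z : SpaceTime m} (hQ : IsOpen Q)
    (h : ∀ z ∈ Q, ContDiffAt ℝ (⊤ : ℕ∞) η z) (hz : z ∈ Q) :
    mulRhs (fun y => (Real.exp (-s * η y) : ℂ)) w G g z
        + ((s ^ 2 * ∑ j, pderiv (stDir j) η z ^ 2 : ℝ) : ℂ)
          * ((Real.exp (-s * η z) : ℂ) * w z)
      = (Real.exp (-s * η z) : ℂ) * (g z - transport s η z (w z) (fun j => G j z)) := by
  simp only [mulRhs, schrodingerClassical, transport, fderiv_expWeight (h z hz),
    fderiv_fderiv_expWeight hQ h hz]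
  have e1 : ∑ j, (2 : ℂ) * (((-s * pderiv (stDir j) η z * Real.exp (-s * η z) : ℝ) : ℂ) * G j z)
      = -2 * s * (Real.exp (-s * η z) : ℂ) * ∑ j, (pderiv (stDir j) η z : ℂ) * G j z := by
    rw [Finset.mul_sum]
    exact Finset.sum_congr rfl fun j _ => by push_cast; ring
  have e2 : ∑ j : Fin (m + 1), (((s ^ 2 * pderiv (stDir j) η z ^ 2
      - s * pderiv (stDir j) (pderiv (stDir j) η) z) * Real.exp (-s * η z) : ℝ) : ℂ)
      = (s ^ 2 * ((∑ j : Fin (m + 1), pderiv (stDir j) η z ^ 2 : ℝ) : ℂ)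
        - s * ((∑ j : Fin (m + 1), pderiv (stDir j) (pderiv (stDir j) η) z : ℝ) : ℂ))
        * (Real.exp (-s * η z) : ℂ) := by
    rw [← Complex.ofReal_sum, ← Finset.sum_mul, Finset.sum_sub_distrib, ← Finset.mul_sum,
      ← Finset.mul_sum]
    push_cast
    ring
  have e3 : ∑ j, ((2 * s * pderiv (stDir j) η z : ℝ) : ℂ)
      * (G j z - ((s * pderiv (stDir j) η z : ℝ) : ℂ) * w z)
      = 2 * s * (∑ j, (pderiv (stDir j) η z : ℂ) * G j z)
        - 2 * s ^ 2 * ((∑ j : Fin (m + 1), pderiv (stDir j) η z ^ 2 : ℝ) : ℂ) * w z := by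
    push_cast
    rw [Finset.mul_sum, Finset.mul_sum, Finset.sum_mul, ← Finset.sum_sub_distrib]
    exact Finset.sum_congr rfl fun j _ => by ring
  rw [e1, e2, e3, Complex.ofReal_mul, Complex.ofReal_mul, Complex.ofReal_mul, Complex.ofReal_mul,
    Complex.ofReal_mul, Complex.ofReal_neg, Complex.ofReal_pow]
  ring

/-- The weak Leibniz rule with the factor e^{-sη}, smooth inside Q, makes e^{-sη}w a weak solution
on Q; test functions on U are used as test functions on Q. -/
theorem eqOnTest_opM₁ {U : Set (SpaceTime m)} (hQ : IsOpen Q) (hUQ : U ⊆ Q)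
    (hη : ∀ z ∈ Q, ContDiffAt ℝ (⊤ : ℕ∞) η z) {w : SpaceTime m → ℂ}
    {G : Fin (m + 1) → SpaceTime m → ℂ} {h : SpaceTime m → ℂ} (hw : WeakSol Q w G h) :
    EqOnTest U (opM₁ s η (ofFun Q fun z => (Real.exp (-s * η z) : ℂ) * w z))
      fun z => (Real.exp (-s * η z) : ℂ) * (h z - transport s η z (w z) (fun j => G j z)) := by
  intro φ hφ
  have hφQ := hφ.mono hUQ
  have hv := hw.mul hQ subset_rfl
    (fun z hz => (contDiffAt_expWeight (s := s) (hη z hz)).contDiffWithinAt) inter_subset_right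
  have hc : ContDiffOn ℝ (⊤ : ℕ∞) (fun z => ((s ^ 2 * ∑ j, pderiv (stDir j) η z ^ 2 : ℝ) : ℂ)) Q :=
    fun z hz => (contDiffAt_ofReal (contDiffAt_const.mul (ContDiffAt.sum fun j _ =>
      (contDiffAt_pderiv (hη z hz) _).pow 2))).contDiffWithinAt
  have hcφ := hφQ.mul hQ hc inter_subset_right
  have h1 := hv.eqn φ hφQ
  rw [integral_mul_schrodingerTranspose hv.integrable hφQ] at h1
  simp only [opM₁, Pi.add_apply, Pi.smul_apply, dlaplacian_ofFun]
  simp only [dderiv, dmul, ofFun, smul_eq_mul]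
  rw [mul_neg, ← neg_mul, h1, ← integral_add (hv.integrable_rhs φ hφQ) (hv.integrable _ hcφ),
    ← hφ.setIntegral_eq hQ.measurableSet hUQ]
  refine setIntegral_congr_fun hQ.measurableSet fun z hz => ?_
  simp only [← mulRhs_expWeight w G h hQ hη hz]
  ring

theorem eqOnTest_opM₂ {U : Set (SpaceTime m)} (hQ : IsOpen Q) (hUQ : U ⊆ Q)
    (hη : ∀ z ∈ Q, ContDiffAt ℝ (⊤ : ℕ∞) η z) {w : SpaceTime m → ℂ}
    {G : Fin (m + 1) → SpaceTime m → ℂ} {h : SpaceTime m → ℂ} (hw : WeakSol Q w G h) :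
    EqOnTest U (opM₂ s η (ofFun Q fun z => (Real.exp (-s * η z) : ℂ) * w z))
      fun z => (Real.exp (-s * η z) : ℂ) * transport s η z (w z) (fun j => G j z) := by
  intro φ hφ
  have hφQ := hφ.mono hUQ
  have hv := hw.mul hQ subset_rfl
    (fun z hz => (contDiffAt_expWeight (s := s) (hη z hz)).contDiffWithinAt) inter_subset_right
  have t1 : IsTest Q fun z => ((s * pderiv timeDir η z : ℝ) : ℂ) * φ z :=
    hφQ.mul hQ (fun z hz => (contDiffAt_ofReal (contDiffAt_const.mul
      (contDiffAt_pderiv (hη z hz) _))).contDiffWithinAt) inter_subset_right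
  have t2 : ∀ j, IsTest Q fun z => ((2 * s * pderiv (stDir j) η z : ℝ) : ℂ) * φ z := fun j =>
    hφQ.mul hQ (fun z hz => (contDiffAt_ofReal (contDiffAt_const.mul
      (contDiffAt_pderiv (hη z hz) _))).contDiffWithinAt) inter_subset_right
  have t3 : IsTest Q fun z =>
      ((s * ∑ j : Fin (m + 1), pderiv (stDir j) (pderiv (stDir j) η) z : ℝ) : ℂ) * φ z :=
    hφQ.mul hQ (fun z hz => (contDiffAt_ofReal (contDiffAt_const.mul (ContDiffAt.sum fun j _ =>
      contDiffAt_pderiv (contDiffAt_pderiv (hη z hz) _) _))).contDiffWithinAt) inter_subset_right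
  have i1 := (hv.integrable _ t1).const_mul Complex.I
  have i2 := fun j => hv.integrable_grad j _ (t2 j)
  have i2s := integrable_finsetSum (μ := volume.restrict Q) Finset.univ fun j _ => i2 j
  have i3 := hv.integrable _ t3
  have i12 : IntegrableOn (fun z => Complex.I * ((Real.exp (-s * η z) : ℂ) * w z
      * (((s * pderiv timeDir η z : ℝ) : ℂ) * φ z))
      + ∑ j, mulGrad (fun y => (Real.exp (-s * η y) : ℂ)) w G j z
        * (((2 * s * pderiv (stDir j) η z : ℝ) : ℂ) * φ z)) Q := Integrable.add i1 i2s
  simp only [opM₂, Pi.add_apply, Pi.smul_apply, Finset.sum_apply]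
  simp only [dderiv, dmul, ofFun, smul_eq_mul]
  simp only [fun j => hv.grad j _ (t2 j), neg_neg]
  rw [← integral_const_mul, ← integral_finsetSum _ fun j _ => i2 j, ← integral_add i1 i2s,
    ← integral_add i12 i3, ← hφ.setIntegral_eq hQ.measurableSet hUQ]
  refine setIntegral_congr_fun hQ.measurableSet fun z hz => ?_
  simp only [mulGrad_expWeight w G (hη z hz), transport, mul_add, add_mul, Finset.mul_sum,
    Finset.sum_mul]
  congr 1
  · congr 1
    · ring
    · exact Finset.sum_congr rfl fun j _ => by ring
  · ring

end Conjugated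

end Carleman
end

noncomputable section

namespace Carleman

variable {m : ℕ}

/-! ### Norms -/

theorem memLp_of_normSqL2_ne_top {F : Type*} [NormedAddCommGroup F] {U : Set (SpaceTime m)}
    {g : SpaceTime m → F} (hg : AEStronglyMeasurable g (volume.restrict U))
    (h : normSqL2 U g ≠ ⊤) : MemLp g 2 (volume.restrict U) :=
  ⟨hg, lt_top_iff_ne_top.2 fun h' => h (by simp [normSqL2, h'])⟩

theorem norm_expWeight_smul_transversePart (y : ℝ) (v : EuclideanSpace ℂ (Fin (m + 1))) :
    ‖(Real.exp y : ℂ) • transversePart v‖ ^ 2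
      = Real.exp y ^ 2 * ∑ i : Fin m, ‖v i.castSucc‖ ^ 2 := by
  rw [norm_smul, Complex.norm_real, Real.norm_of_nonneg (Real.exp_pos _).le, mul_pow,
    EuclideanSpace.norm_sq_eq]
  rfl

theorem normSqL2_lt_top_of_le {F F' : Type*} [NormedAddCommGroup F] [NormedAddCommGroup F']
    {U V : Set (SpaceTime m)} (hU : MeasurableSet U) (hUV : U ⊆ V) {g : SpaceTime m → F}
    {g' : SpaceTime m → F'}
    (hg' : MemLp g' 2 (volume.restrict V)) (h : ∀ z ∈ U, ‖g z‖ ≤ ‖g' z‖) : normSqL2 U g < ⊤ := by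
  refine ENNReal.pow_lt_top (lt_of_le_of_lt (eLpNorm_mono_ae ?_)
    (hg'.mono_measure (Measure.restrict_mono hUV le_rfl)).2)
  filter_upwards [ae_restrict_mem hU] with z hz using h z hz

theorem lintegral_energyDensity {U : Set (SpaceTime m)} {s : ℝ} (hs : 0 ≤ s)
    {η : SpaceTime m → ℝ} (hη : Measurable η) {w h : SpaceTime m → ℂ}
    {G : SpaceTime m → EuclideanSpace ℂ (Fin (m + 1))}
    (hw : AEMeasurable w (volume.restrict U))
    (hG : ∀ j, AEMeasurable (fun z => G z j) (volume.restrict U))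
    (hh : AEMeasurable h (volume.restrict U)) :
    ∫⁻ z in U, ENNReal.ofReal (energyDensity s η z (w z) (fun j => G z j) (h z))
      = ENNReal.ofReal s
          * normSqL2 U (fun z => (Real.exp (-s * η z) : ℂ) • transversePart (G z))
        + ENNReal.ofReal (s ^ 3) * normSqL2 U (fun z => (Real.exp (-s * η z) : ℂ) * w z)
        + (normSqL2 U (fun z => (Real.exp (-s * η z) : ℂ)
            * (h z - transport s η z (w z) (fun j => G z j)))
          + normSqL2 U (fun z => (Real.exp (-s * η z) : ℂ)
            * transport s η z (w z) (fun j => G z j))) := by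
  have ht := aemeasurable_transport s η hw hG
  have hE : Measurable fun z => Real.exp (-s * η z) ^ 2 := by fun_prop
  simp only [normSqL2_eq_lintegral, norm_expWeight_mul, norm_expWeight_smul_transversePart]
  have m1 : AEMeasurable (fun z => ENNReal.ofReal (Real.exp (-s * η z) ^ 2
      * ∑ i : Fin m, ‖G z i.castSucc‖ ^ 2)) (volume.restrict U) :=
    (hE.aemeasurable.mul
      (Finset.aemeasurable_fun_sum _ fun j _ => (hG _).norm.pow_const 2)).ennreal_ofReal
  have m2 : AEMeasurable (fun z => ENNReal.ofReal (Real.exp (-s * η z) ^ 2 * ‖w z‖ ^ 2))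
      (volume.restrict U) := (hE.aemeasurable.mul (hw.norm.pow_const 2)).ennreal_ofReal
  have m3 : AEMeasurable (fun z => ENNReal.ofReal (Real.exp (-s * η z) ^ 2
      * ‖h z - transport s η z (w z) (fun j => G z j)‖ ^ 2)) (volume.restrict U) :=
    (hE.aemeasurable.mul ((hh.sub ht).norm.pow_const 2)).ennreal_ofReal
  have m12 : AEMeasurable (fun z => ENNReal.ofReal s * ENNReal.ofReal (Real.exp (-s * η z) ^ 2
      * ∑ i : Fin m, ‖G z i.castSucc‖ ^ 2)
      + ENNReal.ofReal (s ^ 3) * ENNReal.ofReal (Real.exp (-s * η z) ^ 2 * ‖w z‖ ^ 2))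
      (volume.restrict U) := (m1.const_mul _).add (m2.const_mul _)
  rw [← lintegral_add_left' m3, ← lintegral_const_mul' _ _ ENNReal.ofReal_ne_top,
    ← lintegral_const_mul' _ _ ENNReal.ofReal_ne_top, ← lintegral_add_left' (m1.const_mul _),
    ← lintegral_add_left' m12]
  refine lintegral_congr fun z => ?_
  have p1 : 0 ≤ ∑ i : Fin m, ‖G z i.castSucc‖ ^ 2 := Finset.sum_nonneg fun i _ => by positivity
  rw [← ENNReal.ofReal_mul hs, ← ENNReal.ofReal_mul (by positivity),
    ← ENNReal.ofReal_add (by positivity) (by positivity),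
    ← ENNReal.ofReal_add (by positivity) (by positivity),
    ← ENNReal.ofReal_add (by positivity) (by positivity), energyDensity]
  congr 1
  ring

end Carleman
end
-- The Carleman estimate in the cylinder
theorem proposition2p2 (m : ℕ) (hm : 2 ≤ m)
    (ω ω₂ ω₃ : Set (EuclideanSpace ℝ (Fin m)))
    (hω : IsOpen ω) (hωc : IsConnected ω) (hωb : Bornology.IsBounded ω)
    (hω₂ : IsOpen ω₂) (hω₃ : IsOpen ω₃) (hω₂ω : ω₂ ⊆ ω) (hω₃ω₂ : ω₃ ⊂ ω₂)
    (hfr₂ : frontier ω ⊆ frontier ω₂) (hfr₃ : frontier ω ⊆ frontier ω₃)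
    (hsep : Disjoint (closure ω₃) (closure (ω \ ω₂)))
    (x₀ : EuclideanSpace ℝ (Fin m)) (hx₀ : x₀ ∉ closure ω)
    (r lam T M : ℝ) (hr : 1 < r) (hlam : 0 < lam) (hT : 0 < T) (hM : 0 ≤ M) :
    ∃ s₀ : ℝ, 0 < s₀ ∧ ∃ C : ℝ, 0 < C ∧
      ∀ p : Space m → ℝ,
        AEStronglyMeasurable p (volume.restrict (infCylinder ω)) →
        (∀ᵐ x ∂(volume.restrict (infCylinder ω)), |p x| ≤ M) →
      ∀ s : ℝ, s₀ ≤ s →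
      ∀ (w : SpaceTime m → ℂ) (G : SpaceTime m → EuclideanSpace ℂ (Fin (m + 1)))
        (f : SpaceTime m → ℂ),
        MemL2H10 (infCylinder ω) T w G →
        MemLp f 2 (volume.restrict (stCylinder ω T)) →
        EqOnTest (stCylinder ω T) (schrodinger (stCylinder ω T) p w) f →
      let η : SpaceTime m → ℝ := eta ω x₀ r lam T
      let Q : Set (SpaceTime m) := stCylinder ω T
      let Q₂ : Set (SpaceTime m) := stCylinder (ω \ closure ω₂) T
      let Q₃ : Set (SpaceTime m) := stCylinder (ω \ closure ω₃) T
      let v : SpaceTime m → ℂ := fun z => (Real.exp (-s * η z) : ℂ) * w z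
      ∃ g₁ g₂ : SpaceTime m → ℂ,
        MemLp g₁ 2 (volume.restrict Q₂) ∧ MemLp g₂ 2 (volume.restrict Q₂) ∧
        EqOnTest Q₂ (opM₁ s η (ofFun Q v)) g₁ ∧
        EqOnTest Q₂ (opM₂ s η (ofFun Q v)) g₂ ∧
        ENNReal.ofReal s
              * normSqL2 Q₂ (fun z => (Real.exp (-s * η z) : ℂ) • transversePart (G z))
            + ENNReal.ofReal (s ^ 3) * normSqL2 Q₂ v
            + (normSqL2 Q₂ g₁ + normSqL2 Q₂ g₂)
          ≤ ENNReal.ofReal C *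
            (normSqL2 Q (fun z => (Real.exp (-s * η z) : ℂ) * f z)
              + normSqL2 (Q₃ \ Q₂)
                  (fun z => (Real.exp (-s * η z) : ℂ) • transversePart (G z))
              + normSqL2 (Q₃ \ Q₂) v) := by
  obtain ⟨s₀, hs₀, C, hC, key⟩ := exists_carleman_localised (M := M) hω hωb hωc.nonempty hfr₃
    hsep hx₀ hr hlam hT
  refine ⟨s₀, by linarith, C, hC, ?_⟩
  intro p hpm hp s hs w G f hw hf heq η Q Q₂ Q₃ v
  have hQo : IsOpen Q := isOpen_stCylinder hω T
  have hQ₂o : IsOpen Q₂ := isOpen_stCylinder (hω.sdiff isClosed_closure) T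
  have hQ₃o : IsOpen Q₃ := isOpen_stCylinder (hω.sdiff isClosed_closure) T
  have hQ₂Q : Q₂ ⊆ Q := fun z hz => ⟨hz.1.1, hz.2⟩
  have hSm : MeasurableSet (Q₃ \ Q₂) := MeasurableSet.diff hQ₃o.measurableSet hQ₂o.measurableSet
  have hSQ : Q₃ \ Q₂ ⊆ Q := fun z hz => ⟨hz.1.1.1, hz.1.2⟩
  have hs1 : 1 ≤ s := hs₀.trans hs
  have hs0 : 0 ≤ s := by linarith
  have hη : ∀ z ∈ Q, ContDiffAt ℝ (⊤ : ℕ∞) η z := fun z hz => contDiffAt_eta ω x₀ r lam hz.2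
  have hηm : Measurable η := measurable_eta ω x₀ r lam T
  have hwL : MemLp w 2 (volume.restrict Q) := hw.memLp
  have hGL := hw.memLp_grad_apply
  obtain ⟨hpw, hpM⟩ := memLp_potential_mul hpm hp hwL
  have hsol := weakSol_of_eqOnTest hw hpw hf heq
  set h : SpaceTime m → ℂ := fun z => (p z.1 : ℂ) * w z - f z with hh
  have hhL : MemLp h 2 (volume.restrict Q) := hpw.sub hf
  have hmono : ∀ {g : SpaceTime m → ℂ}, MemLp g 2 (volume.restrict Q) → ∀ {U}, U ⊆ Q →
      AEMeasurable g (volume.restrict U) := fun hg _ hU =>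
    hg.1.aemeasurable.mono_measure (Measure.restrict_mono hU le_rfl)
  -- Here h + f = pw, so the pointwise condition is the bound |p| ≤ M.
  have hest := key s hs w (fun j z => G z j) h f hsol hwL hGL hhL hf (by
    filter_upwards [hpM] with z hz
    simpa [hh] using hz)
  have hS : ∫⁻ z in Q₃ \ Q₂, ENNReal.ofReal (Real.exp (-s * η z) ^ 2
      * (∑ i : Fin m, ‖G z i.castSucc‖ ^ 2 + ‖w z‖ ^ 2))
      = normSqL2 (Q₃ \ Q₂) (fun z => (Real.exp (-s * η z) : ℂ) • transversePart (G z))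
        + normSqL2 (Q₃ \ Q₂) v := by
    have hm : AEMeasurable (fun z => ENNReal.ofReal (Real.exp (-s * η z) ^ 2 * ‖w z‖ ^ 2))
        (volume.restrict (Q₃ \ Q₂)) := by
      have := hmono hwL hSQ
      fun_prop
    simp only [v, normSqL2_eq_lintegral, norm_expWeight_mul, norm_expWeight_smul_transversePart]
    rw [← lintegral_add_right' _ hm]
    refine lintegral_congr fun z => ?_
    have p1 : 0 ≤ ∑ i : Fin m, ‖G z i.castSucc‖ ^ 2 := Finset.sum_nonneg fun i _ => by positivity
    rw [mul_add, ENNReal.ofReal_add (by positivity) (by positivity)]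
  rw [lintegral_energyDensity hs0 hηm (hmono hwL hQ₂Q) (fun j => hmono (hGL j) hQ₂Q)
    (hmono hhL hQ₂Q), lintegral_eq_normSqL2, hS] at hest
  replace hest := hest.trans_eq (congrArg _ (add_assoc _ _ _).symm)
  have hexp : ∀ z ∈ Q, Real.exp (-s * η z) ≤ 1 := fun z hz => by
    obtain ⟨c, hc, hlow⟩ := eta_lower_bound hωb hωc.nonempty hx₀ hr hlam
    have hq : 0 < T ^ 2 - z.2 ^ 2 := by nlinarith [hz.2.1, hz.2.2]
    exact exp_neg_mul_le_one hs1 (le_trans (by positivity) (hlow T z hz))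
  have hle : ∀ z ∈ Q, ∀ c : ℂ, ‖(Real.exp (-s * η z) : ℂ) * c‖ ≤ ‖c‖ := fun z hz c => by
    rw [norm_mul, Complex.norm_real, Real.norm_of_nonneg (Real.exp_pos _).le]
    exact mul_le_of_le_one_left (norm_nonneg _) (hexp z hz)
  have hleG : ∀ z ∈ Q, ‖(Real.exp (-s * η z) : ℂ) • transversePart (G z)‖ ≤ ‖G z‖ := by
    intro z hz
    refine abs_le_of_sq_le_sq' ?_ (norm_nonneg _) |>.2
    rw [norm_expWeight_smul_transversePart, EuclideanSpace.norm_sq_eq (G z), Fin.sum_univ_castSucc]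
    have p1 : 0 ≤ ∑ i : Fin m, ‖G z i.castSucc‖ ^ 2 := Finset.sum_nonneg fun i _ => by positivity
    have p2 := sq_nonneg ‖G z (Fin.last m)‖
    have p3 : Real.exp (-s * η z) ^ 2 ≤ 1 := pow_le_one₀ (Real.exp_pos _).le (hexp z hz)
    nlinarith
  -- The right side is finite because e^{-sη} ≤ 1. Through the estimate itself this yields the
  -- membership of M₁e^{-sη}w and M₂e^{-sη}w in L²(Q₂).
  have hfin : ENNReal.ofReal C * (normSqL2 Q (fun z => (Real.exp (-s * η z) : ℂ) * f z)
      + normSqL2 (Q₃ \ Q₂) (fun z => (Real.exp (-s * η z) : ℂ) • transversePart (G z))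
      + normSqL2 (Q₃ \ Q₂) v) ≠ ⊤ := by
    refine ENNReal.mul_ne_top ENNReal.ofReal_ne_top (ENNReal.add_ne_top.2
      ⟨ENNReal.add_ne_top.2 ⟨?_, ?_⟩, ?_⟩)
    · exact (normSqL2_lt_top_of_le hQo.measurableSet subset_rfl hf fun z hz => hle z hz _).ne
    · exact (normSqL2_lt_top_of_le hSm hSQ hw.memLp_grad fun z hz => hleG z (hSQ hz)).ne
    · exact (normSqL2_lt_top_of_le hSm hSQ hwL fun z hz => hle z (hSQ hz) _).ne
  have hLfin := ne_top_of_le_ne_top hfin hest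
  have hWm : Measurable fun z => (Real.exp (-s * η z) : ℂ) := by fun_prop
  have htm := aemeasurable_transport s η (hmono hwL hQ₂Q) (fun j => hmono (hGL j) hQ₂Q)
  have hg := ENNReal.add_ne_top.1 (ENNReal.add_ne_top.1 hLfin).2
  exact ⟨_, _,
    memLp_of_normSqL2_ne_top (hWm.aemeasurable.mul
      ((hmono hhL hQ₂Q).sub htm)).aestronglyMeasurable hg.1,
    memLp_of_normSqL2_ne_top (hWm.aemeasurable.mul htm).aestronglyMeasurable hg.2,
    eqOnTest_opM₁ hQo hQ₂Q hη hsol, eqOnTest_opM₂ hQo hQ₂Q hη hsol, hest⟩
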